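/- An m-graph $G$ is an acyclic graph with directed edges and (symmetric, loop-free) bidirected edges whose vertices are partitioned into sets $\mathbf V_o,\mathbf V_m,\mathbf R$, together with a bijection $V\mapsto R_V$ from $\mathbf V_m$ to $\mathbf R$, such that no vertex of $\mathbf R$ is a parent of a vertex of $\mathbf V_o\cup\mathbf V_m$; for a set $\mathbf C$ of vertices, $\mathbf R_{\mathbf C}=\{R_V : V\in\mathbf C\cap\mathbf V_m\}$. $De(\mathbf C)_G$ and $An(\mathbf C)_G$ are the sets of descendants and of ancestors of $\mathbf C$ in $G$, including $\mathbf C$ (the subscript is omitted for the given m-graph), $G_{\overline{\mathbf X}}$ and $G_{\underline{\mathbf X}}$ arise from $G$ by deleting all edges with an arrowhead at a vertex of $\mathbf X$, respectively all directed edges out of vertices of $\mathbf X$, and $(\mathbf A\perp\mathbf B\mid\mathbf C)_G$ denotes d-separation in $G$. The algorithm FindMinAdjSet takes an m-graph $G$ and disjoint sets $\mathbf X,\mathbf Y\subseteq\mathbf V_o\cup\mathbf V_m$ and executes the following lines. 1. $G'\gets$ the proper backdoor graph, that is, $G$ without the first edge of every directed path from $\mathbf X$ to $\mathbf Y$ that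 meets $\mathbf X$ only in its first vertex; 2. $\mathbf E\gets(\mathbf V_o\cup\mathbf V_m)\setminus(\mathbf X\cup\mathbf Y\cup D)$, where $D=De\big((De(\mathbf X)_{G_{\overline{\mathbf X}}}\setminus\mathbf X)\cap An(\mathbf Y)_{G_{\overline{\mathbf X}}}\big)$; 3. $\mathbf E'\gets\{E\in\mathbf E : E\in\mathbf V_o$, or $E\in\mathbf V_m$ and $(R_E\perp\mathbf Y\mid\mathbf X)_{G'_{\overline{\mathbf X}}}\}$; 4. $\mathbf E''\gets\{E\in\mathbf E' : E\in\mathbf V_o$, or $E\in\mathbf V_m$ and $(\mathbf X\cap An(R_E)\perp\mathbf Y)_{G'_{\underline{\mathbf X}}}\}$; 5. $W\gets$ weight $1$ for all variables; 6. $\mathbf I\gets\emptyset$; 7. $\mathbf N\gets \mathrm{FindMinCostSep}(G',\mathbf X,\mathbf Y,\mathbf I,\mathbf E'',W)$: a set $\mathbf N$ of minimum total weight among the sets with $\mathbf I\subseteq\mathbf N\subseteq\mathbf E''$ and $(\mathbf X\perp\mathbf Y\mid\mathbf N)_{G'}$, or failure if there is no such set; 8. return $\mathbf N\cup\mathbf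 R_{\mathbf N}$ (or failure). Theorem. FindMinAdjSet has time complexity $O(n^3)$, where $n$ is the number of vertices of $G$. That is, there are a random access machine program that executes these lines one after the other and a function $T$ with $T(n)=O(n^3)$ such that on every input $(G,\mathbf X,\mathbf Y)$ with $n$ vertices, given by adjacency matrices and characteristic vectors, the program halts after at most $T(n)$ steps, after the code of each line the memory holds the value that the line assigns, and the value returned is held in memory at the end. Here the machine has registers and two-dimensional arrays of natural numbers, its elementary instructions (setting a register to a literal, copying, adding or subtracting one, loading or storing an array cell) and its tests (comparing two registers) take one step each. -/

import Mathlib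

namespace MissingData

/-! ## Graphs with directed and bidirected edges, and d-separation -/

/-- A graph with directed edges `u → v` and bidirected edges `u ↔ v` (a bidirected edge stands for
an unobserved common cause). -/
structure MixedGraph (V : Type) where
  /-- `dir u v` : there is a directed edge `u → v`. -/
  dir : V → V → Prop
  /-- `bi u v` : there is a bidirected edge `u ↔ v`. -/
  bi : V → V → Prop

/-- The three ways to traverse an edge from `u` to `v`: `u → v`, `u ← v` and `u ↔ v`. -/
inductive EdgeType where
  | right
  | left
  | both

/-- The edge has an arrowhead at the vertex it is traversed to. -/
def EdgeType.headAtTarget : EdgeType → Prop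
  | .right => True
  | .left => False
  | .both => True

/-- The edge has an arrowhead at the vertex it is traversed from. -/
def EdgeType.headAtSource : EdgeType → Prop
  | .right => False
  | .left => True
  | .both => True

namespace MixedGraph

variable {V : Type}

/-- `De(C)`: the descendants of `C`, including `C`. -/
def De (G : MixedGraph V) (C : Set V) : Set V :=
  {v | ∃ c ∈ C, Relation.ReflTransGen G.dir c v}

/-- `An(C)`: the ancestors of `C`, including `C`. -/
def An (G : MixedGraph V) (C : Set V) : Set V :=
  {v | ∃ c ∈ C, Relation.ReflTransGen G.dir v c}

/-- `G` with all edges that have an arrowhead at a vertex of `X` deleted. -/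
def deleteInto (G : MixedGraph V) (X : Set V) : MixedGraph V where
  dir u v := G.dir u v ∧ v ∉ X
  bi u v := G.bi u v ∧ u ∉ X ∧ v ∉ X

/-- `G` with all directed edges that leave a vertex of `X` deleted. -/
def deleteOutOf (G : MixedGraph V) (X : Set V) : MixedGraph V where
  dir u v := G.dir u v ∧ u ∉ X
  bi u v := G.bi u v

/-- The directed edge `x → w` is the first edge of a proper causal path from `X` to `Y`, that is,
of a directed path from `X` to `Y` that meets `X` only in its first vertex. -/
def IsFirstProperEdge (G : MixedGraph V) (X Y : Set V) (x w : V) : Prop :=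
  x ∈ X ∧ G.dir x w ∧ w ∉ X ∧
    ∃ y ∈ Y, Relation.ReflTransGen (fun u v => G.dir u v ∧ v ∉ X) w y

/-- The proper backdoor graph: the first edge of every proper causal path from `X` to `Y` is
removed. -/
def properBackdoor (G : MixedGraph V) (X Y : Set V) : MixedGraph V where
  dir u v := G.dir u v ∧ ¬ G.IsFirstProperEdge X Y u v
  bi u v := G.bi u v

/-- `Dpcp(X, Y) = De((De(X) ∖ X) ∩ An(Y))`, the inner `De` and `An` being those of the graph
without the edges into `X`. -/
def Dpcp (G : MixedGraph V) (X Y : Set V) : Set V :=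
  G.De (((G.deleteInto X).De X \ X) ∩ (G.deleteInto X).An Y)

/-- `G` has an edge of the given type from `u` to `v`. -/
def HasEdge (G : MixedGraph V) (e : EdgeType) (u v : V) : Prop :=
  match e with
  | .right => G.dir u v
  | .left => G.dir v u
  | .both => G.bi u v

/-- The list of edges, each given with the vertex that it leads to, is a walk starting in `u`. -/
def IsWalkFrom (G : MixedGraph V) : V → List (EdgeType × V) → Prop
  | _, [] => True
  | u, (e, v) :: p => G.HasEdge e u v ∧ G.IsWalkFrom v p

/-- The sequence of vertices of a walk starting in `u`. -/
def walkVertices (u : V) (p : List (EdgeType × V)) : List V :=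
  u :: p.map Prod.snd

/-- `p` is a path (without repeated vertices) from `u` to `v`. -/
def IsPath (G : MixedGraph V) (u v : V) (p : List (EdgeType × V)) : Prop :=
  G.IsWalkFrom u p ∧ (walkVertices u p).Nodup ∧ (walkVertices u p).getLast? = some v

/-- `p` is not blocked by `Z`: every inner vertex of `p` that is a collider has a descendant
(possibly itself) in `Z`, and no inner vertex that is not a collider lies in `Z`. -/
def IsUnblocked (G : MixedGraph V) (Z : Set V) : List (EdgeType × V) → Prop
  | [] => True
  | [_] => True
  | (e, v) :: (f, w) :: p =>
      ((e.headAtTarget ∧ f.headAtSource) → (G.De {v} ∩ Z).Nonempty) ∧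
      (¬ (e.headAtTarget ∧ f.headAtSource) → v ∉ Z) ∧
      G.IsUnblocked Z ((f, w) :: p)

/-- `A` and `B` are d-separated by `Z`: every path between them is blocked by `Z`. -/
def DSep (G : MixedGraph V) (A B Z : Set V) : Prop :=
  ∀ a ∈ A, ∀ b ∈ B, ∀ p, G.IsPath a b p → ¬ G.IsUnblocked Z p

/-- The sets `Z` with `I ⊆ Z ⊆ E` that d-separate `X` and `Y`. -/
def Separators (G : MixedGraph V) (X Y I E : Set V) : Set (Finset V) :=
  {Z | G.DSep X Y (Z : Set V) ∧ I ⊆ (Z : Set V) ∧ (Z : Set V) ⊆ E}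

/-- What a call of `FindMinCostSep` may return: a separator `Z`, `I ⊆ Z ⊆ E`, of minimum weight,
or `none` (failure) if there is no such separator. -/
def IsFindMinCostSepOutput (G : MixedGraph V) (X Y I E : Set V) (w : V → ℕ) :
    Option (Finset V) → Prop
  | some Z => Z ∈ G.Separators X Y I E ∧
      ∀ U ∈ G.Separators X Y I E, ∑ v ∈ Z, w v ≤ ∑ v ∈ U, w v
  | none => G.Separators X Y I E = ∅

end MixedGraph

/-! ## m-graphs and the values that the algorithm assigns to its variables -/

/-- An m-graph on `n` variables, which are numbered from `0` to `n - 1`: an acyclic graph with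
directed and bidirected edges whose vertices are partitioned into the always observed variables
`Vo`, the partially observed variables `Vm` and the missingness indicators `R`; each `v ∈ Vm` has
its own indicator `ind v ∈ R`, and indicators are not parents of other variables. -/
structure MGraph (n : ℕ) extends MixedGraph (Fin n) where
  acyclic : ∀ v, ¬ Relation.TransGen dir v v
  bi_symm : ∀ u v, bi u v → bi v u
  bi_irrefl : ∀ v, ¬ bi v v
  Vo : Set (Fin n)
  Vm : Set (Fin n)
  R : Set (Fin n)
  disjoint_Vo_Vm : Disjoint Vo Vm
  disjoint_V_R : Disjoint (Vo ∪ Vm) R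
  cover : Vo ∪ Vm ∪ R = Set.univ
  /-- The indicator of a variable in `Vm` (irrelevant outside `Vm`). -/
  ind : Fin n → Fin n
  ind_bijOn : Set.BijOn ind Vm R
  indicator_not_parent : ∀ r ∈ R, ∀ v ∈ Vo ∪ Vm, ¬ dir r v

namespace MGraph

variable {n : ℕ}

/-- The graph assigned to `G'`. -/
def pbd (G : MGraph n) (X Y : Set (Fin n)) : MixedGraph (Fin n) :=
  G.toMixedGraph.properBackdoor X Y

/-- The set assigned to `E`. -/
def setE (G : MGraph n) (X Y : Set (Fin n)) : Set (Fin n) :=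
  (G.Vo ∪ G.Vm) \ (X ∪ Y ∪ G.Dpcp X Y)

/-- The set assigned to `E'`. -/
def setE1 (G : MGraph n) (X Y : Set (Fin n)) : Set (Fin n) :=
  {v ∈ G.setE X Y | v ∈ G.Vo ∨
    (v ∈ G.Vm ∧ ((G.pbd X Y).deleteInto X).DSep {G.ind v} Y X)}

/-- The set assigned to `E''`; the ancestors are those in the input graph. -/
def setE2 (G : MGraph n) (X Y : Set (Fin n)) : Set (Fin n) :=
  {v ∈ G.setE1 X Y | v ∈ G.Vo ∨
    (v ∈ G.Vm ∧ ((G.pbd X Y).deleteOutOf X).DSep (X ∩ G.An {G.ind v}) Y ∅)}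

/-- `N ∪ R_N`, where `R_N` consists of the indicators of the variables in `N ∩ Vm`. -/
def withIndicators (G : MGraph n) (N : Set (Fin n)) : Set (Fin n) :=
  N ∪ G.ind '' (N ∩ G.Vm)

end MGraph

/-! ## The machine model

A random access machine with registers and two-dimensional arrays of natural numbers. The only
arithmetic is adding or subtracting one, so that numbers exceed the inputs and the literals of the
program by at most the number of steps made: words of logarithmic length suffice for computations
in polynomial time. Each elementary instruction and each test is one step. -/

/-- The contents of the memory: registers `reg x` and array cells `arr a i j`. -/
structure State where
  reg : ℕ → ℕ
  arr : ℕ → ℕ → ℕ → ℕ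

/-- `s` with register `x` set to `k`. -/
def State.setReg (s : State) (x k : ℕ) : State where
  reg y := if y = x then k else s.reg y
  arr := s.arr

/-- `s` with cell `(i, j)` of array `a` set to `k`. -/
def State.setArr (s : State) (a i j k : ℕ) : State where
  reg := s.reg
  arr b p q := if b = a ∧ p = i ∧ q = j then k else s.arr b p q

/-- Tests compare two registers. -/
inductive Test where
  | lt (x y : ℕ)
  | eq (x y : ℕ)

/-- The test succeeds in state `s`. -/
def Test.Holds (s : State) : Test → Prop
  | .lt x y => s.reg x < s.reg y
  | .eq x y => s.reg x = s.reg y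

/-- Programs; `x`, `y`, `i`, `j` name registers and `a` names an array. -/
inductive Prog where
  /-- do nothing -/
  | skip
  /-- `x := k` for a literal `k` -/
  | const (x k : ℕ)
  /-- `x := y` -/
  | copy (x y : ℕ)
  /-- `x := x + 1` -/
  | succ (x : ℕ)
  /-- `x := x - 1` (zero stays zero) -/
  | pred (x : ℕ)
  /-- `x := a[i, j]` -/
  | load (x a i j : ℕ)
  /-- `a[i, j] := x` -/
  | store (a i j x : ℕ)
  | seq (p q : Prog)
  | ite (b : Test) (p q : Prog)
  | loop (b : Test) (p : Prog)

/-- `Exec p s t u`: started in state `s`, the program `p` halts after exactly `t` steps in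
state `u`. `loop b p` is the loop `while b do p`. -/
inductive Exec : Prog → State → ℕ → State → Prop where
  | skip (s : State) : Exec .skip s 1 s
  | const (x k : ℕ) (s : State) : Exec (.const x k) s 1 (s.setReg x k)
  | copy (x y : ℕ) (s : State) : Exec (.copy x y) s 1 (s.setReg x (s.reg y))
  | succ (x : ℕ) (s : State) : Exec (.succ x) s 1 (s.setReg x (s.reg x + 1))
  | pred (x : ℕ) (s : State) : Exec (.pred x) s 1 (s.setReg x (s.reg x - 1))
  | load (x a i j : ℕ) (s : State) :
      Exec (.load x a i j) s 1 (s.setReg x (s.arr a (s.reg i) (s.reg j)))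
  | store (a i j x : ℕ) (s : State) :
      Exec (.store a i j x) s 1 (s.setArr a (s.reg i) (s.reg j) (s.reg x))
  | seq {p q : Prog} {s u v : State} {t₁ t₂ : ℕ} :
      Exec p s t₁ u → Exec q u t₂ v → Exec (.seq p q) s (t₁ + t₂) v
  | ite_true {b : Test} {p q : Prog} {s u : State} {t : ℕ} :
      b.Holds s → Exec p s t u → Exec (.ite b p q) s (t + 1) u
  | ite_false {b : Test} {p q : Prog} {s u : State} {t : ℕ} :
      ¬ b.Holds s → Exec q s t u → Exec (.ite b p q) s (t + 1) u
  | loop_true {b : Test} {p : Prog} {s u v : State} {t₁ t₂ : ℕ} :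
      b.Holds s → Exec p s t₁ u → Exec (.loop b p) u t₂ v →
        Exec (.loop b p) s (t₁ + t₂ + 1) v
  | loop_false {b : Test} {p : Prog} {s : State} :
      ¬ b.Holds s → Exec (.loop b p) s 1 s

/-! ## Data in memory -/

open Classical in
/-- `1` if `p` is true and `0` otherwise. -/
noncomputable def truthValue (p : Prop) : ℕ := if p then 1 else 0

/-- The input: register `0` holds the number `n` of variables, arrays `0` and `1` hold the
adjacency matrices of the directed and of the bidirected edges, the first columns of arrays
`2, …, 6` hold the characteristic vectors of `X`, `Y`, `Vo`, `Vm`, `R`, and the first column of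
array `7` holds for each variable in `Vm` its indicator. Everything else is `0`. -/
noncomputable def inputState {n : ℕ} (G : MGraph n) (X Y : Set (Fin n)) : State where
  reg x := if x = 0 then n else 0
  arr a i j :=
    if hi : i < n then
      let u : Fin n := ⟨i, hi⟩
      match a with
      | 0 => if hj : j < n then truthValue (G.dir u ⟨j, hj⟩) else 0
      | 1 => if hj : j < n then truthValue (G.bi u ⟨j, hj⟩) else 0
      | 2 => if j = 0 then truthValue (u ∈ X) else 0
      | 3 => if j = 0 then truthValue (u ∈ Y) else 0
      | 4 => if j = 0 then truthValue (u ∈ G.Vo) else 0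
      | 5 => if j = 0 then truthValue (u ∈ G.Vm) else 0
      | 6 => if j = 0 then truthValue (u ∈ G.R) else 0
      | 7 => if j = 0 then truthValue (u ∈ G.Vm) * (G.ind u : ℕ) else 0
      | _ => 0
    else 0

/-- Array `a` holds the matrix of the relation `r`. -/
def State.HoldsRel {n : ℕ} (s : State) (a : ℕ) (r : Fin n → Fin n → Prop) : Prop :=
  ∀ u v : Fin n, s.arr a u v = truthValue (r u v)

/-- The first column of array `a` holds the characteristic vector of `S`. -/
def State.HoldsSet {n : ℕ} (s : State) (a : ℕ) (S : Set (Fin n)) : Prop :=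
  ∀ v : Fin n, s.arr a v 0 = truthValue (v ∈ S)

/-- The first column of array `a` holds the numbers `w`. -/
def State.HoldsFun {n : ℕ} (s : State) (a : ℕ) (w : Fin n → ℕ) : Prop :=
  ∀ v : Fin n, s.arr a v 0 = w v

/-- Register `x` holds `0` for failure; or it holds `1` and array `a` holds the set. -/
def State.HoldsOption {n : ℕ} (s : State) (x a : ℕ) : Option (Set (Fin n)) → Prop
  | some S => s.reg x = 1 ∧ s.HoldsSet a S
  | none => s.reg x = 0

/-! ## FindMinAdjSet -/

/-- Machine code for the eight lines of `FindMinAdjSet`. -/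
structure Code where
  /-- `G' ← ` proper backdoor graph -/
  line2 : Prog
  /-- `E ← (Vo ∪ Vm) ∖ (X ∪ Y ∪ Dpcp(X, Y))` -/
  line3 : Prog
  /-- `E' ← {v ∈ E | v ∈ Vo, or v ∈ Vm and R_v is d-separated from Y by X in G' without the edges
  into X}` -/
  line4 : Prog
  /-- `E'' ← {v ∈ E' | v ∈ Vo, or v ∈ Vm and X ∩ An(R_v) is d-separated from Y in G' without the
  edges out of X}` -/
  line5 : Prog
  /-- `W ← 1` for all variables -/
  line6 : Prog
  /-- `I ← ∅` -/
  line7 : Prog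
  /-- `N ← FindMinCostSep(G', X, Y, I, E'', W)` -/
  line8 : Prog
  /-- return `N ∪ R_N` (failure if `N` is failure) -/
  line9 : Prog

/-- The whole program: the lines are executed one after the other. -/
def Code.program (c : Code) : Prog :=
  .seq c.line2 <| .seq c.line3 <| .seq c.line4 <| .seq c.line5 <|
    .seq c.line6 <| .seq c.line7 <| .seq c.line8 c.line9

/-- The run of `c` on `(G, X, Y)` halts after `t` steps and is a run of `FindMinAdjSet`: when a
line has been executed, the memory holds the value which that line assigns to its variable.
The variables are kept as follows: `G'` in arrays `8` and `9`, `E`, `E'`, `E''` in arrays `10`,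
`11`, `12`, `W` in array `13`, `I` in array `14`, `N` in array `15` with register `1`, the value
that is returned in array `16` with register `2`. -/
def Code.RunsFindMinAdjSet (c : Code) {n : ℕ} (G : MGraph n) (X Y : Set (Fin n)) (t : ℕ) : Prop :=
  ∃ (s₂ s₃ s₄ s₅ s₆ s₇ s₈ s₉ : State) (t₂ t₃ t₄ t₅ t₆ t₇ t₈ t₉ : ℕ) (N : Option (Finset (Fin n))),
    (Exec c.line2 (inputState G X Y) t₂ s₂ ∧
      s₂.HoldsRel 8 (G.pbd X Y).dir ∧ s₂.HoldsRel 9 (G.pbd X Y).bi) ∧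
    (Exec c.line3 s₂ t₃ s₃ ∧ s₃.HoldsSet 10 (G.setE X Y)) ∧
    (Exec c.line4 s₃ t₄ s₄ ∧ s₄.HoldsSet 11 (G.setE1 X Y)) ∧
    (Exec c.line5 s₄ t₅ s₅ ∧ s₅.HoldsSet 12 (G.setE2 X Y)) ∧
    (Exec c.line6 s₅ t₆ s₆ ∧ s₆.HoldsFun 13 (fun _ : Fin n => 1)) ∧
    (Exec c.line7 s₆ t₇ s₇ ∧ s₇.HoldsSet 14 (∅ : Set (Fin n))) ∧
    (Exec c.line8 s₇ t₈ s₈ ∧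
      (G.pbd X Y).IsFindMinCostSepOutput X Y ∅ (G.setE2 X Y) (fun _ => 1) N ∧
      s₈.HoldsOption 1 15 (N.map fun Z => (Z : Set (Fin n)))) ∧
    (Exec c.line9 s₈ t₉ s₉ ∧
      s₉.HoldsOption 2 16 (N.map fun Z => G.withIndicators (Z : Set (Fin n)))) ∧
    Exec c.program (inputState G X Y) t s₉

end MissingData

namespace MissingData

/-! The cubic bound is read off from syntax. Each line is written in a small language (`Cmd`) of
bounded loops whose assignments evaluate first-order formulas (`Formula`) with quantifiers over the
vertices. Compiled code simulates a command (`Cmd.exec_prog`) within `C * (n + 1) ^ depth` steps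
(`Cmd.exists_cost_le`), where `depth` counts nested loops and quantifiers. It remains to describe
each line by commands of depth at most three.

Reachability is Warshall's algorithm (`Cmd.holdsRel_closure`). The d-separation tests for `E'` and
`E''` condition on a set that no edge points into, or on the empty set. No collider can then be
open, so d-connection means that there is a trek (`MixedGraph.openGiven_iff_trek`), and treks for
all variables are found together from one closure.

For the minimum separator, d-separation by candidates is replaced by separation in the moral graph
of the ancestors of `X ∪ Y` (`MixedGraph.dSep_of_moral`, `MixedGraph.DSep.moral`). Let `M` be the
set of candidate ancestors. Contracting everything outside `M` leaves a relation on `M`, together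
with the vertices `S` first met from `X` and the vertices `T` last met before `Y`. A cut arises from
two sides `a ⊇ S` and `b ⊇ T` with `a ∪ b = M`, and has size `|a| + |b| - |M|`; the parts `b \ T`
and `a \ S` form a vertex cover of the bipartite graph `cutGraph`. Minimum cuts thus come from
minimum vertex covers (`coverCut_separates`, `ncard_coverCut_le`), and these by König's argument
from maximum matchings (`Stuck`). Such a matching is found in `n + 1` phases of quadratic cost
(`Cmd.run_maxMatching`). -/

theorem truthValue_eq_one {p : Prop} : truthValue p = 1 ↔ p := by
  unfold truthValue; split <;> simp_all

theorem truthValue_of_true {p : Prop} (h : p) : truthValue p = 1 := truthValue_eq_one.2 h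

theorem truthValue_of_false {p : Prop} (h : ¬ p) : truthValue p = 0 := by
  simp [truthValue, h]

theorem truthValue_congr {p q : Prop} (h : p ↔ q) : truthValue p = truthValue q := by
  rw [propext h]

namespace State

@[simp] theorem setReg_reg (s : State) (x k y : ℕ) :
    (s.setReg x k).reg y = if y = x then k else s.reg y := rfl

@[simp] theorem setReg_arr (s : State) (x k : ℕ) : (s.setReg x k).arr = s.arr := rfl

@[simp] theorem setArr_reg (s : State) (a i j k : ℕ) : (s.setArr a i j k).reg = s.reg := rfl

@[simp] theorem setArr_arr (s : State) (a i j k b p q : ℕ) :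
    (s.setArr a i j k).arr b p q = if b = a ∧ p = i ∧ q = j then k else s.arr b p q := rfl

end State

/-! ## Formulas and their evaluation -/

/-- First-order formulas about the memory; quantifiers range over numbers below `n`, which are
placed in a register. -/
inductive Formula where
  /-- `a[i, j] = 1` -/
  | cell (a i j : ℕ)
  /-- `a[i, j] = x` -/
  | cellEq (a i j x : ℕ)
  | eq (x y : ℕ)
  | neg (φ : Formula)
  | conj (φ ψ : Formula)
  | disj (φ ψ : Formula)
  | ex (x : ℕ) (φ : Formula)

namespace Formula

/-- Truth of a formula in a state. -/
def Holds (n : ℕ) : Formula → State → Prop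
  | cell a i j, s => s.arr a (s.reg i) (s.reg j) = 1
  | cellEq a i j x, s => s.arr a (s.reg i) (s.reg j) = s.reg x
  | eq x y, s => s.reg x = s.reg y
  | neg φ, s => ¬ φ.Holds n s
  | conj φ ψ, s => φ.Holds n s ∧ ψ.Holds n s
  | disj φ ψ, s => φ.Holds n s ∨ ψ.Holds n s
  | ex x φ, s => ∃ k : Fin n, φ.Holds n (s.setReg x k)

/-- The registers that occur in a formula. -/
def regs : Formula → List ℕ
  | cell _ i j => [i, j]
  | cellEq _ i j x => [i, j, x]
  | eq x y => [x, y]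
  | neg φ => φ.regs
  | conj φ ψ => φ.regs ++ ψ.regs
  | disj φ ψ => φ.regs ++ ψ.regs
  | ex x φ => x :: φ.regs

/-- The registers that are bound by a quantifier. -/
def bound : Formula → List ℕ
  | cell _ _ _ => []
  | cellEq _ _ _ _ => []
  | eq _ _ => []
  | neg φ => φ.bound
  | conj φ ψ => φ.bound ++ ψ.bound
  | disj φ ψ => φ.bound ++ ψ.bound
  | ex x φ => x :: φ.bound

/-- The arrays that occur in a formula. -/
def arrs : Formula → List ℕ
  | cell a _ _ => [a]
  | cellEq a _ _ _ => [a]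
  | eq _ _ => []
  | neg φ => φ.arrs
  | conj φ ψ => φ.arrs ++ ψ.arrs
  | disj φ ψ => φ.arrs ++ ψ.arrs
  | ex _ φ => φ.arrs

/-- The number of nested quantifiers. -/
def depth : Formula → ℕ
  | cell _ _ _ => 0
  | cellEq _ _ _ _ => 0
  | eq _ _ => 0
  | neg φ => φ.depth
  | conj φ ψ => max φ.depth ψ.depth
  | disj φ ψ => max φ.depth ψ.depth
  | ex _ φ => φ.depth + 1

/-- A bound for the number of steps of the evaluation. -/
def cost (n : ℕ) : Formula → ℕ
  | cell _ _ _ => 10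
  | cellEq _ _ _ _ => 10
  | eq _ _ => 10
  | neg φ => φ.cost n + 10
  | conj φ ψ => φ.cost n + ψ.cost n + 10
  | disj φ ψ => φ.cost n + ψ.cost n + 10
  | ex _ φ => n * (φ.cost n + 10) + 10

/-- Code that evaluates a formula, with the truth value in register `d`; the registers below `d`
are left as they were. -/
def prog : Formula → ℕ → Prog
  | cell a i j, d => .seq (.load d a i j) (.seq (.const (d + 1) 1)
      (.ite (.eq d (d + 1)) (.const d 1) (.const d 0)))
  | cellEq a i j x, d => .seq (.load d a i j) (.ite (.eq d x) (.const d 1) (.const d 0))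
  | eq x y, d => .ite (.eq x y) (.const d 1) (.const d 0)
  | neg φ, d => .seq (φ.prog d) (.seq (.const (d + 1) 1)
      (.ite (.eq d (d + 1)) (.const d 0) (.const d 1)))
  | conj φ ψ, d => .seq (φ.prog d) (.seq (.const (d + 1) 1)
      (.ite (.eq d (d + 1)) (ψ.prog d) (.const d 0)))
  | disj φ ψ, d => .seq (φ.prog d) (.seq (.const (d + 1) 1)
      (.ite (.eq d (d + 1)) (.const d 1) (ψ.prog d)))
  | ex x φ, d => .seq (.copy d x) (.seq (.const (d + 1) 0) (.seq (.const x 0)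
      (.seq (.loop (.lt x 0) (.seq (φ.prog (d + 2)) (.seq (.const (d + 3) 1)
        (.seq (.ite (.eq (d + 2) (d + 3)) (.const (d + 1) 1) .skip) (.succ x)))))
      (.seq (.copy x d) (.copy d (d + 1))))))

theorem holds_congr {n : ℕ} (φ : Formula) {s s' : State}
    (ha : ∀ a ∈ φ.arrs, s.arr a = s'.arr a) (hr : ∀ x ∈ φ.regs, s.reg x = s'.reg x) :
    φ.Holds n s ↔ φ.Holds n s' := by
  induction φ generalizing s s' with
  | cell a i j => simp_all [Holds, arrs, regs]
  | cellEq a i j x => simp_all [Holds, arrs, regs]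
  | eq x y => simp_all [Holds, arrs, regs]
  | neg φ ih => exact not_congr (ih ha hr)
  | conj φ ψ ih₁ ih₂ =>
    simp only [arrs, regs, List.mem_append] at ha hr
    exact and_congr (ih₁ (fun a h => ha a (.inl h)) fun x h => hr x (.inl h))
      (ih₂ (fun a h => ha a (.inr h)) fun x h => hr x (.inr h))
  | disj φ ψ ih₁ ih₂ =>
    simp only [arrs, regs, List.mem_append] at ha hr
    exact or_congr (ih₁ (fun a h => ha a (.inl h)) fun x h => hr x (.inl h))
      (ih₂ (fun a h => ha a (.inr h)) fun x h => hr x (.inr h))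
  | ex x φ ih =>
    refine exists_congr fun k => ih ha fun y hy => ?_
    simp only [State.setReg_reg]
    split
    · rfl
    · exact hr y (by simp [regs, hy])

/-- Conditions under which `φ.prog d` evaluates `φ` correctly. -/
def WF (d : ℕ) (φ : Formula) : Prop :=
  0 < d ∧ (∀ x ∈ φ.regs, x < d) ∧ 0 ∉ φ.bound

instance (d : ℕ) (φ : Formula) : Decidable (φ.WF d) := by unfold WF; infer_instance

end Formula

/-- From the state `s`, the program `p` puts the truth value of `P` into register `d` in at most
`c` steps and changes neither the arrays nor the registers below `d`. -/
def Evaluates (p : Prog) (d : ℕ) (s : State) (P : Prop) (c : ℕ) : Prop :=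
  ∃ t ≤ c, ∃ s', Exec p s t s' ∧ s'.arr = s.arr ∧ (∀ x < d, s'.reg x = s.reg x) ∧
    s'.reg d = truthValue P

theorem evaluates_branch {b : Test} {d k₁ k₂ : ℕ} {s : State} {P : Prop}
    (h₁ : b.Holds s → k₁ = truthValue P) (h₂ : ¬ b.Holds s → k₂ = truthValue P) :
    Evaluates (.ite b (.const d k₁) (.const d k₂)) d s P 2 := by
  by_cases hb : b.Holds s
  · refine ⟨1 + 1, le_rfl, _, .ite_true hb (.const ..), rfl, fun x hx => ?_, ?_⟩
    · simp [hx.ne]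
    · simp [h₁ hb]
  · refine ⟨1 + 1, le_rfl, _, .ite_false hb (.const ..), rfl, fun x hx => ?_, ?_⟩
    · simp [hx.ne]
    · simp [h₂ hb]

theorem Evaluates.prepend {p q : Prog} {d t c : ℕ} {s u : State} {P : Prop}
    (hp : Exec p s t u) (ha : u.arr = s.arr) (hr : ∀ x < d, u.reg x = s.reg x)
    (hq : Evaluates q d u P c) : Evaluates (.seq p q) d s P (t + c) := by
  obtain ⟨t', ht', s', he, ha', hr', hd⟩ := hq
  exact ⟨_, by omega, s', .seq hp he, ha'.trans ha, fun x hx => (hr' x hx).trans (hr x hx), hd⟩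

theorem Evaluates.mono {p : Prog} {d c c' : ℕ} {s : State} {P Q : Prop}
    (h : Evaluates p d s P c) (hc : c ≤ c') (hPQ : P ↔ Q) : Evaluates p d s Q c' := by
  obtain ⟨t, ht, h⟩ := h
  rw [truthValue_congr hPQ] at h
  exact ⟨t, by omega, h⟩

theorem evaluates_ite {b : Test} {p q : Prog} {d c : ℕ} {s : State} {P : Prop}
    (h₁ : b.Holds s → Evaluates p d s P c) (h₂ : ¬ b.Holds s → Evaluates q d s P c) :
    Evaluates (.ite b p q) d s P (c + 1) := by
  by_cases hb : b.Holds s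
  · obtain ⟨t, ht, s', he, h⟩ := h₁ hb
    exact ⟨_, by omega, s', .ite_true hb he, h⟩
  · obtain ⟨t, ht, s', he, h⟩ := h₂ hb
    exact ⟨_, by omega, s', .ite_false hb he, h⟩

theorem evaluates_const {d k : ℕ} {s : State} {P : Prop} (h : k = truthValue P) :
    Evaluates (.const d k) d s P 1 :=
  ⟨1, le_rfl, _, .const .., rfl, fun x hx => by simp [hx.ne], by simp [h]⟩

/-- Evaluation of a formula followed by code that branches on its truth value. -/
theorem Evaluates.branch {p q r : Prog} {d c c' : ℕ} {s : State} {P Q : Prop}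
    (h : Evaluates p d s P c)
    (hq : ∀ u : State, P → u.arr = s.arr → (∀ x < d, u.reg x = s.reg x) → Evaluates q d u Q c')
    (hr : ∀ u : State, ¬ P → u.arr = s.arr → (∀ x < d, u.reg x = s.reg x) →
      Evaluates r d u Q c') :
    Evaluates (.seq p (.seq (.const (d + 1) 1) (.ite (.eq d (d + 1)) q r))) d s Q
      (c + c' + 2) := by
  obtain ⟨t, ht, s', he, ha, hreg, hd⟩ := h
  have hagree : ∀ x < d, (s'.setReg (d + 1) 1).reg x = s.reg x := fun x hx => by
    simp [show x ≠ d + 1 by omega, hreg x hx]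
  have hP : (Test.eq d (d + 1)).Holds (s'.setReg (d + 1) 1) ↔ P := by
    simp [Test.Holds, hd, truthValue_eq_one]
  refine (Evaluates.prepend (t := t) (c := 1 + (c' + 1)) he ha hreg (Evaluates.prepend
    (.const ..) rfl (fun x hx => ?_) (evaluates_ite (fun hb => ?_) fun hb => ?_))).mono
      (by omega) Iff.rfl
  · simp [show x ≠ d + 1 by omega]
  · exact hq _ (hP.1 hb) ha hagree
  · exact hr _ (fun h => hb (hP.2 h)) ha hagree

/-- The body works in registers from `d + 2` on. So `d` can keep the old value of `x`, which is
restored at the end, and `d + 1` can accumulate the disjunction of the instances tried so far. -/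
theorem evaluates_ex {n d x c : ℕ} {p : Prog} {s : State} {P : ℕ → Prop}
    (h0 : s.reg 0 = n) (hx : x < d) (hx0 : x ≠ 0)
    (hp : ∀ (u : State) (k : ℕ), k < n → u.arr = s.arr →
      (∀ y < d, u.reg y = (s.setReg x k).reg y) → Evaluates p (d + 2) u (P k) c) :
    Evaluates (.seq (.copy d x) (.seq (.const (d + 1) 0) (.seq (.const x 0)
      (.seq (.loop (.lt x 0) (.seq p (.seq (.const (d + 3) 1)
        (.seq (.ite (.eq (d + 2) (d + 3)) (.const (d + 1) 1) .skip) (.succ x)))))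
      (.seq (.copy x d) (.copy d (d + 1))))))) d s (∃ k : Fin n, P k) (n * (c + 10) + 10) := by
  -- Here `k` rounds are done and `m` remain; the induction is on `m`.
  have hloop : ∀ m k : ℕ, k + m = n → ∀ u : State, u.arr = s.arr →
      (∀ y < d, u.reg y = (s.setReg x k).reg y) → u.reg d = s.reg x →
      u.reg (d + 1) = truthValue (∃ j < k, P j) →
      ∃ t ≤ m * (c + 10) + 1, ∃ u', Exec (.loop (.lt x 0) (.seq p (.seq (.const (d + 3) 1)
        (.seq (.ite (.eq (d + 2) (d + 3)) (.const (d + 1) 1) .skip) (.succ x))))) u t u' ∧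
        u'.arr = s.arr ∧ (∀ y < d, u'.reg y = (s.setReg x n).reg y) ∧ u'.reg d = s.reg x ∧
        u'.reg (d + 1) = truthValue (∃ j < n, P j) := by
    intro m
    induction m with
    | zero =>
      intro k hk u ha hr hd hf
      obtain rfl : k = n := by omega
      refine ⟨1, by omega, u, .loop_false ?_, ha, hr, hd, hf⟩
      simp [Test.Holds, hr x hx, hr 0 (by omega), h0, hx0.symm]
    | succ m ih =>
      intro k hk u ha hr hd hf
      obtain ⟨t₁, ht₁, u₁, he₁, ha₁, hr₁, hd₁⟩ := hp u k (by omega) ha hr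
      have hk' : u.reg x = k := by simp [hr x hx]
      have hu0 : u.reg 0 = n := by simp [hr 0 (by omega), hx0.symm, h0]
      have key : ∃ t₂ ≤ 2, ∃ u₂, Exec (.ite (.eq (d + 2) (d + 3)) (.const (d + 1) 1) .skip)
          (u₁.setReg (d + 3) 1) t₂ u₂ ∧ u₂.arr = s.arr ∧ (∀ y < d + 1, u₂.reg y = u.reg y) ∧
          u₂.reg (d + 1) = truthValue (∃ j < k + 1, P j) := by
        by_cases hP : P k
        · refine ⟨1 + 1, le_rfl, _, .ite_true ?_ (.const ..), ?_, ?_, ?_⟩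
          · simp [Test.Holds, hd₁, truthValue_eq_one, hP]
          · simp [ha₁, ha]
          · intro y hy
            simp [show y ≠ d + 1 by omega, show y ≠ d + 3 by omega, hr₁ y (by omega)]
          · simp only [State.setReg_reg, if_true]
            exact (truthValue_of_true ⟨k, by omega, hP⟩).symm
        · refine ⟨1 + 1, le_rfl, _, .ite_false ?_ (.skip _), ?_, ?_, ?_⟩
          · simp [Test.Holds, hd₁, truthValue_of_false hP]
          · simp [ha₁, ha]
          · intro y hy
            simp [show y ≠ d + 3 by omega, hr₁ y (by omega)]
          · rw [State.setReg_reg, if_neg (by omega), hr₁ _ (by omega), hf]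
            refine truthValue_congr ⟨fun ⟨j, hj, h⟩ => ⟨j, by omega, h⟩, fun ⟨j, hj, h⟩ => ?_⟩
            rcases Nat.lt_succ_iff_lt_or_eq.1 hj with hj | rfl
            · exact ⟨j, hj, h⟩
            · exact absurd h hP
      obtain ⟨t₂, ht₂, u₂, he₂, ha₂, hr₂, hd₂⟩ := key
      obtain ⟨t₃, ht₃, u₃, he₃, h₃⟩ := ih (k + 1) (by omega) (u₂.setReg x (u₂.reg x + 1))
        (by simpa using ha₂) (by
          intro y hy
          have := hr₂ y (by omega)
          have h2 := hr y hy
          simp only [State.setReg_reg] at h2 ⊢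
          split_ifs with h
          · rw [hr₂ x (by omega), hk']
          · rw [this, h2, if_neg h])
        (by simp [show d ≠ x by omega, hr₂, hd]) (by simp [show d + 1 ≠ x by omega, hd₂])
      refine ⟨_, ?_, u₃, .loop_true ?_ (.seq he₁ (.seq (.const ..) (.seq he₂ (.succ ..)))) he₃,
        h₃⟩
      · rw [Nat.succ_mul]; omega
      · simp [Test.Holds, hk', hu0]; omega
  obtain ⟨t, ht, u, he, ha, hr, hd, hf⟩ := hloop n 0 (by omega)
    (((s.setReg d (s.reg x)).setReg (d + 1) 0).setReg x 0) rfl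
    (by intro y hy; simp [show y ≠ d + 1 by omega, hy.ne])
    (by simp [show d ≠ x by omega]) (by
      simp [show d + 1 ≠ x by omega, truthValue])
  refine ⟨1 + (1 + (1 + (t + (1 + 1)))), by omega, _, .seq (.copy ..) (.seq (.const ..)
    (.seq (.const ..) (.seq he (.seq (.copy ..) (.copy ..))))), by simpa using ha, fun y hy => ?_, ?_⟩
  · have := hr y hy
    simp only [State.setReg_reg] at this ⊢
    rw [if_neg hy.ne]
    split_ifs with h
    · rw [hd, h]
    · rw [this, if_neg h]
  · simp only [State.setReg_reg, if_true, if_neg (show d + 1 ≠ x by omega), hf]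
    exact truthValue_congr ⟨fun ⟨j, hj, h⟩ => ⟨⟨j, hj⟩, h⟩, fun ⟨j, h⟩ => ⟨j, j.2, h⟩⟩

namespace Formula

/-- Both halves of a connective may use the same register `d`: evaluation preserves the arrays and
the registers below `d`, and a well-formed formula reads nothing else, so the second half keeps its
truth value (`holds_congr`). -/
theorem evaluates_prog {n : ℕ} (φ : Formula) {d : ℕ} {s : State} (h0 : s.reg 0 = n)
    (hd : φ.WF d) : Evaluates (φ.prog d) d s (φ.Holds n s) (φ.cost n) := by
  induction φ generalizing d s with
  | cell a i j =>
    obtain ⟨-, hd, -⟩ := hd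
    refine (Evaluates.prepend (c := 1 + 2) (.load ..) rfl (fun x hx => by simp [hx.ne])
      (Evaluates.prepend (.const ..) rfl (fun x hx => by simp [show x ≠ d + 1 by omega])
        (evaluates_branch (fun hb => ?_) fun hb => ?_))).mono (by simp [cost]) Iff.rfl <;>
      simp [Test.Holds] at hb
    · exact (truthValue_of_true hb).symm
    · exact (truthValue_of_false hb).symm
  | cellEq a i j y =>
    obtain ⟨-, hd, -⟩ := hd
    simp [regs] at hd
    refine (Evaluates.prepend (.load ..) rfl (fun x hx => by simp [hx.ne])
        (evaluates_branch (fun hb => ?_) fun hb => ?_)).mono (by simp [cost]) Iff.rfl <;>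
      simp [Test.Holds, hd.2.2.ne] at hb
    · exact (truthValue_of_true hb).symm
    · exact (truthValue_of_false hb).symm
  | eq x y =>
    exact (evaluates_branch (fun hb => (truthValue_of_true hb).symm)
      fun hb => (truthValue_of_false hb).symm).mono (by simp [cost]) Iff.rfl
  | neg φ ih =>
    refine ((ih h0 hd).branch (c' := 1) (fun u h _ _ => evaluates_const ?_)
      fun u h _ _ => evaluates_const ?_).mono (by simp [cost]) Iff.rfl
    · exact (truthValue_of_false (not_not.2 h)).symm
    · exact (truthValue_of_true h).symm
  | conj φ ψ ih₁ ih₂ =>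
    obtain ⟨hd0, hd, hb⟩ := hd
    simp only [regs, bound, List.mem_append, not_or] at hd hb
    refine ((ih₁ h0 ⟨hd0, fun x h => hd x (.inl h), hb.1⟩).branch (c' := ψ.cost n + 1)
      (fun u h ha hr => ?_)
      fun u h _ _ => (evaluates_const (k := 0) ?_).mono (by omega) Iff.rfl).mono
        (by simp only [cost]; omega) Iff.rfl
    · refine (ih₂ ((hr 0 hd0).trans h0) ⟨hd0, fun x h => hd x (.inr h), hb.2⟩).mono (by omega) ?_
      rw [holds_congr ψ (s' := s) (fun a _ => by rw [ha]) fun x hx => hr x (hd x (.inr hx))]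
      simp [Holds, h]
    · exact (truthValue_of_false fun h' => h h'.1).symm
  | disj φ ψ ih₁ ih₂ =>
    obtain ⟨hd0, hd, hb⟩ := hd
    simp only [regs, bound, List.mem_append, not_or] at hd hb
    refine ((ih₁ h0 ⟨hd0, fun x h => hd x (.inl h), hb.1⟩).branch (c' := ψ.cost n + 1)
      (fun u h _ _ => (evaluates_const (k := 1) ?_).mono (by omega) Iff.rfl)
      (fun u h ha hr => ?_)).mono (by simp only [cost]; omega) Iff.rfl
    · exact (truthValue_of_true (.inl h)).symm
    · refine (ih₂ ((hr 0 hd0).trans h0) ⟨hd0, fun x h => hd x (.inr h), hb.2⟩).mono (by omega) ?_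
      rw [holds_congr ψ (s' := s) (fun a _ => by rw [ha]) fun x hx => hr x (hd x (.inr hx))]
      simp [Holds, h]
  | ex x φ ih =>
    obtain ⟨hd0, hd, hb⟩ := hd
    simp only [regs, bound, List.mem_cons, not_or, forall_eq_or_imp] at hd hb
    refine evaluates_ex (P := fun k => φ.Holds n (s.setReg x k)) h0 hd.1 (Ne.symm hb.1)
      fun u k hk ha hr => (ih ?_ ⟨by omega, fun y hy => ?_, hb.2⟩).mono le_rfl ?_
    · rw [hr 0 hd0, State.setReg_reg, if_neg hb.1, h0]
    · exact (hd.2 y hy).trans (by omega)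
    · exact holds_congr φ (fun a _ => by rw [ha]; rfl) fun y hy => hr y (hd.2 y hy)

/-- Connectives add costs, and a quantifier multiplies by `n`. The base `n + 1` absorbs additive
constants even for `n = 0`. -/
theorem exists_cost_le (φ : Formula) : ∃ C, ∀ n, φ.cost n ≤ C * (n + 1) ^ φ.depth := by
  induction φ with
  | cell => exact ⟨10, fun n => by simp [cost, depth]⟩
  | cellEq => exact ⟨10, fun n => by simp [cost, depth]⟩
  | eq => exact ⟨10, fun n => by simp [cost, depth]⟩
  | neg φ ih =>
    obtain ⟨C, hC⟩ := ih
    refine ⟨C + 10, fun n => ?_⟩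
    have := hC n
    have h1 : 1 ≤ (n + 1) ^ φ.depth := Nat.one_le_pow _ _ (by omega)
    simp only [cost, depth]; nlinarith
  | conj φ ψ ih₁ ih₂ =>
    obtain ⟨C, hC⟩ := ih₁
    obtain ⟨C', hC'⟩ := ih₂
    refine ⟨C + C' + 10, fun n => ?_⟩
    have h1 : 1 ≤ (n + 1) ^ max φ.depth ψ.depth := Nat.one_le_pow _ _ (by omega)
    have h2 := (hC n).trans (Nat.mul_le_mul_left C
      (Nat.pow_le_pow_right (by omega) (le_max_left φ.depth ψ.depth)))
    have h3 := (hC' n).trans (Nat.mul_le_mul_left C'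
      (Nat.pow_le_pow_right (by omega) (le_max_right φ.depth ψ.depth)))
    simp only [cost, depth]; nlinarith
  | disj φ ψ ih₁ ih₂ =>
    obtain ⟨C, hC⟩ := ih₁
    obtain ⟨C', hC'⟩ := ih₂
    refine ⟨C + C' + 10, fun n => ?_⟩
    have h1 : 1 ≤ (n + 1) ^ max φ.depth ψ.depth := Nat.one_le_pow _ _ (by omega)
    have h2 := (hC n).trans (Nat.mul_le_mul_left C
      (Nat.pow_le_pow_right (by omega) (le_max_left φ.depth ψ.depth)))
    have h3 := (hC' n).trans (Nat.mul_le_mul_left C'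
      (Nat.pow_le_pow_right (by omega) (le_max_right φ.depth ψ.depth)))
    simp only [cost, depth]; nlinarith
  | ex x φ ih =>
    obtain ⟨C, hC⟩ := ih
    refine ⟨C + 20, fun n => ?_⟩
    have h1 : 1 ≤ (n + 1) ^ φ.depth := Nat.one_le_pow _ _ (by omega)
    simp only [cost, depth, pow_succ]
    calc n * (φ.cost n + 10) + 10 ≤ (n + 1) * (φ.cost n + 20) := by nlinarith
      _ ≤ (n + 1) * (C * (n + 1) ^ φ.depth + 20 * (n + 1) ^ φ.depth) := by
        have := hC n
        gcongr
        omega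
      _ = _ := by ring

end Formula

/-! ## Programs with bounded loops -/

/-- Commands with bounded loops only. -/
inductive Cmd where
  | skip
  | copy (x y : ℕ)
  /-- `x` is set to the truth value of `φ` -/
  | test (x : ℕ) (φ : Formula)
  /-- `a[i, j]` is set to the truth value of `φ` -/
  | write (a i j : ℕ) (φ : Formula)
  | ite (φ : Formula) (c c' : Cmd)
  | seq (c c' : Cmd)
  /-- `for x < n do c` -/
  | loop (x : ℕ) (c : Cmd)

namespace Cmd

open Classical in
/-- The state in which a command ends. -/
noncomputable def run (n : ℕ) : Cmd → State → State
  | skip, s => s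
  | copy x y, s => s.setReg x (s.reg y)
  | test x φ, s => s.setReg x (truthValue (φ.Holds n s))
  | write a i j φ, s => s.setArr a (s.reg i) (s.reg j) (truthValue (φ.Holds n s))
  | ite φ c c', s => if φ.Holds n s then c.run n s else c'.run n s
  | seq c c', s => c'.run n (c.run n s)
  | loop x c, s =>
    (Nat.rec (motive := fun _ => State) s (fun k u => c.run n (u.setReg x k)) n).setReg x n

/-- The registers that a command may change. -/
def regs : Cmd → List ℕ
  | skip => []
  | copy x _ => [x]
  | test x _ => [x]
  | write _ _ _ _ => []
  | ite _ c c' => c.regs ++ c'.regs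
  | seq c c' => c.regs ++ c'.regs
  | loop x c => x :: c.regs

/-- The arrays that a command may change. -/
def arrs : Cmd → List ℕ
  | skip => []
  | copy _ _ => []
  | test _ _ => []
  | write a _ _ _ => [a]
  | ite _ c c' => c.arrs ++ c'.arrs
  | seq c c' => c.arrs ++ c'.arrs
  | loop _ c => c.arrs

/-- The number of nested loops, including those that evaluate quantifiers. -/
def depth : Cmd → ℕ
  | skip => 0
  | copy _ _ => 0
  | test _ φ => φ.depth
  | write _ _ _ φ => φ.depth
  | ite φ c c' => max φ.depth (max c.depth c'.depth)
  | seq c c' => max c.depth c'.depth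
  | loop _ c => c.depth + 1

/-- A bound for the number of steps. -/
def cost (n : ℕ) : Cmd → ℕ
  | skip => 1
  | copy _ _ => 1
  | test _ φ => φ.cost n + 1
  | write _ _ _ φ => φ.cost n + 1
  | ite φ c c' => φ.cost n + c.cost n + c'.cost n + 2
  | seq c c' => c.cost n + c'.cost n
  | loop _ c => n * (c.cost n + 2) + 2

/-- Machine code for a command, with scratch registers from `d` on. -/
def prog (d : ℕ) : Cmd → Prog
  | skip => .skip
  | copy x y => .copy x y
  | test x φ => .seq (φ.prog d) (.copy x d)
  | write a i j φ => .seq (φ.prog d) (.store a i j d)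
  | ite φ c c' => .seq (φ.prog d) (.seq (.const (d + 1) 1)
      (.ite (.eq d (d + 1)) (c.prog d) (c'.prog d)))
  | seq c c' => .seq (c.prog d) (c'.prog d)
  | loop x c => .seq (.const x 0) (.loop (.lt x 0) (.seq (c.prog d) (.succ x)))

/-- Conditions under which the machine code is correct. -/
def WF (d : ℕ) : Cmd → Prop
  | skip => True
  | copy x y => x < d ∧ y < d ∧ x ≠ 0
  | test x φ => x < d ∧ x ≠ 0 ∧ φ.WF d
  | write _ i j φ => i < d ∧ j < d ∧ φ.WF d
  | ite φ c c' => φ.WF d ∧ c.WF d ∧ c'.WF d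
  | seq c c' => c.WF d ∧ c'.WF d
  | loop x c => x < d ∧ x ≠ 0 ∧ x ∉ c.regs ∧ c.WF d

instance decidableWF (d : ℕ) : (c : Cmd) → Decidable (c.WF d)
  | skip => inferInstanceAs (Decidable True)
  | copy x y => inferInstanceAs (Decidable (x < d ∧ y < d ∧ x ≠ 0))
  | test x φ => inferInstanceAs (Decidable (x < d ∧ x ≠ 0 ∧ φ.WF d))
  | write _ i j φ => inferInstanceAs (Decidable (i < d ∧ j < d ∧ φ.WF d))
  | ite φ c c' => by
    have := decidableWF d c; have := decidableWF d c'
    exact inferInstanceAs (Decidable (φ.WF d ∧ c.WF d ∧ c'.WF d))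
  | seq c c' => by
    have := decidableWF d c; have := decidableWF d c'
    exact inferInstanceAs (Decidable (c.WF d ∧ c'.WF d))
  | loop x c => by
    have := decidableWF d c
    exact inferInstanceAs (Decidable (x < d ∧ x ≠ 0 ∧ x ∉ c.regs ∧ c.WF d))

/-- Induction principle for loops. -/
theorem run_loop_induction {n x : ℕ} {c : Cmd} {s : State} (I : ℕ → State → Prop) (h0 : I 0 s)
    (hstep : ∀ k < n, ∀ u, I k u → I (k + 1) (c.run n (u.setReg x k))) :
    ∃ u, I n u ∧ (loop x c).run n s = u.setReg x n := by
  refine ⟨_, ?_, rfl⟩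
  have : ∀ m ≤ n, I m (Nat.rec (motive := fun _ => State) s
      (fun k u => c.run n (u.setReg x k)) m) := by
    intro m
    induction m with
    | zero => exact fun _ => h0
    | succ m ih => exact fun hm => hstep m hm _ (ih (by omega))
  exact this n le_rfl

/-- With `run_arr` this is the frame rule. For concrete commands its side condition is membership in
a list of numerals, so facts about untouched memory are carried along by `decide`. -/
theorem run_reg {n : ℕ} (c : Cmd) {s : State} {x : ℕ} (hx : x ∉ c.regs) :
    (c.run n s).reg x = s.reg x := by
  induction c generalizing s with
  | skip => rfl
  | copy y z => simp_all [run, regs]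
  | test y φ => simp_all [run, regs]
  | write a i j φ => simp [run]
  | ite φ c c' ih₁ ih₂ =>
    simp only [regs, List.mem_append, not_or] at hx
    simp only [run]
    split
    · exact ih₁ hx.1
    · exact ih₂ hx.2
  | seq c c' ih₁ ih₂ =>
    simp only [regs, List.mem_append, not_or] at hx
    exact (ih₂ hx.2).trans (ih₁ hx.1)
  | loop y c ih =>
    simp only [regs, List.mem_cons, not_or] at hx
    obtain ⟨u, hu, he⟩ := run_loop_induction (n := n) (x := y) (c := c) (s := s)
      (fun _ u => u.reg x = s.reg x) rfl fun k _ u hu => by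
        rw [ih hx.2]; simpa [hx.1] using hu
    rw [he]
    simpa [hx.1] using hu

theorem run_arr {n : ℕ} (c : Cmd) {s : State} {a : ℕ} (ha : a ∉ c.arrs) :
    (c.run n s).arr a = s.arr a := by
  induction c generalizing s with
  | skip => rfl
  | copy y z => rfl
  | test y φ => rfl
  | write b i j φ => funext p q; simp_all [run, arrs]
  | ite φ c c' ih₁ ih₂ =>
    simp only [arrs, List.mem_append, not_or] at ha
    simp only [run]
    split
    · exact ih₁ ha.1
    · exact ih₂ ha.2
  | seq c c' ih₁ ih₂ =>
    simp only [arrs, List.mem_append, not_or] at ha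
    exact (ih₂ ha.2).trans (ih₁ ha.1)
  | loop y c ih =>
    obtain ⟨u, hu, he⟩ := run_loop_induction (n := n) (x := y) (c := c) (s := s)
      (fun _ u => u.arr a = s.arr a) rfl fun k _ u hu => by
        rw [ih ha]; simpa using hu
    rw [he]
    simpa using hu

/-- Equality of two states up to the registers from `d` on. -/
def _root_.MissingData.State.Agree (d : ℕ) (s u : State) : Prop :=
  s.arr = u.arr ∧ ∀ x < d, s.reg x = u.reg x

theorem _root_.MissingData.State.Agree.holds_iff {n d : ℕ} {s u : State} (h : s.Agree d u)
    {φ : Formula} (hφ : φ.WF d) : φ.Holds n s ↔ φ.Holds n u :=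
  φ.holds_congr (fun a _ => by rw [h.1]) fun x hx => h.2 x (hφ.2.1 x hx)

theorem _root_.MissingData.State.Agree.setReg {d : ℕ} {s u : State} (h : s.Agree d u)
    (x k : ℕ) : (s.setReg x k).Agree d (u.setReg x k) :=
  ⟨h.1, fun y hy => by simp [h.2 y hy]⟩

/-- The machine code simulates the command. -/
theorem exec_prog {n d : ℕ} (c : Cmd) {s u : State} (hc : c.WF d) (h0 : u.reg 0 = n)
    (hd : 0 < d) (h : s.Agree d u) :
    ∃ t ≤ c.cost n, ∃ s', Exec (c.prog d) s t s' ∧ s'.Agree d (c.run n u) ∧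
      (c.run n u).reg 0 = n := by
  induction c generalizing s u with
  | skip => exact ⟨1, le_rfl, s, .skip _, h, h0⟩
  | copy x y =>
    refine ⟨1, le_rfl, _, .copy .., ?_, ?_⟩
    · rw [h.2 y hc.2.1]; exact h.setReg ..
    · simp [run, hc.2.2.symm, h0]
  | test x φ =>
    obtain ⟨hx, hx0, hφ⟩ := hc
    obtain ⟨t, ht, s', he, ha, hr, hv⟩ := φ.evaluates_prog ((h.2 0 hd).trans h0) hφ
    refine ⟨t + 1, by simp only [cost]; omega, _, .seq he (.copy ..), ?_, ?_⟩
    · rw [hv, truthValue_congr (h.holds_iff hφ)]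
      exact State.Agree.setReg ⟨ha.trans h.1, fun y hy => (hr y hy).trans (h.2 y hy)⟩ _ _
    · simp [run, hx0.symm, h0]
  | write a i j φ =>
    obtain ⟨hi, hj, hφ⟩ := hc
    obtain ⟨t, ht, s', he, ha, hr, hv⟩ := φ.evaluates_prog ((h.2 0 hd).trans h0) hφ
    refine ⟨t + 1, by simp only [cost]; omega, _, .seq he (.store ..), ⟨?_, fun y hy => ?_⟩, ?_⟩
    · rw [hv, truthValue_congr (h.holds_iff hφ), hr i hi, hr j hj, h.2 i hi, h.2 j hj]
      funext b p q
      simp [run, ha, h.1]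
    · simpa [run] using (hr y hy).trans (h.2 y hy)
    · simpa [run] using h0
  | ite φ c c' ih₁ ih₂ =>
    obtain ⟨hφ, hc₁, hc₂⟩ := hc
    obtain ⟨t, ht, s', he, ha, hr, hv⟩ := φ.evaluates_prog ((h.2 0 hd).trans h0) hφ
    have hag : (s'.setReg (d + 1) 1).Agree d u := ⟨ha.trans h.1, fun y hy => by
      simpa [show y ≠ d + 1 by omega] using (hr y hy).trans (h.2 y hy)⟩
    rw [truthValue_congr (h.holds_iff hφ)] at hv
    by_cases hP : φ.Holds n u
    · obtain ⟨t', ht', s'', he', hag', h0'⟩ := ih₁ hc₁ h0 hag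
      refine ⟨t + (1 + (t' + 1)), by simp only [cost]; omega, s'',
        .seq he (.seq (.const ..) (.ite_true ?_ he')), ?_⟩
      · simp [Test.Holds, hv, truthValue_of_true hP]
      · simp only [run, if_pos hP]
        exact ⟨hag', h0'⟩
    · obtain ⟨t', ht', s'', he', hag', h0'⟩ := ih₂ hc₂ h0 hag
      refine ⟨t + (1 + (t' + 1)), by simp only [cost]; omega, s'',
        .seq he (.seq (.const ..) (.ite_false ?_ he')), ?_⟩
      · simp [Test.Holds, hv, truthValue_of_false hP]
      · simp only [run, if_neg hP]
        exact ⟨hag', h0'⟩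
  | seq c c' ih₁ ih₂ =>
    obtain ⟨t, ht, s', he, hag, h0'⟩ := ih₁ hc.1 h0 h
    obtain ⟨t', ht', s'', he', hag', h0''⟩ := ih₂ hc.2 h0' hag
    exact ⟨_, by simp only [cost]; omega, s'', .seq he he', hag', h0''⟩
  | loop x c ih =>
    obtain ⟨hx, hx0, hxc, hc⟩ := hc
    -- The abstract states after each round. The machine has already advanced its counter when a
    -- round starts, so it is compared with `(v k).setReg x k`.
    let v : ℕ → State := fun m => Nat.rec (motive := fun _ => State) u
      (fun k u => c.run n (u.setReg x k)) m
    have hloop : ∀ m k : ℕ, k + m = n → ∀ s : State, s.Agree d ((v k).setReg x k) →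
        (v k).reg 0 = n →
        ∃ t ≤ m * (c.cost n + 2) + 1, ∃ s', Exec (.loop (.lt x 0) (.seq (c.prog d) (.succ x)))
          s t s' ∧ s'.Agree d ((v n).setReg x n) ∧ (v n).reg 0 = n := by
      intro m
      induction m with
      | zero =>
        intro k hk s hs h0
        obtain rfl : k = n := by omega
        refine ⟨1, by omega, s, .loop_false ?_, hs, h0⟩
        have h1 := hs.2 x hx
        have h2 := hs.2 0 hd
        simp_all [Test.Holds, hx0.symm]
      | succ m ihm =>
        intro k hk s hs h0
        obtain ⟨t, ht, s', he, hag, h0'⟩ := ih hc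
          (by simpa [hx0.symm] using h0) hs
        -- The body does not assign `x`, so the increment leads to `k + 1`.
        have hx' : s'.reg x = k := by
          rw [hag.2 x hx, c.run_reg hxc]; simp
        obtain ⟨t', ht', s'', he', h''⟩ := ihm (k + 1) (by omega) (s'.setReg x (k + 1))
          (hag.setReg ..) h0'
        refine ⟨t + 1 + t' + 1, by rw [Nat.succ_mul]; omega, s'',
          .loop_true ?_ (.seq he (hx' ▸ .succ x s')) he', h''⟩
        have h1 := hs.2 x hx
        have h2 := hs.2 0 hd
        simp_all [Test.Holds, hx0.symm]
        omega
    obtain ⟨t, ht, s', he, hag, h0'⟩ := hloop n 0 (by omega) (s.setReg x 0) (h.setReg ..) h0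
    exact ⟨_, by simp only [cost]; omega, s', .seq (.const ..) he, hag,
      by simpa [run, hx0.symm] using h0'⟩

/-- This turns the time bound into a computation: the exponent is a number that `decide` can
evaluate for a given command. -/
theorem exists_cost_le (c : Cmd) : ∃ C, ∀ n, c.cost n ≤ C * (n + 1) ^ c.depth := by
  induction c with
  | skip => exact ⟨1, fun n => by simp [cost, depth]⟩
  | copy => exact ⟨1, fun n => by simp [cost, depth]⟩
  | test x φ =>
    obtain ⟨C, hC⟩ := φ.exists_cost_le
    refine ⟨C + 1, fun n => ?_⟩
    have := hC n
    have h1 : 1 ≤ (n + 1) ^ φ.depth := Nat.one_le_pow _ _ (by omega)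
    simp only [cost, depth]; nlinarith
  | write a i j φ =>
    obtain ⟨C, hC⟩ := φ.exists_cost_le
    refine ⟨C + 1, fun n => ?_⟩
    have := hC n
    have h1 : 1 ≤ (n + 1) ^ φ.depth := Nat.one_le_pow _ _ (by omega)
    simp only [cost, depth]; nlinarith
  | ite φ c c' ih₁ ih₂ =>
    obtain ⟨C₀, hC₀⟩ := φ.exists_cost_le
    obtain ⟨C, hC⟩ := ih₁
    obtain ⟨C', hC'⟩ := ih₂
    refine ⟨C₀ + C + C' + 2, fun n => ?_⟩
    set e := max φ.depth (max c.depth c'.depth) with he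
    have h1 : 1 ≤ (n + 1) ^ e := Nat.one_le_pow _ _ (by omega)
    have h2 := (hC₀ n).trans (Nat.mul_le_mul_left C₀
      (Nat.pow_le_pow_right (by omega) (show φ.depth ≤ e by omega)))
    have h3 := (hC n).trans (Nat.mul_le_mul_left C
      (Nat.pow_le_pow_right (by omega) (show c.depth ≤ e by omega)))
    have h4 := (hC' n).trans (Nat.mul_le_mul_left C'
      (Nat.pow_le_pow_right (by omega) (show c'.depth ≤ e by omega)))
    simp only [cost, depth, ← he]; nlinarith
  | seq c c' ih₁ ih₂ =>
    obtain ⟨C, hC⟩ := ih₁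
    obtain ⟨C', hC'⟩ := ih₂
    refine ⟨C + C', fun n => ?_⟩
    have h3 := (hC n).trans (Nat.mul_le_mul_left C
      (Nat.pow_le_pow_right (by omega) (le_max_left c.depth c'.depth)))
    have h4 := (hC' n).trans (Nat.mul_le_mul_left C'
      (Nat.pow_le_pow_right (by omega) (le_max_right c.depth c'.depth)))
    simp only [cost, depth]; nlinarith
  | loop x c ih =>
    obtain ⟨C, hC⟩ := ih
    refine ⟨C + 4, fun n => ?_⟩
    have h1 : 1 ≤ (n + 1) ^ c.depth := Nat.one_le_pow _ _ (by omega)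
    simp only [cost, depth, pow_succ]
    calc n * (c.cost n + 2) + 2 ≤ (n + 1) * (c.cost n + 4) := by nlinarith
      _ ≤ (n + 1) * (C * (n + 1) ^ c.depth + 4 * (n + 1) ^ c.depth) := by
        have := hC n
        gcongr
        omega
      _ = _ := by ring

end Cmd

/-! ### Reading sets and relations from the memory -/

namespace State

variable {n : ℕ} {s : State} {a : ℕ}

theorem HoldsRel.iff {r : Fin n → Fin n → Prop} (h : s.HoldsRel a r) (u v : Fin n) :
    s.arr a u v = 1 ↔ r u v := by
  rw [h u v, truthValue_eq_one]

theorem HoldsSet.iff {S : Set (Fin n)} (h : s.HoldsSet a S) (v : Fin n) :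
    s.arr a v 0 = 1 ↔ v ∈ S := by
  rw [h v, truthValue_eq_one]

theorem HoldsRel.congr {s' : State} {r : Fin n → Fin n → Prop} (h : s.HoldsRel a r)
    (ha : s'.arr a = s.arr a) : s'.HoldsRel a r := fun u v => by rw [ha, h u v]

theorem HoldsSet.congr {s' : State} {S : Set (Fin n)} (h : s.HoldsSet a S)
    (ha : s'.arr a = s.arr a) : s'.HoldsSet a S := fun v => by rw [ha, h v]

theorem HoldsRel.run {r : Fin n → Fin n → Prop} (h : s.HoldsRel a r) {c : Cmd}
    (ha : a ∉ c.arrs) : (c.run n s).HoldsRel a r := h.congr (c.run_arr ha)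

theorem HoldsSet.run {S : Set (Fin n)} (h : s.HoldsSet a S) {c : Cmd}
    (ha : a ∉ c.arrs) : (c.run n s).HoldsSet a S := h.congr (c.run_arr ha)

end State

namespace Formula

/-- A formula that does not hold. -/
def false : Formula := .neg (.eq 0 0)

theorem holds_false {n : ℕ} {s : State} : ¬ false.Holds n s := fun h => h rfl

end Formula

/-! ### Filling arrays and picking vertices -/

namespace Cmd

/-- The first column of `a` becomes the set of all values of register `10` that satisfy `φ`. -/
def fillCol (a : ℕ) (φ : Formula) : Cmd := .loop 10 (.write a 10 9 φ)

/-- Row number `x` (a register) of `a` becomes the set of all values of register `11` that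
satisfy `φ`. -/
def fillRow (a x : ℕ) (φ : Formula) : Cmd := .loop 11 (.write a x 11 φ)

/-- `a` becomes the relation between the values of registers `10` and `11` defined by `φ`. -/
def fillMat (a : ℕ) (φ : Formula) : Cmd := .loop 10 (fillRow a 10 φ)

/-- `x` becomes some value of register `10` that satisfies `φ`, or `n` if there is none. -/
def pick (x : ℕ) (φ : Formula) : Cmd :=
  .seq (.copy x 0) (.loop 10 (.ite φ (.copy x 10) .skip))

variable {n : ℕ} {s : State} {a : ℕ} {φ : Formula}

/-- As `φ` does not read the array being filled, each entry has the value that it would have in the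
initial memory. Register `9` is `0` throughout and addresses the first column. -/
theorem holdsSet_fillCol {S : Set (Fin n)} (hz : s.reg 9 = 0) (ha : a ∉ φ.arrs)
    (h : ∀ v : Fin n, φ.Holds n (s.setReg 10 v) ↔ v ∈ S) :
    ((fillCol a φ).run n s).HoldsSet a S := by
  obtain ⟨u, hu, he⟩ := run_loop_induction (n := n) (x := 10) (c := .write a 10 9 φ) (s := s)
    (fun k u => (∀ x ≠ 10, u.reg x = s.reg x) ∧ (∀ b ≠ a, u.arr b = s.arr b) ∧
      ∀ p < k, u.arr a p 0 = truthValue (φ.Holds n (s.setReg 10 p)))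
    ⟨fun _ _ => rfl, fun _ _ => rfl, fun p hp => by omega⟩ fun k _ u ⟨hr, hb, hp⟩ => by
      refine ⟨fun x hx => by simp [run, hx, hr], fun b hb' => by funext p q; simp [run, hb', hb],
        fun p hpk => ?_⟩
      have h9 : u.reg 9 = 0 := by rw [hr 9 (by omega), hz]
      simp only [run, State.setArr_arr, State.setReg_reg, State.setReg_arr, if_true]
      rw [if_neg (show 9 ≠ 10 by omega), h9]
      rcases Nat.lt_succ_iff_lt_or_eq.1 hpk with hlt | rfl
      · rw [if_neg (by omega), hp p hlt]
      · rw [if_pos (by simp)]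
        refine truthValue_congr (φ.holds_congr (fun b hb' => hb b (ne_of_mem_of_not_mem hb' ha))
          fun x _ => ?_)
        simp only [State.setReg_reg]
        split_ifs with hx
        · rfl
        · exact hr x hx
  intro v
  rw [fillCol, he, State.setReg_arr, hu.2.2 v v.2, truthValue_congr (h v)]

theorem run_fillRow {x : ℕ} (hx : x ≠ 11) (ha : a ∉ φ.arrs) :
    (∀ q : Fin n, ((fillRow a x φ).run n s).arr a (s.reg x) q =
      truthValue (φ.Holds n (s.setReg 11 q))) ∧
    ∀ p ≠ s.reg x, ∀ q, ((fillRow a x φ).run n s).arr a p q = s.arr a p q := by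
  obtain ⟨u, hu, he⟩ := run_loop_induction (n := n) (x := 11) (c := .write a x 11 φ) (s := s)
    (fun k u => (∀ x ≠ 11, u.reg x = s.reg x) ∧ (∀ b ≠ a, u.arr b = s.arr b) ∧
      (∀ q < k, u.arr a (s.reg x) q = truthValue (φ.Holds n (s.setReg 11 q))) ∧
      ∀ p ≠ s.reg x, ∀ q, u.arr a p q = s.arr a p q)
    ⟨fun _ _ => rfl, fun _ _ => rfl, fun p hp => by omega, fun _ _ _ => rfl⟩
    fun k _ u ⟨hr, hb, hp, hq⟩ => by
      refine ⟨fun x hx => by simp [run, hx, hr], fun b hb' => by funext p q; simp [run, hb', hb],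
        fun q hqk => ?_, fun p hpx q => ?_⟩
      · simp only [run, State.setArr_arr, State.setReg_reg, State.setReg_arr, if_true]
        rw [if_neg hx, hr x hx]
        rcases Nat.lt_succ_iff_lt_or_eq.1 hqk with hlt | rfl
        · rw [if_neg (by omega), hp q hlt]
        · rw [if_pos (by simp)]
          refine truthValue_congr (φ.holds_congr
            (fun b hb' => hb b (ne_of_mem_of_not_mem hb' ha)) fun y _ => ?_)
          simp only [State.setReg_reg]
          split_ifs with hy
          · rfl
          · exact hr y hy
      · simp only [run, State.setArr_arr, State.setReg_reg, State.setReg_arr, if_true]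
        rw [if_neg hx, hr x hx, if_neg (by tauto), hq p hpx]
  rw [fillRow, he]
  exact ⟨fun q => hu.2.2.1 q q.2, hu.2.2.2⟩

theorem holdsRel_fillMat {r : Fin n → Fin n → Prop} (ha : a ∉ φ.arrs)
    (h : ∀ u v : Fin n, φ.Holds n ((s.setReg 10 u).setReg 11 v) ↔ r u v) :
    ((fillMat a φ).run n s).HoldsRel a r := by
  obtain ⟨u, hu, he⟩ := run_loop_induction (n := n) (x := 10) (c := fillRow a 10 φ) (s := s)
    (fun k u => (∀ x ≠ 10, x ≠ 11 → u.reg x = s.reg x) ∧ (∀ b ≠ a, u.arr b = s.arr b) ∧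
      ∀ p < k, ∀ q : Fin n, u.arr a p q =
        truthValue (φ.Holds n ((s.setReg 10 p).setReg 11 q)))
    ⟨fun _ _ _ => rfl, fun _ _ => rfl, fun p hp => by omega⟩ fun k _ u ⟨hr, hb, hp⟩ => by
      obtain ⟨h₁, h₂⟩ := run_fillRow (n := n) (s := u.setReg 10 k) (x := 10) (by omega) ha
      refine ⟨fun x hx hx' => ?_, fun b hb' => ?_, fun p hpk q => ?_⟩
      · rw [run_reg _ (by simp [fillRow, regs, hx'])]; simp [hx, hr x hx hx']
      · rw [run_arr _ (by simp [fillRow, arrs, hb'])]; simp [hb b hb']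
      · rcases Nat.lt_succ_iff_lt_or_eq.1 hpk with hlt | rfl
        · rw [h₂ p (by simp; omega), ← hp p hlt]; rfl
        · refine Eq.trans (h₁ q) (truthValue_congr (φ.holds_congr
            (fun b hb' => hb b (ne_of_mem_of_not_mem hb' ha)) fun y _ => ?_))
          simp only [State.setReg_reg]
          split_ifs with hy hy' <;> try rfl
          exact hr y hy' hy
  intro v w
  rw [fillMat, he, State.setReg_arr, hu.2.2 v v.2, truthValue_congr (h v w)]

/-- Vertices are numbered below `n`, so the initial value `n` survives exactly if nothing satisfies
`φ`; otherwise the last witness remains. -/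
theorem run_pick {x : ℕ} (h0 : s.reg 0 = n) (hx : x ≠ 10) (hφ : x ∉ φ.regs) :
    (((pick x φ).run n s).reg x = n ∧ ∀ v : Fin n, ¬ φ.Holds n (s.setReg 10 v)) ∨
    ∃ v : Fin n, ((pick x φ).run n s).reg x = v ∧ φ.Holds n (s.setReg 10 v) := by
  obtain ⟨u, hu, he⟩ := run_loop_induction (n := n) (x := 10)
    (c := .ite φ (.copy x 10) .skip) (s := s.setReg x (s.reg 0))
    (fun k u => u.arr = s.arr ∧ (∀ y ≠ 10, y ≠ x → u.reg y = s.reg y) ∧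
      ((u.reg x = n ∧ ∀ v : Fin n, v < k → ¬ φ.Holds n (s.setReg 10 v)) ∨
        ∃ v : Fin n, u.reg x = v ∧ φ.Holds n (s.setReg 10 v)))
    ⟨rfl, fun y hy hyx => by simp [hyx], .inl ⟨by simp [h0], fun v hv => by omega⟩⟩
    fun k hk u ⟨ha, hr, h⟩ => by
      have hiff : φ.Holds n (u.setReg 10 k) ↔ φ.Holds n (s.setReg 10 k) := by
        refine φ.holds_congr (fun b _ => by rw [State.setReg_arr, ha]; rfl) fun y hy => ?_
        simp only [State.setReg_reg]
        split_ifs with h'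
        · rfl
        · exact hr y h' (ne_of_mem_of_not_mem hy hφ)
      by_cases hP : φ.Holds n (s.setReg 10 k)
      · simp only [run, if_pos (hiff.2 hP)]
        refine ⟨ha, fun y hy hyx => by simp [hy, hyx, hr], .inr ⟨⟨k, hk⟩, by simp, hP⟩⟩
      · simp only [run, if_neg (fun h => hP (hiff.1 h))]
        refine ⟨ha, fun y hy hyx => by simp [hy, hyx, hr], ?_⟩
        rcases h with ⟨h, h'⟩ | ⟨v, hv, h⟩
        · refine .inl ⟨by simp [hx, h], fun v hv => ?_⟩
          rcases Nat.lt_succ_iff_lt_or_eq.1 hv with hlt | heq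
          · exact h' v hlt
          · rwa [heq]
        · exact .inr ⟨v, by simp [hx, hv], h⟩
  rw [show (pick x φ).run n s = _ from he]
  simp only [State.setReg_reg, if_neg hx]
  refine hu.2.2.imp (fun h => ⟨h.1, fun v => h.2 v v.2⟩) id

end Cmd

/-! ## Transitive closure -/

/-- There is a path along `r` of length at least one with inner vertices in `K`. -/
inductive PathIn {α : Type*} (r : α → α → Prop) (K : Set α) : α → α → Prop
  | single {u v : α} : r u v → PathIn r K u v
  | trans {u v w : α} : PathIn r K u v → v ∈ K → PathIn r K v w → PathIn r K u w

namespace PathIn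

variable {α : Type*} {r : α → α → Prop} {K : Set α}

theorem mono {L : Set α} (hKL : K ⊆ L) {u w : α} (h : PathIn r K u w) : PathIn r L u w := by
  induction h with
  | single h => exact .single h
  | trans _ hk _ ih₁ ih₂ => exact .trans ih₁ (hKL hk) ih₂

/-- Warshall's recurrence: of a path through `k`, only the part before the first visit to `k` and
the part after the last one are needed. -/
theorem insert_iff {k u w : α} : PathIn r (insert k K) u w ↔
    PathIn r K u w ∨ (PathIn r K u k ∧ PathIn r K k w) := by
  constructor
  · intro h
    induction h with
    | single h => exact .inl (.single h)
    | @trans u v w _ hv _ ih₁ ih₂ =>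
      rcases hv with rfl | hv
      · right
        exact ⟨ih₁.elim id (·.1), ih₂.elim id (·.2)⟩
      · rcases ih₁ with h₁ | ⟨h₁, h₁'⟩ <;> rcases ih₂ with h₂ | ⟨h₂, h₂'⟩
        · exact .inl (.trans h₁ hv h₂)
        · exact .inr ⟨.trans h₁ hv h₂, h₂'⟩
        · exact .inr ⟨h₁, .trans h₁' hv h₂⟩
        · exact .inr ⟨h₁, h₂'⟩
  · have hKk : K ⊆ insert k K := Set.subset_insert _ _
    rintro (h | ⟨h₁, h₂⟩)
    · exact h.mono hKk
    · exact .trans (h₁.mono hKk) (Set.mem_insert _ _) (h₂.mono hKk)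

theorem empty_iff {u w : α} : PathIn r ∅ u w ↔ r u w := by
  constructor
  · intro h
    cases h with
    | single h => exact h
    | trans _ hk _ => exact hk.elim
  · exact .single

theorem univ_iff_reflTransGen {u w : α} :
    PathIn (fun u w => u = w ∨ r u w) Set.univ u w ↔ Relation.ReflTransGen r u w := by
  constructor
  · intro h
    induction h with
    | single h =>
      rcases h with rfl | h
      · exact .refl
      · exact .single h
    | trans _ _ _ ih₁ ih₂ => exact ih₁.trans ih₂
  · intro h
    induction h with
    | refl => exact .single (.inl rfl)
    | tail _ h ih => exact .trans ih trivial (.single (.inr h))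

end PathIn

namespace Cmd

/-- Warshall's algorithm for the relation in array `a`, with array `b` for intermediate results
and with inner vertices restricted to the set in array `c`. -/
def closure (a b c : ℕ) : Cmd :=
  .loop 14 (.seq (fillMat b (.disj (.cell a 10 11)
    (.conj (.cell c 14 9) (.conj (.cell a 10 14) (.cell a 14 11))))) (fillMat a (.cell b 10 11)))

/-- After `k` rounds the inner vertices may be those members of `K` with number below `k`. A round
is `PathIn.insert_iff` if the vertex `k` lies in `K`, and changes nothing otherwise. The buffer `b`
is needed because a fill must not read its own target. -/
theorem holdsRel_closure {n : ℕ} {s : State} {a b c : ℕ} {r : Fin n → Fin n → Prop}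
    {K : Set (Fin n)} (hz : s.reg 9 = 0) (hab : a ≠ b) (hca : c ≠ a) (hcb : c ≠ b)
    (hr : s.HoldsRel a r) (hK : s.HoldsSet c K) :
    ((closure a b c).run n s).HoldsRel a (PathIn r K) := by
  obtain ⟨u, hu, he⟩ := run_loop_induction (n := n) (x := 14)
    (c := .seq (fillMat b (.disj (.cell a 10 11)
    (.conj (.cell c 14 9) (.conj (.cell a 10 14) (.cell a 14 11))))) (fillMat a (.cell b 10 11)))
    (s := s)
    (fun k u => u.reg 9 = 0 ∧ u.HoldsSet c K ∧
      u.HoldsRel a (PathIn r {x ∈ K | (x : ℕ) < k}))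
    ⟨hz, hK, by simpa [PathIn.empty_iff, funext_iff, State.HoldsRel] using hr⟩ (by
      rintro k hk u ⟨h9, hc, ha⟩
      refine ⟨?_, ?_, ?_⟩
      · rw [run_reg _ (by simp [fillMat, fillRow, regs])]; simpa using h9
      · exact hc.congr (run_arr _ (by simp [fillMat, fillRow, arrs, hca, hcb]))
      · have h₁ : ((fillMat b (.disj (.cell a 10 11)
            (.conj (.cell c 14 9) (.conj (.cell a 10 14) (.cell a 14 11))))).run n
            (u.setReg 14 k)).HoldsRel b (PathIn r {x ∈ K | (x : ℕ) < k + 1}) := by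
          refine holdsRel_fillMat (by simp [Formula.arrs, hab.symm, hcb.symm]) fun v w => ?_
          have hk1 := hc.iff ⟨k, hk⟩
          have hk2 := ha.iff v ⟨k, hk⟩
          have hk3 := ha.iff ⟨k, hk⟩ w
          by_cases hkK : (⟨k, hk⟩ : Fin n) ∈ K
          · rw [show {x ∈ K | (x : ℕ) < k + 1} = insert ⟨k, hk⟩ {x ∈ K | (x : ℕ) < k} by
              ext x
              simp only [Set.mem_ofPred_eq, Set.mem_insert_iff, Nat.lt_succ_iff_lt_or_eq]
              constructor
              · rintro ⟨h, h' | h'⟩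
                · exact .inr ⟨h, h'⟩
                · exact .inl (Fin.ext h')
              · rintro (rfl | ⟨h, h'⟩)
                · exact ⟨hkK, .inr rfl⟩
                · exact ⟨h, .inl h'⟩, PathIn.insert_iff]
            simp [Formula.Holds, h9, ha.iff, hk1, hk2, hk3, hkK]
          · rw [show {x ∈ K | (x : ℕ) < k + 1} = {x ∈ K | (x : ℕ) < k} by
              ext x
              simp only [Set.mem_ofPred_eq, Nat.lt_succ_iff_lt_or_eq]
              refine ⟨?_, fun h => ⟨h.1, .inl h.2⟩⟩
              rintro ⟨h, h' | h'⟩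
              · exact ⟨h, h'⟩
              · exact absurd (show (⟨k, hk⟩ : Fin n) ∈ K by
                  rwa [show (⟨k, hk⟩ : Fin n) = x from Fin.ext h'.symm]) hkK]
            simp [Formula.Holds, h9, ha.iff, hk1, hk2, hk3, hkK]
        refine holdsRel_fillMat (by simp [Formula.arrs, hab]) fun v w => ?_
        simp [Formula.Holds, h₁.iff])
  have hu' : {x ∈ K | (x : ℕ) < n} = K := by ext x; simp
  rw [hu'] at hu
  exact fun v w => by rw [closure, he]; exact hu.2.2 v w

end Cmd

/-! ### d-connection by walks instead of paths -/

namespace MixedGraph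

open Relation

variable {V : Type} {H : MixedGraph V}

/-- The condition for a path that arrives at `v`, with an arrowhead at `v` if `h` holds, to go on
with `p` without being blocked at `v`. -/
def Passes (H : MixedGraph V) (Z : Set V) (h : Prop) (v : V) : List (EdgeType × V) → Prop
  | [] => True
  | (f, _) :: _ => ((h ∧ f.headAtSource) → (H.De {v} ∩ Z).Nonempty) ∧
      (¬ (h ∧ f.headAtSource) → v ∉ Z)

theorem isUnblocked_cons {Z : Set V} {e : EdgeType} {v : V} {p : List (EdgeType × V)} :
    H.IsUnblocked Z ((e, v) :: p) ↔ H.Passes Z e.headAtTarget v p ∧ H.IsUnblocked Z p := by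
  cases p with
  | nil => simp [IsUnblocked, Passes]
  | cons a p => obtain ⟨f, w⟩ := a; simp [IsUnblocked, Passes, and_assoc]

theorem mem_De_of_reflTransGen {u v z : V} (h : ReflTransGen H.dir u v) (hz : z ∈ H.De {v}) :
    z ∈ H.De {u} := by
  obtain ⟨c, rfl, hc⟩ := hz
  exact ⟨u, rfl, h.trans hc⟩

theorem De_inter_nonempty_of_reflTransGen {u v : V} {Z : Set V} (h : ReflTransGen H.dir u v)
    (hz : (H.De {v} ∩ Z).Nonempty) : (H.De {u} ∩ Z).Nonempty :=
  hz.mono fun _ hx => ⟨mem_De_of_reflTransGen h hx.1, hx.2⟩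

theorem isPath_cons {e : EdgeType} {u v b : V} {p : List (EdgeType × V)} :
    H.IsPath u b ((e, v) :: p) ↔ H.HasEdge e u v ∧ u ∉ walkVertices v p ∧ H.IsPath v b p := by
  simp only [IsPath, IsWalkFrom, walkVertices, List.map_cons, List.nodup_cons,
    List.getLast?_cons_cons]
  tauto

/-- There is a walk from `u` to `Y` whose inner colliders satisfy `C` and whose other inner
vertices satisfy `N`; `u` counts as an inner vertex that is reached with an arrowhead at `u` if
`h` holds. -/
inductive OpenTo (H : MixedGraph V) (C N : V → Prop) (Y : Set V) : Prop → V → Prop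
  | base {h : Prop} {v : V} : v ∈ Y → OpenTo H C N Y h v
  | collider {h : Prop} {e : EdgeType} {u v : V} : H.HasEdge e u v →
      OpenTo H C N Y e.headAtTarget v → h → e.headAtSource → C u → OpenTo H C N Y h u
  | nonCollider {h : Prop} {e : EdgeType} {u v : V} : H.HasEdge e u v →
      OpenTo H C N Y e.headAtTarget v → ¬ (h ∧ e.headAtSource) → N u → OpenTo H C N Y h u

/-- There is a walk from `u` to `Y` that is not blocked by `Z`. -/
def OpenGiven (H : MixedGraph V) (Z Y : Set V) (h : Prop) (u : V) : Prop :=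
  H.OpenTo (fun v => (H.De {v} ∩ Z).Nonempty) (fun v => v ∉ Z) Y h u

theorem openGiven_of_walk {Z Y : Set V} {b : V} (hb : b ∈ Y) (p : List (EdgeType × V)) {u : V}
    {h : Prop} (hp : H.IsWalkFrom u p) (hl : (walkVertices u p).getLast? = some b)
    (hu : H.IsUnblocked Z p) (hpass : H.Passes Z h u p) : H.OpenGiven Z Y h u := by
  induction p generalizing u h with
  | nil =>
    simp only [walkVertices, List.map_nil, List.getLast?_singleton, Option.some.injEq] at hl
    exact .base (hl ▸ hb)
  | cons a p ih =>
    obtain ⟨e, v⟩ := a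
    obtain ⟨hp₁, hp₂⟩ := isUnblocked_cons.1 hu
    have hv := ih hp.2 (by simpa only [walkVertices, List.map_cons, List.getLast?_cons_cons]
      using hl) hp₂ hp₁
    by_cases hc : h ∧ e.headAtSource
    · exact .collider hp.1 hv hc.1 hc.2 (hpass.1 hc)
    · exact .nonCollider hp.1 hv hc (hpass.2 hc)

/-- The part of a path from its vertex `u` on. -/
theorem exists_suffix {Z : Set V} {b u : V} {D : Prop} (q : List (EdgeType × V)) {v : V}
    {g : Prop} (hpass : H.Passes Z g v q) (hu : H.IsUnblocked Z q) (hq : H.IsPath v b q)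
    (hD : (g ∧ TransGen H.dir u v) ∨ (H.De {u} ∩ Z).Nonempty ∨ D)
    (hmem : u ∈ walkVertices v q) :
    ∃ p g', H.IsPath u b p ∧ H.IsUnblocked Z p ∧ H.Passes Z g' u p ∧
      (TransGen H.dir u u ∨ (H.De {u} ∩ Z).Nonempty ∨ D) := by
  induction q generalizing v g with
  | nil =>
    obtain rfl : u = v := by simpa [walkVertices] using hmem
    exact ⟨[], g, hq, hu, hpass, hD.imp (·.2) id⟩
  | cons a q ih =>
    obtain ⟨f, w⟩ := a
    by_cases huv : u = v
    · subst huv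
      exact ⟨_, g, hq, hu, hpass, hD.imp (·.2) id⟩
    · obtain ⟨hp₁, hp₂⟩ := isUnblocked_cons.1 hu
      obtain ⟨hf, -, hq'⟩ := isPath_cons.1 hq
      refine ih hp₁ hp₂ hq' ?_ (by
        rcases List.mem_cons.1 hmem with h | h
        · exact absurd h huv
        · exact h)
      -- While the path follows arrows away from `u`, its vertices are descendants of `u`. The first
      -- edge with an arrowhead at its source makes a collider, whose descendant in `Z` is also a
      -- descendant of `u`.
      rcases hD with ⟨hg, ht⟩ | hD
      · cases f with
        | right => exact .inl ⟨trivial, ht.tail hf⟩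
        | left => exact .inr (.inl (De_inter_nonempty_of_reflTransGen ht.to_reflTransGen
            (hpass.1 ⟨hg, trivial⟩)))
        | both => exact .inr (.inl (De_inter_nonempty_of_reflTransGen ht.to_reflTransGen
            (hpass.1 ⟨hg, trivial⟩)))
      · exact .inr hD

/-- Walks that are not blocked can be shortened to paths. -/
theorem exists_path_cons (hac : ∀ v, ¬ TransGen H.dir v v) {Z : Set V} {b u v : V}
    {e : EdgeType} {q : List (EdgeType × V)} {h : Prop} (he : H.HasEdge e u v)
    (hq : H.IsPath v b q) (hu : H.IsUnblocked Z q) (hpass : H.Passes Z e.headAtTarget v q)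
    (hpass' : H.Passes Z h u ((e, v) :: q)) :
    ∃ p, H.IsPath u b p ∧ H.IsUnblocked Z p ∧ H.Passes Z h u p := by
  by_cases hmem : u ∈ walkVertices v q
  -- The walk returns to `u`, and the closed part is cut out. If `u` becomes a collider by this,
  -- then the closed part was directed, which acyclicity excludes, or `u` has a descendant in `Z`,
  -- or `u` was a collider before.
  · obtain ⟨p, g, hp, hpu, hpp, hD⟩ := exists_suffix (D := e.headAtSource) q hpass hu hq (by
      cases e with
      | right => exact .inl ⟨trivial, .single he⟩
      | left => exact .inr (.inr trivial)
      | both => exact .inr (.inr trivial)) hmem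
    refine ⟨p, hp, hpu, ?_⟩
    match p, hpp with
    | [], _ => trivial
    | (f, w) :: p, hpp =>
      refine ⟨fun hc => ?_, fun hc => ?_⟩
      · rcases hD with hD | hD | hD
        · exact absurd hD (hac u)
        · exact hD
        · exact hpass'.1 ⟨hc.1, hD⟩
      -- If `u` is not a collider now, it was none at one of its two occurrences: at the later one
      -- if `h` holds, at the earlier one if not.
      · by_cases hh : h
        · exact hpp.2 fun h' => hc ⟨hh, h'.2⟩
        · exact hpass'.2 fun h' => hh h'.1
  · exact ⟨(e, v) :: q, isPath_cons.2 ⟨he, hmem, hq⟩, isUnblocked_cons.2 ⟨hpass, hu⟩, hpass'⟩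

theorem OpenGiven.exists_path (hac : ∀ v, ¬ TransGen H.dir v v) {Z Y : Set V} {h : Prop} {u : V}
    (ho : H.OpenGiven Z Y h u) :
    ∃ b ∈ Y, ∃ p, H.IsPath u b p ∧ H.IsUnblocked Z p ∧ H.Passes Z h u p := by
  induction ho with
  | @base h v hv => exact ⟨v, hv, [], by simp [IsPath, IsWalkFrom, walkVertices], trivial, trivial⟩
  | collider he _ hh hs hC ih =>
    obtain ⟨b, hb, q, hq, hu, hpass⟩ := ih
    exact ⟨b, hb, exists_path_cons hac he hq hu hpass
      ⟨fun _ => hC, fun h' => absurd ⟨hh, hs⟩ h'⟩⟩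
  | nonCollider he _ hh hN ih =>
    obtain ⟨b, hb, q, hq, hu, hpass⟩ := ih
    exact ⟨b, hb, exists_path_cons hac he hq hu hpass
      ⟨fun h' => absurd h' hh, fun _ => hN⟩⟩

/-- In an acyclic graph open walks can be shortened to open paths, so d-connection becomes a
reachability question. Walks treat their start as an inner non-collider, hence the disjointness of
`A` and `Z`. -/
theorem not_dSep_iff (hac : ∀ v, ¬ TransGen H.dir v v) {A Y Z : Set V} (hA : Disjoint A Z) :
    ¬ H.DSep A Y Z ↔ ∃ a ∈ A, H.OpenGiven Z Y False a := by
  constructor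
  · intro h
    simp only [DSep, not_forall, not_not] at h
    obtain ⟨a, ha, b, hb, p, hp, hu⟩ := h
    refine ⟨a, ha, openGiven_of_walk hb p hp.1 hp.2.2 hu ?_⟩
    match p with
    | [] => trivial
    | (f, w) :: p => exact ⟨fun h' => h'.1.elim, fun _ => Set.disjoint_left.1 hA ha⟩
  · rintro ⟨a, ha, ho⟩ h
    obtain ⟨b, hb, p, hp, hu, -⟩ := ho.exists_path hac
    exact h a ha b hb p hp hu

/-- The walk first climbs from `c` to `u` against the arrows; it arrives everywhere without an
arrowhead, so no vertex on the way is a collider. -/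
theorem OpenGiven.of_reflTransGen {U Y : Set V} {u c : V} (ho : H.OpenGiven U Y False u)
    (huc : ReflTransGen H.dir u c) (hfree : ∀ w, ReflTransGen H.dir u w → w ∉ U) :
    H.OpenGiven U Y False c := by
  induction huc with
  | refl => exact ho
  | tail hub hbc ih =>
    exact .nonCollider (e := .left) hbc ih (fun h' => h'.1) (hfree _ (hub.tail hbc))

theorem openGiven_of_reflTransGen {U Y : Set V} {u y : V} (hy : y ∈ Y)
    (huy : ReflTransGen H.dir u y) (hfree : ∀ w, ReflTransGen H.dir u w → w ∉ U) (h : Prop) :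
    H.OpenGiven U Y h u := by
  induction huy using ReflTransGen.head_induction_on generalizing h with
  | refl => exact .base hy
  | head hab _ ih =>
    exact .nonCollider (e := .right) hab (ih (fun w hw => hfree w (.head hab hw)) _)
      (fun h' => h'.2) (hfree _ .refl)

/-! ### Treks -/

/-- There are directed paths that start outside `Z` in the same vertex or in the two ends of a
bidirected edge and lead to `a` and to a vertex of `Y`. -/
def Trek (H : MixedGraph V) (Z Y : Set V) (a : V) : Prop :=
  ∃ c d, c ∉ Z ∧ d ∉ Z ∧ ReflTransGen H.dir c a ∧ (∃ y ∈ Y, ReflTransGen H.dir d y) ∧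
    (c = d ∨ H.bi c d)

/-- Since no edge points into `Z`, no vertex outside `Z` has a descendant in `Z`, and colliders are
always closed. A walk without colliders climbs, crosses at most one bidirected edge, and descends.
-/
theorem openGiven_iff_trek {Z Y : Set V} (hdir : ∀ u, ∀ z ∈ Z, ¬ H.dir u z)
    (hbi : ∀ u, ∀ z ∈ Z, ¬ H.bi u z) (hY : Disjoint Y Z) {a : V} (ha : a ∉ Z) :
    H.OpenGiven Z Y False a ↔ H.Trek Z Y a := by
  have hmem : ∀ u, (H.De {u} ∩ Z).Nonempty → u ∈ Z := by
    rintro u ⟨z, ⟨c, rfl, hc⟩, hz⟩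
    rcases hc.cases_tail with rfl | ⟨w, _, hw⟩
    · exact hz
    · exact absurd hw (hdir w z hz)
  constructor
  -- Once a vertex is entered with an arrowhead, the rest of the walk must descend to `Y`.
  · have key : ∀ h v, H.OpenGiven Z Y h v → v ∉ Z →
        (h → ∃ y ∈ Y, ReflTransGen H.dir v y) ∧ H.Trek Z Y v := by
      intro h v ho
      induction ho with
      | base hv =>
        exact fun hvZ => ⟨fun _ => ⟨_, hv, .refl⟩, _, _, hvZ, hvZ, .refl, ⟨_, hv, .refl⟩, .inl rfl⟩
      | collider _ _ _ _ hC _ => exact fun hu => absurd (hmem _ hC) hu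
      | @nonCollider h e u v he ho hh hN ih =>
        intro hu
        cases e with
        | right =>
          obtain ⟨y, hy, hvy⟩ := (ih fun hv => hdir _ _ hv he).1 trivial
          exact ⟨fun _ => ⟨y, hy, .head he hvy⟩, u, u, hu, hu, .refl, ⟨y, hy, .head he hvy⟩,
            .inl rfl⟩
        | left =>
          have hv : v ∉ Z := by
            cases ho with
            | base hv => exact Set.disjoint_left.1 hY hv
            | collider _ _ h' => exact h'.elim
            | nonCollider _ _ _ h' => exact h'
          obtain ⟨c, d, hc, hd, hcv, hdy, hcd⟩ := (ih hv).2
          exact ⟨fun h => absurd ⟨h, trivial⟩ hh, c, d, hc, hd, hcv.tail he, hdy, hcd⟩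
        | both =>
          have hv : v ∉ Z := fun hv => hbi _ _ hv he
          exact ⟨fun h => absurd ⟨h, trivial⟩ hh, u, v, hu, hv, .refl, (ih hv).1 trivial, .inr he⟩
    exact fun ho => (key _ _ ho ha).2
  · rintro ⟨c, d, hc, hd, hca, ⟨y, hy, hdy⟩, hcd⟩
    have hfree : ∀ v, v ∉ Z → ∀ w, ReflTransGen H.dir v w → w ∉ Z := fun v hv w hw hwZ =>
      hv (hmem v ⟨w, ⟨v, rfl, hw⟩, hwZ⟩)
    have hd' := openGiven_of_reflTransGen hy hdy (hfree d hd)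
    refine OpenGiven.of_reflTransGen ?_ hca (hfree c hc)
    rcases hcd with rfl | hcd
    · exact hd' _
    · exact .nonCollider (e := .both) hcd (hd' _) (fun h' => h'.1) hc

/-! ### Moralization -/

/-- `u` and `w` are connected by a path in `A` all of whose inner vertices are colliders. -/
def MoralAdj (H : MixedGraph V) (A : Set V) (u w : V) : Prop :=
  u ∈ A ∧ w ∈ A ∧ ∃ c ∈ A, ∃ d ∈ A, (u = c ∨ H.dir u c) ∧
    ReflTransGen (fun p q => H.bi p q ∧ p ∈ A ∧ q ∈ A) c d ∧ (d = w ∨ H.dir w d)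

/-- Steps along `N` to vertices outside `Z`. -/
def Avoiding (N : V → V → Prop) (Z : Set V) (u w : V) : Prop := N u w ∧ w ∉ Z

/-- There is a walk in `A` from `u` to `Y` whose inner vertices in `Z` are colliders. -/
def OpenIn (H : MixedGraph V) (A Z Y : Set V) (h : Prop) (u : V) : Prop :=
  H.OpenTo (fun v => v ∈ A) (fun v => v ∈ A ∧ v ∉ Z) Y h u

theorem OpenIn.mem {A Z Y : Set V} (hY : Y ⊆ A) {h : Prop} {u : V} (ho : H.OpenIn A Z Y h u) :
    u ∈ A := by
  cases ho with
  | base hu => exact hY hu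
  | collider _ _ _ _ hu => exact hu
  | nonCollider _ _ _ hu => exact hu.1

theorem OpenIn.cons {A Z Y : Set V} {h : Prop} {e : EdgeType} {u v : V} (he : H.HasEdge e u v)
    (ho : H.OpenIn A Z Y e.headAtTarget v) (hA : u ∈ A) (hZ : u ∉ Z) : H.OpenIn A Z Y h u := by
  by_cases hc : h ∧ e.headAtSource
  · exact .collider he ho hc.1 hc.2 hA
  · exact .nonCollider he ho hc ⟨hA, hZ⟩

/-- Cut the walk at its non-colliders: each piece between them has only colliders inside and is one
moral edge. Conversely, moral edges are expanded; a junction that becomes a collider does no harm,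
since colliders need only lie in `A`. -/
theorem openIn_iff {A Z Y : Set V} (hYA : Y ⊆ A) (hYZ : Disjoint Y Z) {u : V} (hu : u ∉ Z) :
    H.OpenIn A Z Y False u ↔ ∃ y ∈ Y, ReflTransGen (Avoiding (H.MoralAdj A) Z) u y := by
  constructor
  -- The first part describes a piece in progress: bidirected edges lead from `v` to `d`, and `w`,
  -- the next non-collider or the end, is `d` or a parent of `d`. The second part applies if `v` is
  -- entered without an arrowhead and so ends a piece.
  · have key : ∀ h v, H.OpenIn A Z Y h v →
        (∃ w, ((∃ y ∈ Y, ReflTransGen (Avoiding (H.MoralAdj A) Z) w y) ∧ w ∈ A ∧ w ∉ Z) ∧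
          ∃ d ∈ A, ReflTransGen (fun p q => H.bi p q ∧ p ∈ A ∧ q ∈ A) v d ∧
            (d = w ∨ H.dir w d)) ∧
        (¬ h → (∃ y ∈ Y, ReflTransGen (Avoiding (H.MoralAdj A) Z) v y) ∧ v ∉ Z) := by
      intro h v ho
      induction ho with
      | @base h v hv =>
        have := Set.disjoint_left.1 hYZ hv
        exact ⟨⟨v, ⟨⟨v, hv, .refl⟩, hYA hv, this⟩, v, hYA hv, .refl, .inl rfl⟩,
          fun _ => ⟨⟨v, hv, .refl⟩, this⟩⟩
      | @collider h e u v he ho hh hs hu ih =>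
        have hvA : v ∈ A := OpenIn.mem hYA ho
        refine ⟨?_, fun h' => absurd hh h'⟩
        cases e with
        | right => exact hs.elim
        | left => exact ⟨v, ⟨(ih.2 id).1, hvA, (ih.2 id).2⟩, u, hu, .refl, .inr he⟩
        | both =>
          obtain ⟨w, hw, d, hd, hvd, hdw⟩ := ih.1
          exact ⟨w, hw, d, hd, .head ⟨he, hu, hvA⟩ hvd, hdw⟩
      | @nonCollider h e u v he ho hh hu ih =>
        have hvA : v ∈ A := OpenIn.mem hYA ho
        have hr : ∃ y ∈ Y, ReflTransGen (Avoiding (H.MoralAdj A) Z) u y := by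
          obtain ⟨w, ⟨⟨y, hy, hwy⟩, hwA, hwZ⟩, d, hd, hvd, hdw⟩ := ih.1
          cases e with
          | right => exact ⟨y, hy, .head ⟨⟨hu.1, hwA, v, hvA, d, hd, .inr he, hvd, hdw⟩, hwZ⟩ hwy⟩
          | left =>
            obtain ⟨⟨y, hy, hvy⟩, hvZ⟩ := ih.2 id
            exact ⟨y, hy, .head ⟨⟨hu.1, hvA, u, hu.1, u, hu.1, .inl rfl, .refl, .inr he⟩, hvZ⟩ hvy⟩
          | both => exact ⟨y, hy, .head ⟨⟨hu.1, hwA, u, hu.1, d, hd, .inl rfl,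
              .head ⟨he, hu.1, hvA⟩ hvd, hdw⟩, hwZ⟩ hwy⟩
        exact ⟨⟨u, ⟨hr, hu⟩, u, hu.1, .refl, .inl rfl⟩, fun _ => ⟨hr, hu.2⟩⟩
    exact fun ho => ((key _ _ ho).2 id).1
  · rintro ⟨y, hy, h⟩
    suffices ∀ h, H.OpenIn A Z Y h u from this _
    induction h using ReflTransGen.head_induction_on with
    | refl => exact fun h => .base hy
    | @head u w huw _ ih =>
      obtain ⟨⟨huA, hwA, c, hc, d, hd, huc, hcd, hdw⟩, hwZ⟩ := huw
      have hw := ih hwZ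
      have hd' : H.OpenIn A Z Y True d := by
        rcases hdw with rfl | hdw
        · exact hw _
        · exact .collider (e := .left) hdw (hw _) trivial trivial hd
      have hdist : ∀ q ∈ A, ReflTransGen (fun p q => H.bi p q ∧ p ∈ A ∧ q ∈ A) q d →
          H.OpenIn A Z Y True q := by
        intro q hq hqd
        induction hqd using ReflTransGen.head_induction_on with
        | refl => exact hd'
        | head hpq _ ih => exact .collider (e := .both) hpq.1 (ih hpq.2.2) trivial trivial hq
      intro h
      rcases huc with rfl | huc
      · rcases hcd.cases_head with rfl | ⟨q, hq, hqd⟩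
        · rcases hdw with rfl | hdw
          · exact hw _
          · exact OpenIn.cons (e := .left) hdw (hw _) huA hu
        · exact OpenIn.cons (e := .both) hq.1 (hdist q hq.2.2 hqd) huA hu
      · exact OpenIn.cons (e := .right) huc (hdist c hc hcd) huA hu

/-- A set of ancestors of `X ∪ Y` that separates `X` and `Y` in the moral graph of the ancestors
d-separates them. -/
theorem dSep_of_moral (hac : ∀ v, ¬ TransGen H.dir v v) {X Y Z : Set V}
    (hX : Disjoint X Z) (hY : Disjoint Y Z) (hZ : Z ⊆ H.An (X ∪ Y))
    (h : ∀ x ∈ X, ∀ y ∈ Y, ¬ ReflTransGen (Avoiding (H.MoralAdj (H.An (X ∪ Y))) Z) x y) :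
    H.DSep X Y Z := by
  by_contra hs
  obtain ⟨x, hx, ho⟩ := (not_dSep_iff hac hX).1 hs
  have hXA : X ⊆ H.An (X ∪ Y) := fun v hv => ⟨v, .inl hv, .refl⟩
  have hYA : Y ⊆ H.An (X ∪ Y) := fun v hv => ⟨v, .inr hv, .refl⟩
  have hanc : ∀ {u v}, v ∈ H.An (X ∪ Y) → ReflTransGen H.dir u v → u ∈ H.An (X ∪ Y) := by
    rintro u v ⟨c, hc, hvc⟩ huv
    exact ⟨c, hc, huv.trans hvc⟩
  have hDe : ∀ {u}, (H.De {u} ∩ Z).Nonempty → u ∈ H.An (X ∪ Y) := by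
    rintro u ⟨z, ⟨c, rfl, hc⟩, hz⟩
    exact hanc (hZ hz) hc
  -- After an arrowhead the walk descends until it meets `Y` or a collider; an open collider is an
  -- ancestor of `Z`, hence of `X ∪ Y`.
  have hhead : ∀ (h : Prop) v, H.OpenGiven Z Y h v → h → v ∈ H.An (X ∪ Y) := by
    intro h v ho
    induction ho with
    | base hv => exact fun _ => hYA hv
    | collider _ _ _ _ hC _ => exact fun _ => hDe hC
    | @nonCollider h e u v he _ hh _ ih =>
      intro h'
      cases e with
      | right => exact hanc (ih trivial) (.single he)
      | left => exact absurd ⟨h', trivial⟩ hh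
      | both => exact absurd ⟨h', trivial⟩ hh
  have key : ∀ h v, H.OpenGiven Z Y h v → (¬ h → v ∈ H.An (X ∪ Y)) →
      H.OpenIn (H.An (X ∪ Y)) Z Y h v := by
    intro h v ho
    induction ho with
    | base hv => exact fun _ => .base hv
    | @collider h e u v he ho hh hs hC ih =>
      refine fun _ => .collider he (ih fun h' => ?_) hh hs (hDe hC)
      cases e with
      | right => exact hs.elim
      | left => exact hanc (hDe hC) (.single he)
      | both => exact absurd trivial h'
    | @nonCollider h e u v he ho hh hN ih =>
      intro hu
      have huA : u ∈ H.An (X ∪ Y) := by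
        by_cases h' : h
        · exact hhead _ _ (.nonCollider he ho hh hN) h'
        · exact hu h'
      refine .nonCollider he (ih fun h' => ?_) hh ⟨huA, hN⟩
      cases e with
      | right => exact absurd trivial h'
      | left => exact hanc huA (.single he)
      | both => exact absurd trivial h'
  obtain ⟨y, hy, hxy⟩ := (openIn_iff hYA hY (Set.disjoint_left.1 hX hx)).1
    (key _ _ ho fun _ => hXA hx)
  exact h x hx y hy hxy

/-- A set that d-separates `X` and `Y` separates them in the moral graph of the ancestors of
`X ∪ Y`. -/
theorem DSep.moral (hac : ∀ v, ¬ TransGen H.dir v v) {X Y U : Set V}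
    (hX : Disjoint X U) (hY : Disjoint Y U) (hs : H.DSep X Y U) :
    ∀ x ∈ X, ∀ y ∈ Y, ¬ ReflTransGen (Avoiding (H.MoralAdj (H.An (X ∪ Y))) U) x y := by
  intro x hx y hy hxy
  have hYA : Y ⊆ H.An (X ∪ Y) := fun v hv => ⟨v, .inr hv, .refl⟩
  refine (not_dSep_iff hac hX).2 ?_ hs
  -- A collider without descendants in `U` still has a directed path to `X` or `Y`, which avoids
  -- `U`. If it leads to `Y`, the walk ends along it; if it leads to `X`, a new walk starts there,
  -- climbs to the collider and goes on.
  have key : ∀ h v, H.OpenIn (H.An (X ∪ Y)) U Y h v →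
      H.OpenGiven U Y h v ∨ ∃ x ∈ X, H.OpenGiven U Y False x := by
    intro h v ho
    induction ho with
    | base hv => exact .inl (.base hv)
    | @nonCollider h e u v he ho hh hu ih => exact ih.imp (fun h' => .nonCollider he h' hh hu.2) id
    | @collider h e u v he ho hh hs hu ih =>
      rcases ih with ih | ih
      · by_cases hD : (H.De {u} ∩ U).Nonempty
        · exact .inl (.collider he ih hh hs hD)
        · have hfree : ∀ w, ReflTransGen H.dir u w → w ∉ U := fun w hw hwU =>
            hD ⟨w, ⟨u, rfl, hw⟩, hwU⟩
          obtain ⟨c, hc, huc⟩ := hu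
          rcases hc with hc | hc
          · exact .inr ⟨c, hc, OpenGiven.of_reflTransGen
              (.nonCollider he ih (fun h' => h'.1) (hfree u .refl)) huc hfree⟩
          · exact .inl (openGiven_of_reflTransGen hc huc hfree h)
      · exact .inr ih
  rcases key _ _ ((openIn_iff hYA hY (Set.disjoint_left.1 hX hx)).2 ⟨y, hy, hxy⟩) with h | h
  · exact ⟨x, hx, h⟩
  · exact h

end MixedGraph

open Relation

/-! ## Bipartite matchings and vertex covers -/

section Matching

variable {α : Type*} {B m : α → α → Prop}

/-- `m` is a matching in the bipartite graph `B`, whose sides are two copies of `α`. -/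
structure IsMatching (B m : α → α → Prop) : Prop where
  sub : ∀ {u w}, m u w → B u w
  right_unique : ∀ {u w w'}, m u w → m u w' → w = w'
  left_unique : ∀ {u u' w}, m u w → m u' w → u = u'

/-- The left vertices that are matched. -/
def matched (m : α → α → Prop) : Set α := {u | ∃ w, m u w}

/-- `L` and `R` are the two parts of a vertex cover. -/
def IsCover (B : α → α → Prop) (L R : Set α) : Prop := ∀ u w, B u w → u ∈ L ∨ w ∈ R

/-- `ρ` contains the right vertices on alternating walks from unmatched left vertices, and all of
them are matched. -/
structure Stuck (B m : α → α → Prop) (ρ : Set α) : Prop where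
  of_unmatched : ∀ {u w}, u ∉ matched m → B u w → w ∈ ρ
  of_matched : ∀ {u v w}, m u v → v ∈ ρ → B u w → w ∈ ρ
  exists_mate : ∀ {w}, w ∈ ρ → ∃ u, m u w

/-- Weak duality: each matching edge uses up a cover vertex of its own. -/
theorem IsMatching.ncard_le [Finite α] (hm : IsMatching B m) {L R : Set α}
    (hc : IsCover B L R) : (matched m).ncard ≤ L.ncard + R.ncard := by
  have h₁ : matched m ⊆ L ∪ {u | ∃ w ∈ R, m u w} := by
    rintro u ⟨w, hw⟩
    exact (hc u w (hm.sub hw)).imp id fun h => ⟨w, h, hw⟩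
  have h₂ : {u | ∃ w ∈ R, m u w}.ncard ≤ R.ncard := by
    choose! f hf using fun u (hu : ∃ w ∈ R, m u w) => hu
    refine Set.ncard_le_ncard_of_injOn f (fun u hu => (hf u hu).1) fun u hu v hv huv => ?_
    exact hm.left_unique (hf u hu).2 (huv ▸ (hf v hv).2)
  calc (matched m).ncard ≤ _ := Set.ncard_le_ncard h₁
    _ ≤ _ := Set.ncard_union_le _ _
    _ ≤ _ := by omega

theorem Stuck.isCover {ρ : Set α} (hs : Stuck B m ρ) :
    IsCover B {u | ∃ w, m u w ∧ w ∉ ρ} ρ := by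
  intro u w hB
  by_cases hu : u ∈ matched m
  · obtain ⟨v, hv⟩ := hu
    by_cases hvρ : v ∈ ρ
    · exact .inr (hs.of_matched hv hvρ hB)
    · exact .inl ⟨v, hv, hvρ⟩
  · exact .inr (hs.of_unmatched hu hB)

/-- König's cover is tight: members of `ρ` are counted by their mates, and these differ from the
left vertices whose mate lies outside `ρ`. -/
theorem Stuck.le_ncard [Finite α] {ρ : Set α} (hm : IsMatching B m) (hs : Stuck B m ρ) :
    {u | ∃ w, m u w ∧ w ∉ ρ}.ncard + ρ.ncard ≤ (matched m).ncard := by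
  have h₂ : ρ.ncard ≤ {u | ∃ w, m u w ∧ w ∈ ρ}.ncard := by
    choose! f hf using fun w (hw : w ∈ ρ) => hs.exists_mate hw
    refine Set.ncard_le_ncard_of_injOn f (fun w hw => ⟨w, hf w hw, hw⟩) fun u hu v hv huv => ?_
    exact hm.right_unique (hf u hu) (huv ▸ hf v hv)
  have hd : Disjoint {u | ∃ w, m u w ∧ w ∉ ρ} {u | ∃ w, m u w ∧ w ∈ ρ} := by
    rw [Set.disjoint_left]
    rintro u ⟨w, hw, hwρ⟩ ⟨w', hw', hwρ'⟩
    exact hwρ (hm.right_unique hw hw' ▸ hwρ')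
  calc _ ≤ {u | ∃ w, m u w ∧ w ∉ ρ}.ncard + {u | ∃ w, m u w ∧ w ∈ ρ}.ncard := by omega
    _ = _ := (Set.ncard_union_eq hd).symm
    _ ≤ _ := by
      refine Set.ncard_le_ncard ?_
      rintro u (⟨w, hw, _⟩ | ⟨w, hw, _⟩) <;> exact ⟨w, hw⟩

end Matching

/-! ## Vertex separators -/

section Cut

open MixedGraph (Avoiding)

variable {α : Type} {N : α → α → Prop} {X Y M : Set α}

/-- The vertices of `M` that are the first ones in `M` on some path from `X`. -/
def sources (N : α → α → Prop) (X M : Set α) : Set α := {v ∈ M | ∃ x ∈ X, PathIn N Mᶜ x v}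

/-- The vertices of `M` that are the last ones in `M` on some path to `Y`. -/
def targets (N : α → α → Prop) (Y M : Set α) : Set α := {v ∈ M | ∃ y ∈ Y, PathIn N Mᶜ v y}

/-- The bipartite graph whose vertex covers correspond to the separators in `M`. -/
def cutGraph (N : α → α → Prop) (X Y M : Set α) (u w : α) : Prop :=
  (u ∈ M ∧ u ∉ targets N Y M) ∧ (w ∈ M ∧ w ∉ sources N X M) ∧ (u = w ∨ PathIn N Mᶜ u w)

/-- The separator given by a vertex cover. -/
def coverCut (N : α → α → Prop) (X Y M L R : Set α) : Set α :=
  {v ∈ M | (v ∈ sources N X M ∨ v ∈ R) ∧ (v ∈ targets N Y M ∨ v ∈ L)}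

/-- Every vertex of `M` on a path from `X` that avoids the cut is free, that is, outside `targets`
and `L`. The first one is in `sources`; if the preceding one is free, the cover condition puts the
next one into `sources` or `R`. Avoiding the cut then makes it free too. From a free vertex `Y`
cannot be reached outside `M`. -/
theorem coverCut_separates {L R : Set α} (hX : Disjoint X M) (hY : Disjoint Y M)
    (hXY : Disjoint X Y) (hP : ∀ x ∈ X, ∀ y ∈ Y, ¬ PathIn N Mᶜ x y)
    (hc : IsCover (cutGraph N X Y M) L R) :
    ∀ x ∈ X, ∀ y ∈ Y, ¬ ReflTransGen (Avoiding N (coverCut N X Y M L R)) x y := by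
  intro x hx y hy hxy
  let free : Set α := {v | v ∈ M ∧ v ∉ targets N Y M ∧ v ∉ L}
  have key : ∀ v, ReflTransGen (Avoiding N (coverCut N X Y M L R)) x v →
      v ∈ free ∨ (v ∉ M ∧ ∃ o, (o ∈ X ∨ o ∈ free) ∧ (o = v ∨ PathIn N Mᶜ o v)) := by
    intro v hv
    induction hv with
    | refl => exact .inr ⟨Set.disjoint_left.1 hX hx, x, .inl hx, .inl rfl⟩
    | @tail v w _ hvw ih =>
      obtain ⟨o, ho, how⟩ : ∃ o, (o ∈ X ∨ o ∈ free) ∧ PathIn N Mᶜ o w := by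
        rcases ih with ih | ⟨hvM, o, ho, rfl | hov⟩
        · exact ⟨v, .inr ih, .single hvw.1⟩
        · exact ⟨o, ho, .single hvw.1⟩
        · exact ⟨o, ho, .trans hov hvM (.single hvw.1)⟩
      by_cases hwM : w ∈ M
      · left
        have hSR : w ∈ sources N X M ∨ w ∈ R := by
          by_contra! hn
          rcases ho with ho | ho
          · exact hn.1 ⟨hwM, o, ho, how⟩
          · rcases hc o w ⟨⟨ho.1, ho.2.1⟩, ⟨hwM, hn.1⟩, .inr how⟩ with h | h
            · exact ho.2.2 h
            · exact hn.2 h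
        have hTL : ¬ (w ∈ targets N Y M ∨ w ∈ L) := fun h => hvw.2 ⟨hwM, hSR, h⟩
        exact ⟨hwM, fun h => hTL (.inl h), fun h => hTL (.inr h)⟩
      · exact .inr ⟨hwM, o, ho, .inr how⟩
  rcases key y hxy with h | ⟨-, o, ho | ho, rfl | hoy⟩
  · exact Set.disjoint_left.1 hY hy h.1
  · exact Set.disjoint_left.1 hXY ho hy
  · exact hP o ho y hy hoy
  · exact Set.disjoint_left.1 hY hy ho.1
  · exact ho.2.1 ⟨ho.1, y, hy, hoy⟩

theorem exists_last_step {U : Set α} (hU : U ⊆ M) {u w : α} (h : PathIn N Mᶜ u w) :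
    ∃ v, ReflTransGen (Avoiding N U) u v ∧ N v w := by
  induction h with
  | single h => exact ⟨_, .refl, h⟩
  | trans _ hv _ ih₁ ih₂ =>
    obtain ⟨p, hp, hpv⟩ := ih₁
    obtain ⟨q, hq, hqw⟩ := ih₂
    exact ⟨q, (hp.tail ⟨hpv, fun h => hv (hU h)⟩).trans hq, hqw⟩

theorem reflTransGen_of_pathIn {U : Set α} (hU : U ⊆ M) {u w : α} (h : PathIn N Mᶜ u w)
    (hw : w ∉ U) : ReflTransGen (Avoiding N U) u w := by
  obtain ⟨v, hv, hvw⟩ := exists_last_step hU h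
  exact hv.tail ⟨hvw, hw⟩

/-- The chain is `|cut| + |M| = |a| + |b| ≤ |S| + |T| + |L| + |R| ≤ |S| + |T| + |m| ≤ |a'| + |b'| =
|a' ∩ b'| + |M| ≤ |U| + |M|`, where `|m|` is the size of the matching and the third inequality is
weak duality for the cover that `U` induces. -/
theorem ncard_coverCut_le [Finite α] {L R U : Set α} {m : α → α → Prop} (hX : Disjoint X M)
    (hY : Disjoint Y M) (hc : IsCover (cutGraph N X Y M) L R)
    (hm : IsMatching (cutGraph N X Y M) m) (hmc : L.ncard + R.ncard ≤ (matched m).ncard)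
    (hU : U ⊆ M) (hsep : ∀ x ∈ X, ∀ y ∈ Y, ¬ ReflTransGen (Avoiding N U) x y) :
    (coverCut N X Y M L R).ncard ≤ U.ncard := by
  set S := sources N X M with hS
  set T := targets N Y M with hT
  have hSM : S ⊆ M := fun v hv => hv.1
  have hTM : T ⊆ M := fun v hv => hv.1
  -- the two sides of the separator given by the cover
  let a : Set α := {v ∈ M | v ∈ S ∨ v ∈ R}
  let b : Set α := {v ∈ M | v ∈ T ∨ v ∈ L}
  -- The edges of `cutGraph` from a vertex to its own copy serve this purpose.
  have hab : M ⊆ a ∪ b := by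
    intro v hv
    by_contra hn
    simp only [Set.mem_union, not_or] at hn
    have h₁ : v ∉ S ∧ v ∉ R := not_or.1 fun h => hn.1 ⟨hv, h⟩
    have h₂ : v ∉ T ∧ v ∉ L := not_or.1 fun h => hn.2 ⟨hv, h⟩
    rcases hc v v ⟨⟨hv, h₂.1⟩, ⟨hv, h₁.1⟩, .inl rfl⟩ with h | h
    · exact h₂.2 h
    · exact h₁.2 h
  have hcut : coverCut N X Y M L R = a ∩ b := by
    ext v
    simp only [coverCut, a, b, Set.mem_inter_iff, Set.mem_ofPred_eq]
    tauto
  have h₁ : (a ∩ b).ncard + M.ncard = a.ncard + b.ncard := by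
    rw [← Set.ncard_union_add_ncard_inter a b, add_comm, Set.Subset.antisymm hab
      (Set.union_subset (fun v hv => hv.1) fun v hv => hv.1)]
  have h₂ : a.ncard ≤ S.ncard + R.ncard :=
    (Set.ncard_le_ncard fun v hv => hv.2).trans (Set.ncard_union_le _ _)
  have h₃ : b.ncard ≤ T.ncard + L.ncard :=
    (Set.ncard_le_ncard fun v hv => hv.2).trans (Set.ncard_union_le _ _)
  -- the two sides of the separator `U`
  let reach : Set α := {v | ∃ x ∈ X, ReflTransGen (Avoiding N U) x v}
  let a' : Set α := {v ∈ M | ∃ u ∈ reach, N u v}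
  let b' : Set α := {v ∈ M | v ∉ reach}
  have hstep : ∀ {u w}, u ∈ reach → PathIn N Mᶜ u w → w ∈ M → w ∈ a' := by
    rintro u w ⟨x, hx, hxu⟩ huw hw
    obtain ⟨v, hv, hvw⟩ := exists_last_step hU huw
    exact ⟨hw, v, ⟨x, hx, hxu.trans hv⟩, hvw⟩
  have hSa : S ⊆ a' := by
    rintro v ⟨hv, x, hx, hxv⟩
    exact hstep ⟨x, hx, .refl⟩ hxv hv
  have hTb : T ⊆ b' := by
    rintro v ⟨hv, y, hy, hvy⟩
    refine ⟨hv, ?_⟩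
    rintro ⟨x, hx, hxv⟩
    exact hsep x hx y hy (hxv.trans (reflTransGen_of_pathIn hU hvy
      fun h => Set.disjoint_left.1 hY hy (hU h)))
  have hMab : M ⊆ a' ∪ b' := by
    intro v hv
    by_cases hr : v ∈ reach
    · left
      obtain ⟨x, hx, hxv⟩ := hr
      rcases hxv.cases_tail with rfl | ⟨u, hxu, huv⟩
      · exact absurd hv (Set.disjoint_left.1 hX hx)
      · exact ⟨hv, u, ⟨x, hx, hxu⟩, huv.1⟩
    · exact .inr ⟨hv, hr⟩
  have h₄ : (a' ∩ b').ncard + M.ncard = a'.ncard + b'.ncard := by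
    rw [← Set.ncard_union_add_ncard_inter a' b', add_comm, Set.Subset.antisymm hMab
      (Set.union_subset (fun v hv => hv.1) fun v hv => hv.1)]
  have h₅ : (a' ∩ b').ncard ≤ U.ncard := by
    refine Set.ncard_le_ncard ?_
    rintro v ⟨⟨-, u, ⟨x, hx, hxu⟩, huv⟩, -, hv⟩
    by_contra hvU
    exact hv ⟨x, hx, hxu.tail ⟨huv, hvU⟩⟩
  -- An edge starting at a vertex that is reachable around `U` ends in `a'`; any other edge starts
  -- in `b'`.
  have h₆ : (matched m).ncard ≤ (b' \ T).ncard + (a' \ S).ncard := by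
    refine hm.ncard_le ?_
    rintro u w ⟨⟨hu, huT⟩, ⟨hw, hwS⟩, huw⟩
    by_cases hr : u ∈ reach
    · right
      refine ⟨?_, hwS⟩
      rcases huw with rfl | huw
      · rcases hMab hu with h | h
        · exact h
        · exact absurd hr h.2
      · exact hstep hr huw hw
    · exact .inl ⟨⟨hu, hr⟩, huT⟩
  have h₇ := Set.ncard_sdiff_add_ncard_of_subset hSa
  have h₈ := Set.ncard_sdiff_add_ncard_of_subset hTb
  rw [hcut]
  omega

end Cut

/-! ## Maximum matchings by augmenting paths -/

section Augment

variable {α : Type*} {B m par : α → α → Prop} {π ρ : Set α} {rank : α → ℕ} {k : ℕ}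

/-- The state of a search for augmenting paths of the matching `m`: the right vertices in `ρ` have
been reached, those in `π` have been processed, and `par u w` says that `w` was reached from the
left vertex `u`. -/
structure SearchInv (B m : α → α → Prop) (π ρ : Set α) (par : α → α → Prop) (rank : α → ℕ)
    (k : ℕ) : Prop where
  exists_par : ∀ {w}, w ∈ ρ → ∃ u, par u w
  par_sub : ∀ {u w}, par u w → B u w
  par_mem : ∀ {u w}, par u w → w ∈ ρ
  par_rank : ∀ {u w}, par u w → u ∈ matched m → ∃ v, m u v ∧ v ∈ π ∧ rank v < rank w
  processed_sub : π ⊆ ρ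
  of_unmatched : ∀ {u w}, u ∉ matched m → B u w → w ∈ ρ
  of_matched : ∀ {u v w}, m u v → v ∈ π → B u w → w ∈ ρ
  rank_le : ∀ {w}, w ∈ ρ → rank w ≤ k

/-- Such a vertex ends an augmenting path, but the search only marks it and continues; the end is
looked up later. -/
theorem SearchInv.of_unmated (h : SearchInv B m π ρ par rank k) {w : α} (hw : w ∈ ρ)
    (hm : ∀ u, ¬ m u w) : SearchInv B m (insert w π) ρ par rank (k + 1) where
  exists_par := h.exists_par
  par_sub := h.par_sub
  par_mem := h.par_mem
  par_rank hp hu := by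
    obtain ⟨v, hv, hvπ, hlt⟩ := h.par_rank hp hu
    exact ⟨v, hv, .inr hvπ, hlt⟩
  processed_sub := Set.insert_subset hw h.processed_sub
  of_unmatched := h.of_unmatched
  of_matched := by
    rintro u v x huv (rfl | hv) hB
    · exact absurd huv (hm u)
    · exact h.of_matched huv hv hB
  rank_le hw := (h.rank_le hw).trans (Nat.le_succ k)

open Classical in
-- The whole row of `v` in `par` may be overwritten in linear time: an earlier entry would require
-- the mate of `v`, which is `w`, to be already processed. New vertices get rank `k + 1`, above all
-- earlier ranks.
theorem SearchInv.of_mate (h : SearchInv B m π ρ par rank k) (hm : IsMatching B m) {v w : α}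
    (hw : w ∈ ρ) (hwπ : w ∉ π) (hvw : m v w) :
    SearchInv B m (insert w π) {x | x ∈ ρ ∨ B v x}
      (fun u x => (u = v ∧ B v x ∧ x ∉ ρ) ∨ (u ≠ v ∧ par u x))
      (fun x => if x ∈ ρ then rank x else k + 1) (k + 1) where
  exists_par := by
    intro x hx
    by_cases hxρ : x ∈ ρ
    · obtain ⟨u, hu⟩ := h.exists_par hxρ
      refine ⟨u, .inr ⟨?_, hu⟩⟩
      rintro rfl
      obtain ⟨y, hy, hyπ, -⟩ := h.par_rank hu ⟨w, hvw⟩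
      exact hwπ (hm.right_unique hvw hy ▸ hyπ)
    · exact ⟨v, .inl ⟨rfl, hx.resolve_left hxρ, hxρ⟩⟩
  par_sub := by
    rintro u x (⟨rfl, hB, -⟩ | ⟨-, hp⟩)
    · exact hB
    · exact h.par_sub hp
  par_mem := by
    rintro u x (⟨rfl, hB, -⟩ | ⟨-, hp⟩)
    · exact .inr hB
    · exact .inl (h.par_mem hp)
  par_rank := by
    rintro u x (⟨rfl, hB, hx⟩ | ⟨-, hp⟩) hu
    · exact ⟨w, hvw, .inl rfl, by simpa [hw, hx] using Nat.lt_succ_of_le (h.rank_le hw)⟩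
    · obtain ⟨y, hy, hyπ, hlt⟩ := h.par_rank hp hu
      exact ⟨y, hy, .inr hyπ, by simpa [h.processed_sub hyπ, h.par_mem hp] using hlt⟩
  processed_sub := by
    rintro x (rfl | hx)
    · exact .inl hw
    · exact .inl (h.processed_sub hx)
  of_unmatched hu hB := .inl (h.of_unmatched hu hB)
  of_matched := by
    rintro u y x huy (rfl | hy) hB
    · exact .inr (hm.left_unique huy hvw ▸ hB)
    · exact .inl (h.of_matched huy hy hB)
  rank_le := by
    intro x hx
    show (if x ∈ ρ then rank x else k + 1) ≤ k + 1
    split_ifs with hxρ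
    · exact (h.rank_le hxρ).trans (Nat.le_succ k)
    · exact le_rfl

/-- An intermediate stage of the flip of an augmenting path: `m'` is a matching as large as `m`
that does not cover the reached vertex `w`. -/
structure Flipping (B m : α → α → Prop) (ρ : Set α) (par : α → α → Prop) (rank : α → ℕ)
    (m' : α → α → Prop) (w : α) : Prop where
  isMatching : IsMatching B m'
  ncard_eq : (matched m').ncard = (matched m).ncard
  mem : w ∈ ρ
  free : ∀ u, ¬ m' u w
  agree : ∀ u v, par u v → rank v ≤ rank w → ∀ x, m' u x ↔ m u x

/-- The left vertex `u` is matched to `w` instead of its former mate. -/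
def rematch (m : α → α → Prop) (u w : α) (p x : α) : Prop := (p = u ∧ x = w) ∨ (p ≠ u ∧ m p x)

theorem isMatching_rematch {m' : α → α → Prop} (hm : IsMatching B m') {u w : α} (hB : B u w)
    (hw : ∀ u, ¬ m' u w) : IsMatching B (rematch m' u w) where
  sub := by
    rintro p x (⟨rfl, rfl⟩ | ⟨-, h⟩)
    · exact hB
    · exact hm.sub h
  right_unique := by
    rintro p x y (⟨rfl, rfl⟩ | ⟨h', h⟩) (⟨h₂, rfl⟩ | ⟨h₂', h₂⟩)
    · rfl
    · exact absurd rfl h₂'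
    · exact absurd h₂ h'
    · exact hm.right_unique h h₂
  left_unique := by
    rintro p q x (⟨rfl, rfl⟩ | ⟨h', h⟩) (⟨rfl, h₂⟩ | ⟨h₂', h₂⟩)
    · rfl
    · exact absurd h₂ (hw _)
    · exact absurd (h₂ ▸ h) (hw _)
    · exact hm.left_unique h h₂

theorem matched_rematch {m' : α → α → Prop} {u w : α} :
    matched (rematch m' u w) = insert u (matched m') := by
  ext p
  constructor
  · rintro ⟨x, ⟨rfl, -⟩ | ⟨-, h⟩⟩
    · exact .inl rfl
    · exact .inr ⟨x, h⟩
  · rintro (rfl | ⟨x, h⟩)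
    · exact ⟨w, .inl ⟨rfl, rfl⟩⟩
    · by_cases hp : p = u
      · exact ⟨w, .inl ⟨hp, rfl⟩⟩
      · exact ⟨x, .inr ⟨hp, h⟩⟩

theorem Flipping.last [Finite α] {m' : α → α → Prop} {u w : α}
    (h : Flipping B m ρ par rank m' w) (hs : SearchInv B m π ρ par rank k) (hu : par u w)
    (hum : ∀ x, ¬ m' u x) : IsMatching B (rematch m' u w) ∧
      (matched (rematch m' u w)).ncard = (matched m).ncard + 1 := by
  refine ⟨isMatching_rematch h.isMatching (hs.par_sub hu) h.free, ?_⟩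
  rw [matched_rematch, Set.ncard_insert_of_notMem (show u ∉ matched m' from
    fun h => hum _ h.choose_spec), h.ncard_eq]

/-- The left vertex `u` moves from `v` to `w`, so `v` is uncovered next. Everything with parent `u`
has larger rank than `v`; hence the rest of the path involves only unchanged rows, and the descent
in rank ensures termination. -/
theorem Flipping.next {m' : α → α → Prop} {u v w : α} (hm : IsMatching B m)
    (h : Flipping B m ρ par rank m' w) (hs : SearchInv B m π ρ par rank k) (hu : par u w)
    (huv : m' u v) : Flipping B m ρ par rank (rematch m' u w) v ∧ rank v < rank w := by
  have huv' := (h.agree u w hu le_rfl v).1 huv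
  have hmate : ∀ x, par u x → v ∈ π ∧ rank v < rank x := by
    intro x hx
    obtain ⟨y, hy, hyπ, hlt⟩ := hs.par_rank hx ⟨v, huv'⟩
    obtain rfl := hm.right_unique huv' hy
    exact ⟨hyπ, hlt⟩
  refine ⟨⟨isMatching_rematch h.isMatching (hs.par_sub hu) h.free, ?_,
    hs.processed_sub (hmate w hu).1, ?_, ?_⟩, (hmate w hu).2⟩
  · rw [matched_rematch, Set.insert_eq_of_mem (show u ∈ matched m' from ⟨v, huv⟩), h.ncard_eq]
  · rintro p (⟨rfl, rfl⟩ | ⟨hp, hpv⟩)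
    · exact h.free _ huv
    · exact hp (h.isMatching.left_unique hpv huv)
  · intro p x hp hle y
    have hpu : p ≠ u := by
      rintro rfl
      exact absurd (hmate x hp).2 (by omega)
    rw [← h.agree p x hp (hle.trans (hmate w hu).2.le) y]
    simp [rematch, hpu]

end Augment

/-! ### Commands for the search and the augmentation -/

namespace Cmd

/-- One step of the search: a vertex that has been reached is processed. -/
def searchStep : Cmd :=
  .seq (pick 23 (.conj (.cell 32 10 9) (.neg (.cell 33 10 9)))) <|
  .ite (.eq 23 0) .skip <|
  .seq (.write 33 23 9 (.eq 0 0)) <|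
  .seq (pick 24 (.cell 31 10 23)) <|
  .ite (.eq 24 0) .skip <|
  .seq (fillRow 34 24 (.conj (.cell 30 24 11) (.neg (.cell 32 11 9)))) <|
  -- Array `37` is a buffer, as the new content of array `32` depends on the old one.
  .seq (fillCol 37 (.disj (.cell 32 10 9) (.cell 30 24 10))) <|
  fillCol 32 (.cell 37 10 9)

/-- Search for augmenting paths of the matching in array `31` in the graph in array `30`. -/
def search : Cmd :=
  .seq (fillCol 36 (.neg (.ex 12 (.cell 31 10 12)))) <|
  .seq (fillMat 34 (.conj (.cell 36 10 9) (.cell 30 10 11))) <|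
  .seq (fillCol 32 (.ex 12 (.cell 34 12 10))) <|
  .seq (fillCol 33 .false) <|
  .loop 20 searchStep

/-- One step along an augmenting path. -/
def flipStep : Cmd :=
  .ite (.eq 21 0) .skip <|
  .seq (pick 25 (.cell 34 10 21)) <|
  .seq (pick 26 (.cell 31 25 10)) <|
  .seq (fillRow 31 25 (.eq 11 21)) <|
  .copy 21 26

/-- The matching is augmented if possible. -/
def phase : Cmd :=
  .seq search <|
  .seq (pick 21 (.conj (.cell 32 10 9) (.neg (.ex 12 (.cell 31 12 10))))) <|
  .seq flipStep <|
  .loop 22 flipStep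

/-- A maximum matching of the graph in array `30` is computed. -/
def maxMatching : Cmd :=
  .seq (fillMat 31 .false) <|
  .seq (.loop 27 phase) phase

section

variable {n : ℕ} {s : State} {φ : Formula} {c c' : Cmd}

theorem run_seq : (seq c c').run n s = c'.run n (c.run n s) := rfl

theorem run_ite_pos (h : φ.Holds n s) : (ite φ c c').run n s = c.run n s := if_pos h

theorem run_ite_neg (h : ¬ φ.Holds n s) : (ite φ c c').run n s = c'.run n s := if_neg h

end

variable {n : ℕ} {s : State} {B m par : Fin n → Fin n → Prop} {π ρ : Set (Fin n)}
  {rank : Fin n → ℕ} {k : ℕ}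

/-- The memory during a search. -/
structure _root_.MissingData.State.Searching (s : State) (B m : Fin n → Fin n → Prop)
    (π ρ : Set (Fin n)) (par : Fin n → Fin n → Prop) : Prop where
  h0 : s.reg 0 = n
  h9 : s.reg 9 = 0
  hB : s.HoldsRel 30 B
  hm : s.HoldsRel 31 m
  hρ : s.HoldsSet 32 ρ
  hπ : s.HoldsSet 33 π
  hpar : s.HoldsRel 34 par

/-- Progress measure: each step processes a new vertex unless all reached ones are processed.
Picking, overwriting one row and updating one column keep a step linear. -/
theorem run_searchStep (h : s.Searching B m π ρ par) (hm : IsMatching B m)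
    (hs : SearchInv B m π ρ par rank k) (hk : k ≤ π.ncard ∨ ρ ⊆ π) :
    ∃ π' ρ' par' rank', (searchStep.run n s).Searching B m π' ρ' par' ∧
      SearchInv B m π' ρ' par' rank' (k + 1) ∧ (k + 1 ≤ π'.ncard ∨ ρ' ⊆ π') := by
  obtain ⟨h0, h9, hB, hm', hρ, hπ, hpar⟩ := h
  rw [searchStep, run_seq]
  have hp := run_pick (n := n) (s := s) (x := 23)
    (φ := .conj (.cell 32 10 9) (.neg (.cell 33 10 9))) h0 (by decide) (by decide)
  have h₁ : ((pick 23 (.conj (.cell 32 10 9) (.neg (.cell 33 10 9)))).run n s).Searching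
      B m π ρ par := ⟨(run_reg _ (by decide)).trans h0, (run_reg _ (by decide)).trans h9,
    hB.run (by decide), hm'.run (by decide), hρ.run (by decide), hπ.run (by decide),
    hpar.run (by decide)⟩
  generalize (pick 23 (.conj (.cell 32 10 9) (.neg (.cell 33 10 9)))).run n s = s₁ at *
  simp only [Formula.Holds, State.setReg_reg, State.setReg_arr] at hp
  simp only [h9, hρ.iff, hπ.iff, if_true, if_neg (show 9 ≠ 10 by decide)] at hp
  rcases hp with ⟨hw, hp⟩ | ⟨w, hw, hwρ, hwπ⟩
  · rw [run_ite_pos (by simp [Formula.Holds, hw, h₁.h0])]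
    exact ⟨π, ρ, par, rank, h₁, { hs with rank_le := fun h => (hs.rank_le h).trans k.le_succ },
      .inr fun x hx => by_contra fun hxπ => hp x ⟨hx, hxπ⟩⟩
  · rw [run_ite_neg (by simp [Formula.Holds, hw, h₁.h0, w.2.ne]), run_seq, run_seq]
    have hcard : k + 1 ≤ (insert w π).ncard := by
      rw [Set.ncard_insert_of_notMem hwπ]
      rcases hk with hk | hk
      · omega
      · exact absurd (hk hwρ) hwπ
    clear hB hm' hρ hπ hpar h0 h9
    obtain ⟨h0, h9, hB, hm', hρ, hπ, hpar⟩ := h₁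
    have h₂ : ((write 33 23 9 (.eq 0 0)).run n s₁).Searching B m (insert w π) ρ par := by
      refine ⟨h0, h9, fun u v => ?_, fun u v => ?_, fun v => ?_, fun v => ?_, fun u v => ?_⟩
      · simpa [run] using hB u v
      · simpa [run] using hm' u v
      · simpa [run] using hρ v
      · rw [run, State.setArr_arr,
          truthValue_of_true (p := Formula.Holds n (.eq 0 0) s₁) rfl, hw, h9]
        by_cases hv : v = w
        · simp [hv, truthValue]
        · rw [if_neg (by simpa [Fin.val_inj] using hv), hπ v]
          exact truthValue_congr (by simp [hv])
      · simpa [run] using hpar u v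
    have hw₂ : ((write 33 23 9 (.eq 0 0)).run n s₁).reg 23 = w := hw
    generalize (write 33 23 9 (.eq 0 0)).run n s₁ = s₂ at *
    clear hB hm' hρ hπ hpar h0 h9 hw
    obtain ⟨h0, h9, hB, hm', hρ, hπ, hpar⟩ := h₂
    have hp := run_pick (n := n) (s := s₂) (x := 24) (φ := .cell 31 10 23) h0 (by decide)
      (by decide)
    have h₃ : ((pick 24 (.cell 31 10 23)).run n s₂).Searching B m (insert w π) ρ par :=
      ⟨(run_reg _ (by decide)).trans h0, (run_reg _ (by decide)).trans h9,
      hB.run (by decide), hm'.run (by decide), hρ.run (by decide), hπ.run (by decide),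
      hpar.run (by decide)⟩
    generalize (pick 24 (.cell 31 10 23)).run n s₂ = s₃ at *
    simp only [Formula.Holds, State.setReg_reg, State.setReg_arr] at hp
    simp only [if_true, if_neg (show 23 ≠ 10 by decide), hw₂, hm'.iff] at hp
    rcases hp with ⟨hv, hp⟩ | ⟨v, hv, hvw⟩
    · rw [run_ite_pos (by simp [Formula.Holds, hv, h₃.h0])]
      exact ⟨_, ρ, par, rank, h₃, hs.of_unmated hwρ hp, .inl hcard⟩
    · rw [run_ite_neg (by simp [Formula.Holds, hv, h₃.h0, v.2.ne]), run_seq, run_seq]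
      refine ⟨_, _, _, _, ?_, hs.of_mate hm hwρ hwπ hvw, .inl hcard⟩
      clear hB hm' hρ hπ hpar h0 h9
      obtain ⟨h0, h9, hB, hm', hρ, hπ, hpar⟩ := h₃
      have hrow := run_fillRow (n := n) (s := s₃) (a := 34) (x := 24)
        (φ := .conj (.cell 30 24 11) (.neg (.cell 32 11 9))) (by decide) (by decide)
      have h₄ : ((fillRow 34 24 (.conj (.cell 30 24 11) (.neg (.cell 32 11 9)))).run n
          s₃).Searching B m (insert w π) ρ
          (fun u x => (u = v ∧ B v x ∧ x ∉ ρ) ∨ (u ≠ v ∧ par u x)) := by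
        refine ⟨(run_reg _ (by decide)).trans h0, (run_reg _ (by decide)).trans h9,
          hB.run (by decide), hm'.run (by decide), hρ.run (by decide), hπ.run (by decide),
          fun u x => ?_⟩
        by_cases hu : u = v
        · subst hu
          rw [← hv, hrow.1 x]
          refine truthValue_congr ?_
          simp [Formula.Holds, hv, hB.iff, hρ.iff, h9]
        · rw [hrow.2 u (by rw [hv]; simpa [Fin.val_inj] using hu), hpar u x]
          exact truthValue_congr (by simp [hu])
      have hv₄ : ((fillRow 34 24 (.conj (.cell 30 24 11) (.neg (.cell 32 11 9)))).run n
          s₃).reg 24 = v := (run_reg _ (by decide)).trans hv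
      generalize (fillRow 34 24 (.conj (.cell 30 24 11) (.neg (.cell 32 11 9)))).run n
          s₃ = s₄ at *
      clear hB hm' hρ hπ hpar h0 h9 hrow
      obtain ⟨h0, h9, hB, hm', hρ, hπ, hpar⟩ := h₄
      have htmp : ((fillCol 37 (.disj (.cell 32 10 9) (.cell 30 24 10))).run n s₄).HoldsSet 37
          {x | x ∈ ρ ∨ B v x} := by
        refine holdsSet_fillCol h9 (by decide) fun x => ?_
        simp [Formula.Holds, h9, hv₄, hB.iff, hρ.iff]
      refine ⟨?_, ?_, ?_, ?_, ?_, ?_, ?_⟩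
      · rw [run_reg _ (by decide), run_reg _ (by decide), h0]
      · rw [run_reg _ (by decide), run_reg _ (by decide), h9]
      · exact (hB.run (by decide)).run (by decide)
      · exact (hm'.run (by decide)).run (by decide)
      · refine holdsSet_fillCol ((run_reg _ (by decide)).trans h9) (by decide) fun x => ?_
        have : ((fillCol 37 (.disj (.cell 32 10 9) (.cell 30 24 10))).run n s₄).reg 9 = 0 :=
          (run_reg _ (by decide)).trans h9
        simp [Formula.Holds, this, htmp.iff]
      · exact (hπ.run (by decide)).run (by decide)
      · exact (hpar.run (by decide)).run (by decide)

theorem run_search (h0 : s.reg 0 = n) (h9 : s.reg 9 = 0) (hB : s.HoldsRel 30 B)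
    (hm' : s.HoldsRel 31 m) (hm : IsMatching B m) :
    ∃ π ρ par rank, (search.run n s).Searching B m π ρ par ∧
      SearchInv B m π ρ par rank n ∧ ρ ⊆ π := by
  rw [search, run_seq, run_seq, run_seq, run_seq]
  have h₁ : ((fillCol 36 (.neg (.ex 12 (.cell 31 10 12)))).run n s).HoldsSet 36 (matched m)ᶜ := by
    refine holdsSet_fillCol h9 (by decide) fun x => ?_
    simp [Formula.Holds, hm'.iff, matched]
  have h0₁ : ((fillCol 36 (.neg (.ex 12 (.cell 31 10 12)))).run n s).reg 0 = n :=
    (run_reg _ (by decide)).trans h0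
  have h9₁ : ((fillCol 36 (.neg (.ex 12 (.cell 31 10 12)))).run n s).reg 9 = 0 :=
    (run_reg _ (by decide)).trans h9
  have hB₁ := hB.run (c := fillCol 36 (.neg (.ex 12 (.cell 31 10 12)))) (by decide)
  have hm₁ := hm'.run (c := fillCol 36 (.neg (.ex 12 (.cell 31 10 12)))) (by decide)
  generalize (fillCol 36 (.neg (.ex 12 (.cell 31 10 12)))).run n s = s₁ at *
  have h₂ : ((fillMat 34 (.conj (.cell 36 10 9) (.cell 30 10 11))).run n s₁).HoldsRel 34
      (fun u w => u ∉ matched m ∧ B u w) := by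
    refine holdsRel_fillMat (by decide) fun u w => ?_
    simp [Formula.Holds, h9₁, h₁.iff, hB₁.iff]
  have h0₂ : ((fillMat 34 (.conj (.cell 36 10 9) (.cell 30 10 11))).run n s₁).reg 0 = n :=
    (run_reg _ (by decide)).trans h0₁
  have h9₂ : ((fillMat 34 (.conj (.cell 36 10 9) (.cell 30 10 11))).run n s₁).reg 9 = 0 :=
    (run_reg _ (by decide)).trans h9₁
  have hB₂ := hB₁.run (c := fillMat 34 (.conj (.cell 36 10 9) (.cell 30 10 11))) (by decide)
  have hm₂ := hm₁.run (c := fillMat 34 (.conj (.cell 36 10 9) (.cell 30 10 11))) (by decide)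
  generalize (fillMat 34 (.conj (.cell 36 10 9) (.cell 30 10 11))).run n s₁ = s₂ at *
  have h₃ : ((fillCol 32 (.ex 12 (.cell 34 12 10))).run n s₂).HoldsSet 32
      {w | ∃ u, u ∉ matched m ∧ B u w} := by
    refine holdsSet_fillCol h9₂ (by decide) fun x => ?_
    simp [Formula.Holds, h₂.iff]
  have h9₃ : ((fillCol 32 (.ex 12 (.cell 34 12 10))).run n s₂).reg 9 = 0 :=
    (run_reg _ (by decide)).trans h9₂
  have hbase : ((fillCol 33 .false).run n ((fillCol 32 (.ex 12 (.cell 34 12 10))).run n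
      s₂)).Searching B m ∅ {w | ∃ u, u ∉ matched m ∧ B u w}
      (fun u w => u ∉ matched m ∧ B u w) := by
    refine ⟨?_, ?_, ?_, ?_, ?_, ?_, ?_⟩
    · rw [run_reg _ (by decide), run_reg _ (by decide), h0₂]
    · rw [run_reg _ (by decide), h9₃]
    · exact (hB₂.run (by decide)).run (by decide)
    · exact (hm₂.run (by decide)).run (by decide)
    · exact h₃.run (by decide)
    · exact holdsSet_fillCol h9₃ (by decide) fun x => by simp [Formula.holds_false]
    · exact (h₂.run (by decide)).run (by decide)
  generalize (fillCol 33 .false).run n ((fillCol 32 (.ex 12 (.cell 34 12 10))).run n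
      s₂) = s₃ at *
  obtain ⟨u, ⟨π, ρ, par, rank, hu, hs, hk⟩, he⟩ := run_loop_induction (n := n) (x := 20)
    (c := searchStep) (s := s₃)
    (fun k u => ∃ π ρ par rank, u.Searching B m π ρ par ∧ SearchInv B m π ρ par rank k ∧
      (k ≤ π.ncard ∨ ρ ⊆ π))
    -- The right neighbours of unmatched left vertices start with rank `0`; their parents are
    -- unmatched, so `par_rank` is vacuous.
    ⟨∅, _, _, fun _ => 0, hbase, {
      exists_par := fun ⟨u, hu⟩ => ⟨u, hu⟩
      par_sub := fun h => h.2
      par_mem := fun h => ⟨_, h⟩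
      par_rank := fun h h' => absurd h' h.1
      processed_sub := Set.empty_subset _
      of_unmatched := fun h h' => ⟨_, h, h'⟩
      of_matched := fun _ h => h.elim
      rank_le := fun _ => le_rfl }, .inl (Nat.zero_le _)⟩
    fun k _ u ⟨π, ρ, par, rank, hu, hs, hk⟩ => by
      refine run_searchStep ?_ hm hs hk
      exact ⟨by simp [hu.h0], by simp [hu.h9], hu.hB, hu.hm, hu.hρ, hu.hπ, hu.hpar⟩
  rw [he]
  refine ⟨π, ρ, par, rank, ⟨by simp [hu.h0], by simp [hu.h9], hu.hB, hu.hm, hu.hρ, hu.hπ,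
    hu.hpar⟩, hs, ?_⟩
  rcases hk with hk | hk
  · have : π = Set.univ := by
      refine Set.eq_of_subset_of_ncard_le (Set.subset_univ _) ?_
      simpa [Set.ncard_univ] using hk
    simp [this]
  · exact hk

/-- The memory during the flip of an augmenting path; when the flip is complete, the matching
satisfies `D`. -/
def _root_.MissingData.State.FlipState (s : State) (B m : Fin n → Fin n → Prop)
    (ρ : Set (Fin n)) (par : Fin n → Fin n → Prop) (rank : Fin n → ℕ)
    (D : (Fin n → Fin n → Prop) → Prop) (j : ℕ) : Prop :=
  s.reg 0 = n ∧ s.HoldsRel 34 par ∧ ∃ m', s.HoldsRel 31 m' ∧ ((s.reg 21 = n ∧ D m') ∨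
    ∃ w : Fin n, s.reg 21 = w ∧ Flipping B m ρ par rank m' w ∧ rank w + j ≤ n)

/-- The rank of the uncovered vertex drops in every step, so `rank w + j ≤ n` survives the increase
of `j`. -/
theorem run_flipStep {D : (Fin n → Fin n → Prop) → Prop} {j : ℕ} (hm : IsMatching B m)
    (hs : SearchInv B m π ρ par rank k)
    (hD : ∀ m', IsMatching B m' → (matched m').ncard = (matched m).ncard + 1 → D m')
    (h : s.FlipState B m ρ par rank D j) :
    (flipStep.run n s).FlipState B m ρ par rank D (j + 1) := by
  obtain ⟨h0, hpar, m', hm', hcase⟩ := h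
  rw [flipStep]
  rcases hcase with ⟨hn, hd⟩ | ⟨w, hw, hf, hj⟩
  · rw [run_ite_pos (by simp [Formula.Holds, hn, h0])]
    exact ⟨h0, hpar, m', hm', .inl ⟨hn, hd⟩⟩
  rw [run_ite_neg (by simp [Formula.Holds, hw, h0, w.2.ne]), run_seq, run_seq, run_seq]
  have hp := run_pick (n := n) (s := s) (x := 25) (φ := .cell 34 10 21) h0 (by decide)
    (by decide)
  have h0₁ : ((pick 25 (.cell 34 10 21)).run n s).reg 0 = n := (run_reg _ (by decide)).trans h0
  have hw₁ : ((pick 25 (.cell 34 10 21)).run n s).reg 21 = w := (run_reg _ (by decide)).trans hw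
  have hpar₁ := hpar.run (c := pick 25 (.cell 34 10 21)) (by decide)
  have hm₁ := hm'.run (c := pick 25 (.cell 34 10 21)) (by decide)
  generalize (pick 25 (.cell 34 10 21)).run n s = s₁ at *
  simp only [Formula.Holds, State.setReg_reg, State.setReg_arr, if_true,
    if_neg (show 21 ≠ 10 by decide), hw, hpar.iff] at hp
  obtain ⟨u, hu, huw⟩ : ∃ u : Fin n, s₁.reg 25 = u ∧ par u w := by
    rcases hp with ⟨-, hp⟩ | hp
    · obtain ⟨u, hu⟩ := hs.exists_par hf.mem
      exact absurd hu (hp u)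
    · exact hp
  clear hp
  have hp := run_pick (n := n) (s := s₁) (x := 26) (φ := .cell 31 25 10) h0₁ (by decide)
    (by decide)
  have h0₂ : ((pick 26 (.cell 31 25 10)).run n s₁).reg 0 = n :=
    (run_reg _ (by decide)).trans h0₁
  have hw₂ : ((pick 26 (.cell 31 25 10)).run n s₁).reg 21 = w :=
    (run_reg _ (by decide)).trans hw₁
  have hu₂ : ((pick 26 (.cell 31 25 10)).run n s₁).reg 25 = u :=
    (run_reg _ (by decide)).trans hu
  have hpar₂ := hpar₁.run (c := pick 26 (.cell 31 25 10)) (by decide)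
  have hm₂ := hm₁.run (c := pick 26 (.cell 31 25 10)) (by decide)
  generalize (pick 26 (.cell 31 25 10)).run n s₁ = s₂ at *
  simp only [Formula.Holds, State.setReg_reg, State.setReg_arr, if_true,
    if_neg (show 25 ≠ 10 by decide), hu, hm₁.iff] at hp
  have hrow := run_fillRow (n := n) (s := s₂) (a := 31) (x := 25)
    (φ := .eq 11 21) (by decide) (by decide)
  have h0₃ : ((fillRow 31 25 (.eq 11 21)).run n s₂).reg 0 = n :=
    (run_reg _ (by decide)).trans h0₂
  have hv₃ : ((fillRow 31 25 (.eq 11 21)).run n s₂).reg 26 = s₂.reg 26 :=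
    run_reg _ (by decide)
  have hpar₃ := hpar₂.run (c := fillRow 31 25 (.eq 11 21)) (by decide)
  have hm₃ : ((fillRow 31 25 (.eq 11 21)).run n s₂).HoldsRel 31 (rematch m' u w) := by
    intro p x
    by_cases hpu : p = u
    · subst hpu
      rw [← hu₂, hrow.1 x]
      exact truthValue_congr (by simp [Formula.Holds, hw₂, rematch, Fin.val_inj])
    · rw [hrow.2 p (by rw [hu₂]; simpa [Fin.val_inj] using hpu), hm₂ p x]
      exact truthValue_congr (by simp [rematch, hpu])
  generalize (fillRow 31 25 (.eq 11 21)).run n s₂ = s₃ at *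
  refine ⟨by simp [run, h0₃], hpar₃, _, hm₃, ?_⟩
  -- If `u` had no mate, `pick` has left `n` in register `26`; copied to register `21`, it signals
  -- that the flip is complete.
  rcases hp with ⟨hv, hp⟩ | ⟨v, hv, huv⟩
  · obtain ⟨h₁, h₂⟩ := hf.last hs huw hp
    exact .inl ⟨by simp [run, hv₃, hv], hD _ h₁ h₂⟩
  · obtain ⟨h₁, h₂⟩ := hf.next hm hs huw huv
    exact .inr ⟨v, by simp [run, hv₃, hv], h₁, by omega⟩

theorem run_phase (h0 : s.reg 0 = n) (h9 : s.reg 9 = 0) (hB : s.HoldsRel 30 B)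
    (hm' : s.HoldsRel 31 m) (hm : IsMatching B m) :
    ∃ m' ρ, (phase.run n s).HoldsRel 31 m' ∧ (phase.run n s).HoldsSet 32 ρ ∧
      IsMatching B m' ∧
      ((matched m').ncard = (matched m).ncard + 1 ∨ (m' = m ∧ Stuck B m ρ)) := by
  obtain ⟨π, ρ, par, rank, h₁, hs, hρπ⟩ := run_search h0 h9 hB hm' hm
  clear h0 h9 hB hm'
  let D : (Fin n → Fin n → Prop) → Prop := fun m' => IsMatching B m' ∧
    ((matched m').ncard = (matched m).ncard + 1 ∨ (m' = m ∧ Stuck B m ρ))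
  have hD : ∀ m', IsMatching B m' → (matched m').ncard = (matched m).ncard + 1 → D m' :=
    fun m' h h' => ⟨h, .inl h'⟩
  have hrun : phase.run n s = (Cmd.loop 22 flipStep).run n (flipStep.run n
      ((pick 21 (.conj (.cell 32 10 9) (.neg (.ex 12 (.cell 31 12 10))))).run n
        (search.run n s))) := rfl
  rw [hrun]
  generalize search.run n s = s₁ at *
  obtain ⟨h0, h9, hB, hm', hρ, hπ, hpar⟩ := h₁
  have hp := run_pick (n := n) (s := s₁) (x := 21)
    (φ := .conj (.cell 32 10 9) (.neg (.ex 12 (.cell 31 12 10)))) h0 (by decide) (by decide)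
  have hf : ((pick 21 (.conj (.cell 32 10 9) (.neg (.ex 12 (.cell 31 12 10))))).run n
      s₁).FlipState B m ρ par rank D 0 := by
    refine ⟨(run_reg _ (by decide)).trans h0, hpar.run (by decide), m, hm'.run (by decide), ?_⟩
    simp [Formula.Holds, h9, hρ.iff, hm'.iff] at hp
    rcases hp with ⟨hn, hp⟩ | ⟨w, hw, hwρ, hwm⟩
    · exact .inl ⟨hn, hm, .inr ⟨rfl, hs.of_unmatched, fun h h' => hs.of_matched h (hρπ h'),
        fun h => hp _ h⟩⟩
    · exact .inr ⟨w, hw, ⟨hm, rfl, hwρ, hwm, fun _ _ _ _ _ => Iff.rfl⟩, hs.rank_le hwρ⟩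
  have hρ₂ := hρ.run (c := pick 21 (.conj (.cell 32 10 9) (.neg (.ex 12 (.cell 31 12 10)))))
    (by decide)
  generalize (pick 21 (.conj (.cell 32 10 9) (.neg (.ex 12 (.cell 31 12 10))))).run n
      s₁ = s₂ at *
  have hρ₃ := (hρ₂.run (c := flipStep) (by decide)).run (c := .loop 22 flipStep) (by decide)
  obtain ⟨u, ⟨-, -, m'', hm'', hcase⟩, he⟩ := run_loop_induction (n := n) (x := 22)
    (c := flipStep) (s := flipStep.run n s₂)
    (fun k u => u.FlipState B m ρ par rank D (k + 1)) (run_flipStep hm hs hD hf)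
    fun k _ u ⟨hu0, hupar, m', hum, hu⟩ => run_flipStep hm hs hD
      ⟨by simp [hu0], hupar, m', hum, by simpa using hu⟩
  -- One step before the loop and `n` in it make `n + 1`, more than a rank of at most `n` allows.
  obtain ⟨-, hd⟩ : u.reg 21 = n ∧ D m'' := by
    rcases hcase with h | ⟨w, -, -, h⟩
    · exact h
    · omega
  exact ⟨m'', ρ, by rw [he]; exact hm'', hρ₃, hd⟩

/-- Each phase enlarges the matching until a stuck search certifies by its cover that it is maximum;
by weak duality no later phase can enlarge it. -/
theorem run_maxMatching (h0 : s.reg 0 = n) (h9 : s.reg 9 = 0) (hB : s.HoldsRel 30 B) :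
    ∃ m ρ, (maxMatching.run n s).HoldsRel 31 m ∧ (maxMatching.run n s).HoldsSet 32 ρ ∧
      IsMatching B m ∧ Stuck B m ρ := by
  have hrun : maxMatching.run n s =
    phase.run n ((Cmd.loop 27 phase).run n ((fillMat 31 .false).run n s)) := rfl
  rw [hrun]
  obtain ⟨u, ⟨h0', h9', hB', m, hm', hm, hcard⟩, he⟩ := run_loop_induction (n := n) (x := 27)
    (c := phase) (s := (fillMat 31 .false).run n s)
    (fun k u => u.reg 0 = n ∧ u.reg 9 = 0 ∧ u.HoldsRel 30 B ∧ ∃ m, u.HoldsRel 31 m ∧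
      IsMatching B m ∧ (k ≤ (matched m).ncard ∨ ∃ ρ, Stuck B m ρ))
    ⟨(run_reg _ (by decide)).trans h0, (run_reg _ (by decide)).trans h9, hB.run (by decide),
      fun _ _ => False,
      holdsRel_fillMat (by decide) fun _ _ => by simp [Formula.holds_false],
      ⟨fun h => h.elim, fun h => h.elim, fun h => h.elim⟩, .inl (Nat.zero_le _)⟩
    fun k _ u ⟨hu0, hu9, huB, m, hum, hm, hk⟩ => by
      refine ⟨?_, ?_, ?_, ?_⟩
      · rw [run_reg _ (by decide)]; simpa using hu0
      · rw [run_reg _ (by decide)]; simpa using hu9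
      · exact State.HoldsRel.run (s := u.setReg 27 k) huB (by decide)
      · obtain ⟨m', ρ, h₁, -, h₂, h₃⟩ := run_phase (s := u.setReg 27 k) (by simpa using hu0)
          (by simpa using hu9) huB hum hm
        refine ⟨m', h₁, h₂, ?_⟩
        rcases h₃ with h₃ | ⟨rfl, h₃⟩
        · rcases hk with hk | ⟨ρ', hk⟩
          · exact .inl (by omega)
          · have h₄ := h₂.ncard_le hk.isCover
            have h₅ := hk.le_ncard hm
            omega
        · exact .inr ⟨ρ, h₃⟩
  -- This extra phase cannot augment any more, so the set `ρ` it leaves in memory is a certificate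
  -- for the final matching.
  obtain ⟨m', ρ, h₁, h₁', h₂, h₃⟩ := run_phase (s := u.setReg 27 n) (by simpa using h0')
    (by simpa using h9') hB' hm' hm
  rw [he]
  refine ⟨m', ρ, h₁, h₁', h₂, ?_⟩
  rcases h₃ with h₃ | ⟨rfl, h₃⟩
  · exfalso
    rcases hcard with hk | ⟨ρ', hk⟩
    · have : (matched m').ncard ≤ n := by
        simpa [Set.ncard_univ] using Set.ncard_le_ncard (Set.subset_univ (matched m'))
      omega
    · have h₄ := h₂.ncard_le hk.isCover
      have h₅ := hk.le_ncard hm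
      omega
  · exact h₃

end Cmd

open Relation MixedGraph

/-! ## Graph-theoretic descriptions of the sets computed by the algorithm -/

section Sets

variable {n : ℕ} {G : MGraph n} {X Y : Set (Fin n)}

theorem MGraph.pbd_acyclic (v : Fin n) : ¬ TransGen (G.pbd X Y).dir v v :=
  fun h => G.acyclic v (TransGen.mono (fun _ _ h => h.1) _ _ h)

theorem MGraph.acyclic_of_le {H : MixedGraph (Fin n)}
    (h : ∀ u v, H.dir u v → (G.pbd X Y).dir u v) (v : Fin n) : ¬ TransGen H.dir v v :=
  fun h' => MGraph.pbd_acyclic v (TransGen.mono h _ _ h')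

theorem MGraph.ind_notMem {v : Fin n} (hX : X ⊆ G.Vo ∪ G.Vm) (hv : v ∈ G.Vm) : G.ind v ∉ X :=
  fun h => Set.disjoint_left.1 G.disjoint_V_R (hX h) (G.ind_bijOn.mapsTo hv)

/-- No edge enters `X` in `deleteInto X`, and indicators lie outside `X`, so the trek criterion
applies. -/
theorem MGraph.mem_setE1_iff (hX : X ⊆ G.Vo ∪ G.Vm) (hXY : Disjoint X Y) {v : Fin n} :
    v ∈ G.setE1 X Y ↔ v ∈ G.setE X Y ∧ (v ∈ G.Vo ∨
      (v ∈ G.Vm ∧ ¬ ((G.pbd X Y).deleteInto X).Trek X Y (G.ind v))) := by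
  refine and_congr_right fun _ => or_congr_right (and_congr_right fun hv => ?_)
  have hi := MGraph.ind_notMem hX hv
  have hac : ∀ v, ¬ TransGen ((G.pbd X Y).deleteInto X).dir v v :=
    MGraph.acyclic_of_le (G := G) (X := X) (Y := Y) fun _ _ h => h.1
  rw [← not_iff_not, not_not, not_dSep_iff hac
    (Set.disjoint_singleton_left.2 hi)]
  simp only [Set.mem_singleton_iff, exists_eq_left]
  exact openGiven_iff_trek (H := (G.pbd X Y).deleteInto X)
    (fun u z hz h => h.2 hz) (fun u z hz h => h.2.2 hz) hXY.symm hi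

/-- The trek condition concerns `x` alone, not `v`. It can be computed once for each `x` and then
passed on to the descendants of `x`. -/
theorem MGraph.mem_setE2_iff {v : Fin n} :
    v ∈ G.setE2 X Y ↔ v ∈ G.setE1 X Y ∧ (v ∈ G.Vo ∨
      (v ∈ G.Vm ∧ ¬ ∃ x ∈ X, ReflTransGen G.dir x (G.ind v) ∧
        ((G.pbd X Y).deleteOutOf X).Trek ∅ Y x)) := by
  refine and_congr_right fun _ => or_congr_right (and_congr_right fun hv => ?_)
  have hac : ∀ v, ¬ TransGen ((G.pbd X Y).deleteOutOf X).dir v v :=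
    MGraph.acyclic_of_le (G := G) (X := X) (Y := Y) fun _ _ h => h.1
  rw [← not_iff_not, not_not, not_dSep_iff hac (Set.disjoint_empty _)]
  refine exists_congr fun x => ?_
  rw [openGiven_iff_trek (fun u z hz => hz.elim) (fun u z hz => hz.elim) (Set.disjoint_empty _)
    (Set.notMem_empty x)]
  simp [An, and_assoc]

theorem MGraph.disjoint_setE2 : Disjoint (X ∪ Y) (G.setE2 X Y) :=
  Set.disjoint_right.2 fun _ hv h => hv.1.1.2 (.inl h)

/-- Separators among the candidates are separators in the moral graph. -/
theorem not_reflTransGen_of_mem_separators {U : Finset (Fin n)}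
    (hU : U ∈ (G.pbd X Y).Separators X Y ∅ (G.setE2 X Y)) :
    ∀ x ∈ X, ∀ y ∈ Y, ¬ ReflTransGen (Avoiding ((G.pbd X Y).MoralAdj ((G.pbd X Y).An (X ∪ Y)))
      (U ∩ (G.pbd X Y).An (X ∪ Y))) x y := by
  obtain ⟨hs, -, hE⟩ := hU
  have hd := (MGraph.disjoint_setE2 (G := G) (X := X) (Y := Y)).mono_right hE
  intro x hx y hy hxy
  exact hs.moral MGraph.pbd_acyclic (hd.mono_left Set.subset_union_left)
    (hd.mono_left Set.subset_union_right) x hx y hy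
    -- Moral edges stay among the ancestors, so members of `U` outside them block nothing.
    (ReflTransGen.mono (fun u w h => ⟨h.1, fun hw => h.2 ⟨hw, h.1.2.1⟩⟩) _ _ hxy)

/-- A connection outside the candidates cannot be cut by any set of candidates. -/
theorem isFindMinCostSepOutput_none
    (h : ∃ x ∈ X, ∃ y ∈ Y, PathIn ((G.pbd X Y).MoralAdj ((G.pbd X Y).An (X ∪ Y)))
      (G.setE2 X Y ∩ (G.pbd X Y).An (X ∪ Y))ᶜ x y) (w : Fin n → ℕ) :
    (G.pbd X Y).IsFindMinCostSepOutput X Y ∅ (G.setE2 X Y) w none := by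
  obtain ⟨x, hx, y, hy, hp⟩ := h
  refine Set.eq_empty_iff_forall_notMem.2 fun U hU => ?_
  refine not_reflTransGen_of_mem_separators hU x hx y hy (reflTransGen_of_pathIn
    (Set.inter_subset_inter_left _ hU.2.2) hp fun h => ?_)
  exact Set.disjoint_left.1 MGraph.disjoint_setE2 (.inr hy) (hU.2.2 h.1)

open Classical in
-- A competitor `U` may be replaced by its ancestor part, which still cuts the moral graph and is no
-- larger; so only cuts inside the ancestors matter.
theorem isFindMinCostSepOutput_some {m : Fin n → Fin n → Prop} {ρ : Set (Fin n)}
    (hXY : Disjoint X Y)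
    (h : ¬ ∃ x ∈ X, ∃ y ∈ Y, PathIn ((G.pbd X Y).MoralAdj ((G.pbd X Y).An (X ∪ Y)))
      (G.setE2 X Y ∩ (G.pbd X Y).An (X ∪ Y))ᶜ x y)
    (hm : IsMatching (cutGraph ((G.pbd X Y).MoralAdj ((G.pbd X Y).An (X ∪ Y))) X Y
      (G.setE2 X Y ∩ (G.pbd X Y).An (X ∪ Y))) m)
    (hs : Stuck (cutGraph ((G.pbd X Y).MoralAdj ((G.pbd X Y).An (X ∪ Y))) X Y
      (G.setE2 X Y ∩ (G.pbd X Y).An (X ∪ Y))) m ρ) :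
    (G.pbd X Y).IsFindMinCostSepOutput X Y ∅ (G.setE2 X Y) (fun _ => 1)
      (some (coverCut ((G.pbd X Y).MoralAdj ((G.pbd X Y).An (X ∪ Y))) X Y
        (G.setE2 X Y ∩ (G.pbd X Y).An (X ∪ Y)) {u | ∃ w, m u w ∧ w ∉ ρ} ρ).toFinset) := by
  set A := (G.pbd X Y).An (X ∪ Y) with hA
  set M := G.setE2 X Y ∩ A with hM
  have hd : Disjoint (X ∪ Y) M := MGraph.disjoint_setE2.mono_right Set.inter_subset_left
  have hX := hd.mono_left (Set.subset_union_left (s := X) (t := Y))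
  have hY := hd.mono_left (Set.subset_union_right (s := X) (t := Y))
  set Z := coverCut ((G.pbd X Y).MoralAdj A) X Y M {u | ∃ w, m u w ∧ w ∉ ρ} ρ with hZ
  have hZM : Z ⊆ M := fun v hv => hv.1
  refine ⟨⟨?_, Set.empty_subset _, ?_⟩, fun U hU => ?_⟩
  · rw [Set.coe_toFinset]
    refine dSep_of_moral MGraph.pbd_acyclic (hX.mono_right hZM) (hY.mono_right hZM)
      (hZM.trans Set.inter_subset_right) ?_
    exact coverCut_separates hX hY hXY (fun x hx y hy hp => h ⟨x, hx, y, hy, hp⟩) hs.isCover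
  · rw [Set.coe_toFinset]
    exact hZM.trans Set.inter_subset_left
  · have h₁ := ncard_coverCut_le hX hY hs.isCover hm (hs.le_ncard hm)
      (Set.inter_subset_inter_left A hU.2.2) (not_reflTransGen_of_mem_separators hU)
    have h₂ : ((U : Set (Fin n)) ∩ A).ncard ≤ U.card := by
      rw [← Set.ncard_coe_finset]
      exact Set.ncard_le_ncard Set.inter_subset_left
    rw [Finset.sum_const, Finset.sum_const, smul_eq_mul, smul_eq_mul, mul_one, mul_one,
      ← Set.ncard_eq_toFinset_card']
    exact h₁.trans h₂

end Sets

/-! ## The lines of the algorithm -/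

/-- The memory holds the input. -/
structure State.HasInput {n : ℕ} (s : State) (G : MGraph n) (X Y : Set (Fin n)) : Prop where
  h0 : s.reg 0 = n
  h9 : s.reg 9 = 0
  dir : s.HoldsRel 0 G.dir
  bi : s.HoldsRel 1 G.bi
  X : s.HoldsSet 2 X
  Y : s.HoldsSet 3 Y
  Vo : s.HoldsSet 4 G.Vo
  Vm : s.HoldsSet 5 G.Vm
  ind : ∀ v ∈ G.Vm, s.arr 7 v 0 = G.ind v

namespace Cmd

variable {n : ℕ} {G : MGraph n} {X Y : Set (Fin n)} {s : State}

theorem _root_.MissingData.State.HasInput.run {c : Cmd} (h : s.HasInput G X Y)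
    (hc : (∀ a ∈ c.arrs, 7 < a) ∧ 0 ∉ c.regs ∧ 9 ∉ c.regs) : (c.run n s).HasInput G X Y := by
  have ha : ∀ a ≤ 7, a ∉ c.arrs := fun a h h' => absurd (hc.1 a h') (by omega)
  exact ⟨(run_reg _ hc.2.1).trans h.h0, (run_reg _ hc.2.2).trans h.h9,
    h.dir.run (ha _ (by omega)), h.bi.run (ha _ (by omega)), h.X.run (ha _ (by omega)),
    h.Y.run (ha _ (by omega)), h.Vo.run (ha _ (by omega)), h.Vm.run (ha _ (by omega)),
    fun v hv => by rw [run_arr _ (ha 7 le_rfl)]; exact h.ind v hv⟩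

theorem hasInput_inputState (G : MGraph n) (X Y : Set (Fin n)) :
    (inputState G X Y).HasInput G X Y := by
  refine ⟨rfl, rfl, fun u v => ?_, fun u v => ?_, fun v => ?_, fun v => ?_, fun v => ?_,
    fun v => ?_, fun v hv => ?_⟩ <;> simp [inputState]
  simp [truthValue, hv]

/-- The reflexive transitive closure of the relation defined by `φ` between the values of
registers `10` and `11` is put into array `a`. -/
def reflClosure (a : ℕ) (φ : Formula) : Cmd :=
  .seq (fillCol 19 (.eq 0 0)) <| .seq (fillMat a (.disj (.eq 10 11) φ)) (closure a 18 19)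

theorem holdsRel_reflClosure {a : ℕ} {φ : Formula} {r : Fin n → Fin n → Prop}
    (h9 : s.reg 9 = 0) (ha : a ∉ φ.arrs ∧ a ≠ 18 ∧ a ≠ 19) (hφ : 19 ∉ φ.arrs ∧ 10 ∉ φ.bound)
    (h : ∀ u v : Fin n, φ.Holds n ((s.setReg 10 u).setReg 11 v) ↔ r u v) :
    ((reflClosure a φ).run n s).HoldsRel a (ReflTransGen r) := by
  rw [reflClosure, run_seq, run_seq]
  have h₁ : ((fillCol 19 (.eq 0 0)).run n s).HoldsSet 19 (Set.univ : Set (Fin n)) :=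
    holdsSet_fillCol h9 (by decide) fun v => by simp [Formula.Holds]
  have h9' : ((fillCol 19 (.eq 0 0)).run n s).reg 9 = 0 := (run_reg _ (by decide)).trans h9
  have hr : ∀ b ≠ 19, ((fillCol 19 (.eq 0 0)).run n s).arr b = s.arr b := fun b hb =>
    run_arr _ (by simp [fillCol, arrs, hb])
  have hreg : ∀ x ≠ 10, ((fillCol 19 (.eq 0 0)).run n s).reg x = s.reg x := fun x hx =>
    run_reg _ (by simp [fillCol, regs, hx])
  generalize (fillCol 19 (.eq 0 0)).run n s = s₁ at *
  have h₂ : ((fillMat a (.disj (.eq 10 11) φ)).run n s₁).HoldsRel a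
      (fun u w => u = w ∨ r u w) := by
    refine holdsRel_fillMat (by simpa [Formula.arrs] using ha.1) fun u v => ?_
    refine or_congr (by simp [Formula.Holds, Fin.val_inj]) ?_
    rw [← h u v]
    refine φ.holds_congr (fun b hb => hr b (ne_of_mem_of_not_mem hb hφ.1)) fun x _ => ?_
    simp only [State.setReg_reg]
    split_ifs with h₁ h₂ <;> try rfl
    exact hreg x h₂
  have h9₂ : ((fillMat a (.disj (.eq 10 11) φ)).run n s₁).reg 9 = 0 :=
    (run_reg _ (by simp [fillMat, fillRow, regs])).trans h9'
  have h₃ := h₁.run (c := fillMat a (.disj (.eq 10 11) φ))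
    (by simp [fillMat, fillRow, arrs, ha.2.2.symm])
  generalize (fillMat a (.disj (.eq 10 11) φ)).run n s₁ = s₂ at *
  have := holdsRel_closure (b := 18) h9₂ ha.2.1 ha.2.2.symm (by decide) h₂ h₃
  intro u v
  rw [this u v]
  exact truthValue_congr PathIn.univ_iff_reflTransGen

/-- Started in a state that satisfies `P`, the command `c` ends in a state that satisfies `Q`. -/
def Spec (n : ℕ) (P : State → Prop) (c : Cmd) (Q : State → Prop) : Prop :=
  ∀ s, P s → Q (c.run n s)

theorem Spec.seq {P Q R : State → Prop} {c c' : Cmd} (h : Spec n P c Q) (h' : Spec n Q c' R) :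
    Spec n P (.seq c c') R := fun s hs => h' _ (h s hs)

/-- The proper backdoor graph. -/
def lineBackdoor : Cmd :=
  .seq (reflClosure 20 (.conj (.cell 0 10 11) (.neg (.cell 2 11 9)))) <|
  .seq (fillMat 8 (.conj (.cell 0 10 11) (.neg (.conj (.cell 2 10 9) (.conj
    (.neg (.cell 2 11 9)) (.ex 12 (.conj (.cell 3 12 9) (.cell 20 11 12)))))))) <|
  fillMat 9 (.cell 1 10 11)

/-- One closure of the edges not into `X` decides for all edges at once whether they begin a proper
causal path. Array `20` is kept because the set `E` needs the same closure. -/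
theorem spec_lineBackdoor : Spec n (fun s => s.HasInput G X Y) lineBackdoor fun s =>
    s.HasInput G X Y ∧ s.HoldsRel 8 (G.pbd X Y).dir ∧ s.HoldsRel 9 (G.pbd X Y).bi ∧
      s.HoldsRel 20 (ReflTransGen fun u v => G.dir u v ∧ v ∉ X) := by
  refine Spec.seq (Q := fun s => s.HasInput G X Y ∧
      s.HoldsRel 20 (ReflTransGen fun u v => G.dir u v ∧ v ∉ X))
    (fun s hin => ⟨hin.run (by decide), ?_⟩) ?_
  · exact holdsRel_reflClosure hin.h9 (by decide) (by decide) fun u v => by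
      simp [Formula.Holds, hin.h9, hin.dir.iff, hin.X.iff]
  refine Spec.seq (Q := fun s => s.HasInput G X Y ∧ s.HoldsRel 8 (G.pbd X Y).dir ∧
      s.HoldsRel 20 (ReflTransGen fun u v => G.dir u v ∧ v ∉ X))
    (fun s ⟨hin, h20⟩ => ⟨hin.run (by decide), ?_, h20.run (by decide)⟩) ?_
  · refine holdsRel_fillMat (by decide) fun u v => ?_
    simp [Formula.Holds, hin.h9, hin.dir.iff, hin.X.iff, hin.Y.iff, h20.iff, MGraph.pbd,
      properBackdoor, IsFirstProperEdge]
    tauto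
  · refine fun s ⟨hin, h8, h20⟩ => ⟨hin.run (by decide), h8.run (by decide), ?_,
      h20.run (by decide)⟩
    refine holdsRel_fillMat (by decide) fun u v => ?_
    simp [Formula.Holds, hin.bi.iff, MGraph.pbd, properBackdoor]

/-- The admissible vertices `E`. -/
def lineE : Cmd :=
  .seq (fillCol 22 (.conj (.neg (.cell 2 10 9)) (.conj
    (.ex 12 (.conj (.cell 2 12 9) (.cell 20 12 10)))
    (.ex 12 (.conj (.cell 3 12 9) (.cell 20 10 12)))))) <|
  .seq (reflClosure 23 (.cell 0 10 11)) <|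
  fillCol 10 (.conj (.disj (.cell 4 10 9) (.cell 5 10 9)) (.conj (.neg (.cell 2 10 9)) (.conj
    (.neg (.cell 3 10 9)) (.neg (.ex 12 (.conj (.cell 22 12 9) (.cell 23 12 10)))))))

theorem spec_lineE : Spec n (fun s => s.HasInput G X Y ∧
      s.HoldsRel 20 (ReflTransGen fun u v => G.dir u v ∧ v ∉ X)) lineE fun s =>
    s.HoldsSet 10 (G.setE X Y) ∧ s.HoldsRel 23 (ReflTransGen G.dir) := by
  refine Spec.seq (Q := fun s => s.HasInput G X Y ∧
      s.HoldsSet 22 (((G.deleteInto X).De X \ X) ∩ (G.deleteInto X).An Y))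
    (fun s ⟨hin, h20⟩ => ⟨hin.run (by decide), ?_⟩) ?_
  · refine holdsSet_fillCol hin.h9 (by decide) fun v => ?_
    simp [Formula.Holds, hin.h9, hin.X.iff, hin.Y.iff, h20.iff, De, An, deleteInto]
    tauto
  refine Spec.seq (Q := fun s => s.HasInput G X Y ∧ s.HoldsRel 23 (ReflTransGen G.dir) ∧
      s.HoldsSet 22 (((G.deleteInto X).De X \ X) ∩ (G.deleteInto X).An Y))
    (fun s ⟨hin, h22⟩ => ⟨hin.run (by decide), ?_, h22.run (by decide)⟩) ?_
  · exact holdsRel_reflClosure hin.h9 (by decide) (by decide) fun u v => by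
      simp [Formula.Holds, hin.dir.iff]
  · refine fun s ⟨hin, h23, h22⟩ => ⟨?_, h23.run (by decide)⟩
    refine holdsSet_fillCol hin.h9 (by decide) fun v => ?_
    have : v ∈ G.setE X Y ↔ (v ∈ G.Vo ∨ v ∈ G.Vm) ∧ v ∉ X ∧ v ∉ Y ∧
        ¬ ∃ c ∈ ((G.deleteInto X).De X \ X) ∩ (G.deleteInto X).An Y,
          ReflTransGen G.dir c v := by
      rw [MGraph.setE, Dpcp, De]
      simp only [Set.mem_sdiff, Set.mem_union, Set.mem_ofPred_eq, not_or, and_assoc]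
    rw [this]
    simp only [Formula.Holds, State.setReg_reg, State.setReg_arr]
    simp [hin.h9, hin.X.iff, hin.Y.iff, hin.Vo.iff, hin.Vm.iff, h22.iff, h23.iff]

/-- The admissible vertices `E'` whose indicators are d-separated from `Y`. -/
def lineE1 : Cmd :=
  .seq (reflClosure 24 (.conj (.cell 8 10 11) (.neg (.cell 2 11 9)))) <|
  .seq (fillCol 25 (.conj (.neg (.cell 2 10 9))
    (.ex 12 (.conj (.cell 3 12 9) (.cell 24 10 12))))) <|
  .seq (fillCol 26 (.conj (.neg (.cell 2 10 9)) (.disj (.cell 25 10 9)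
    (.ex 12 (.conj (.cell 9 10 12) (.conj (.neg (.cell 2 12 9)) (.cell 25 12 9))))))) <|
  .seq (fillCol 28 (.ex 12 (.conj (.cell 26 12 9) (.cell 24 12 10)))) <|
  .seq (fillMat 27 (.conj (.cell 5 10 9) (.cellEq 7 10 9 11))) <|
  fillCol 11 (.conj (.cell 10 10 9) (.disj (.cell 4 10 9) (.conj (.cell 5 10 9)
    (.neg (.ex 12 (.conj (.cell 27 10 12) (.cell 28 12 9)))))))

/-- The trek criterion is split so that each set needs one quantifier: `T` has the vertices that
descend to `Y`, `S` the possible tops on the other side, and the ends of treks are the descendants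
of `S`. Array `27` stores the indicator map as a relation, to be used again for `E''` and for the
returned set. -/
theorem spec_lineE1 (hX : X ⊆ G.Vo ∪ G.Vm) (hXY : Disjoint X Y) :
    Spec n (fun s => s.HasInput G X Y ∧ s.HoldsRel 8 (G.pbd X Y).dir ∧
      s.HoldsRel 9 (G.pbd X Y).bi ∧ s.HoldsSet 10 (G.setE X Y)) lineE1 fun s =>
    s.HoldsSet 11 (G.setE1 X Y) ∧ s.HoldsRel 27 (fun v r => v ∈ G.Vm ∧ G.ind v = r) := by
  let H := (G.pbd X Y).deleteInto X
  let T : Set (Fin n) := {d | d ∉ X ∧ ∃ y ∈ Y, ReflTransGen H.dir d y}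
  let S : Set (Fin n) := {c | c ∉ X ∧ (c ∈ T ∨ ∃ d, H.bi c d ∧ d ∈ T)}
  refine Spec.seq (Q := fun s => s.HasInput G X Y ∧ s.HoldsRel 9 (G.pbd X Y).bi ∧
      s.HoldsSet 10 (G.setE X Y) ∧ s.HoldsRel 24 (ReflTransGen H.dir))
    (fun s ⟨hin, h8, h9, h10⟩ => ⟨hin.run (by decide), h9.run (by decide),
      h10.run (by decide), ?_⟩) ?_
  · exact holdsRel_reflClosure hin.h9 (by decide) (by decide) fun u v => by
      simp [Formula.Holds, hin.h9, h8.iff, hin.X.iff, H, deleteInto]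
  refine Spec.seq (Q := fun s => s.HasInput G X Y ∧ s.HoldsRel 9 (G.pbd X Y).bi ∧
      s.HoldsSet 10 (G.setE X Y) ∧ s.HoldsRel 24 (ReflTransGen H.dir) ∧ s.HoldsSet 25 T)
    (fun s ⟨hin, h9, h10, h24⟩ => ⟨hin.run (by decide), h9.run (by decide),
      h10.run (by decide), h24.run (by decide), ?_⟩) ?_
  · refine holdsSet_fillCol hin.h9 (by decide) fun v => ?_
    simp [Formula.Holds, hin.h9, hin.X.iff, hin.Y.iff, h24.iff, T]
  refine Spec.seq (Q := fun s => s.HasInput G X Y ∧ s.HoldsSet 10 (G.setE X Y) ∧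
      s.HoldsRel 24 (ReflTransGen H.dir) ∧ s.HoldsSet 26 S)
    (fun s ⟨hin, h9, h10, h24, h25⟩ => ⟨hin.run (by decide), h10.run (by decide),
      h24.run (by decide), ?_⟩) ?_
  · refine holdsSet_fillCol hin.h9 (by decide) fun v => ?_
    simp only [Formula.Holds, State.setReg_reg, State.setReg_arr]
    simp [hin.h9, hin.X.iff, h9.iff, h25.iff, S, H, deleteInto]
    refine fun hv => or_congr_right (exists_congr fun d => ?_)
    tauto
  refine Spec.seq (Q := fun s => s.HasInput G X Y ∧ s.HoldsSet 10 (G.setE X Y) ∧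
      s.HoldsSet 28 {r | H.Trek X Y r})
    (fun s ⟨hin, h10, h24, h26⟩ => ⟨hin.run (by decide), h10.run (by decide), ?_⟩) ?_
  · refine holdsSet_fillCol hin.h9 (by decide) fun v => ?_
    simp only [Formula.Holds, State.setReg_reg, State.setReg_arr]
    simp only [if_true, if_neg (show 9 ≠ 12 by decide), if_neg (show 9 ≠ 10 by decide),
      if_neg (show 10 ≠ 12 by decide), hin.h9, h24.iff, h26.iff]
    constructor
    · rintro ⟨c, ⟨hc, hT | ⟨d, hcd, hT⟩⟩, hcv⟩
      · exact ⟨c, c, hc, hc, hcv, hT.2, .inl rfl⟩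
      · exact ⟨c, d, hc, hT.1, hcv, hT.2, .inr hcd⟩
    · rintro ⟨c, d, hc, hd, hcv, hT, rfl | hcd⟩
      · exact ⟨c, ⟨hc, .inl ⟨hd, hT⟩⟩, hcv⟩
      · exact ⟨c, ⟨hc, .inr ⟨d, hcd, hd, hT⟩⟩, hcv⟩
  refine Spec.seq (Q := fun s => s.HasInput G X Y ∧ s.HoldsSet 10 (G.setE X Y) ∧
      s.HoldsSet 28 {r | H.Trek X Y r} ∧ s.HoldsRel 27 (fun v r => v ∈ G.Vm ∧ G.ind v = r))
    (fun s ⟨hin, h10, h28⟩ => ⟨hin.run (by decide), h10.run (by decide), h28.run (by decide),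
      ?_⟩) ?_
  · refine holdsRel_fillMat (by decide) fun u v => ?_
    simp [Formula.Holds, hin.h9, hin.Vm.iff]
    exact fun hu => by rw [hin.ind u hu, Fin.val_inj]
  · refine fun s ⟨hin, h10, h28, h27⟩ => ⟨?_, h27.run (by decide)⟩
    refine holdsSet_fillCol hin.h9 (by decide) fun v => ?_
    rw [MGraph.mem_setE1_iff hX hXY]
    simp only [Formula.Holds, State.setReg_reg, State.setReg_arr]
    simp [hin.h9, h10.iff, hin.Vo.iff, hin.Vm.iff, h28.iff, h27.iff]
    refine fun _ => or_congr_right (and_congr_right fun hv => ?_)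
    simp [hv, H]

/-- The admissible vertices `E''`. -/
def lineE2 : Cmd :=
  .seq (reflClosure 29 (.conj (.cell 8 10 11) (.neg (.cell 2 10 9)))) <|
  .seq (fillCol 40 (.ex 12 (.conj (.cell 3 12 9) (.cell 29 10 12)))) <|
  .seq (fillCol 41 (.disj (.cell 40 10 9) (.ex 12 (.conj (.cell 9 10 12) (.cell 40 12 9))))) <|
  .seq (fillCol 42 (.conj (.cell 2 10 9) (.ex 12 (.conj (.cell 41 12 9) (.cell 29 12 10))))) <|
  .seq (fillCol 43 (.ex 12 (.conj (.cell 42 12 9) (.cell 23 12 10)))) <|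
  fillCol 12 (.conj (.cell 11 10 9) (.disj (.cell 4 10 9) (.conj (.cell 5 10 9)
    (.neg (.ex 12 (.conj (.cell 27 10 12) (.cell 43 12 9)))))))

theorem spec_lineE2 : Spec n (fun s => s.HasInput G X Y ∧ s.HoldsRel 8 (G.pbd X Y).dir ∧
      s.HoldsRel 9 (G.pbd X Y).bi ∧ s.HoldsSet 11 (G.setE1 X Y) ∧
      s.HoldsRel 23 (ReflTransGen G.dir) ∧ s.HoldsRel 27 (fun v r => v ∈ G.Vm ∧ G.ind v = r))
    lineE2 fun s => s.HoldsSet 12 (G.setE2 X Y) := by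
  let H := (G.pbd X Y).deleteOutOf X
  let T : Set (Fin n) := {d | ∃ y ∈ Y, ReflTransGen H.dir d y}
  let S : Set (Fin n) := {c | c ∈ T ∨ ∃ d, H.bi c d ∧ d ∈ T}
  refine Spec.seq (Q := fun s => s.HasInput G X Y ∧ s.HoldsRel 9 (G.pbd X Y).bi ∧
      s.HoldsSet 11 (G.setE1 X Y) ∧ s.HoldsRel 23 (ReflTransGen G.dir) ∧
      s.HoldsRel 27 (fun v r => v ∈ G.Vm ∧ G.ind v = r) ∧ s.HoldsRel 29 (ReflTransGen H.dir))
    (fun s ⟨hin, h8, h9, h11, h23, h27⟩ => ⟨hin.run (by decide), h9.run (by decide),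
      h11.run (by decide), h23.run (by decide), h27.run (by decide), ?_⟩) ?_
  · exact holdsRel_reflClosure hin.h9 (by decide) (by decide) fun u v => by
      simp [Formula.Holds, hin.h9, h8.iff, hin.X.iff, H, deleteOutOf]
  refine Spec.seq (Q := fun s => s.HasInput G X Y ∧ s.HoldsRel 9 (G.pbd X Y).bi ∧
      s.HoldsSet 11 (G.setE1 X Y) ∧ s.HoldsRel 23 (ReflTransGen G.dir) ∧
      s.HoldsRel 27 (fun v r => v ∈ G.Vm ∧ G.ind v = r) ∧ s.HoldsRel 29 (ReflTransGen H.dir) ∧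
      s.HoldsSet 40 T)
    (fun s ⟨hin, h9, h11, h23, h27, h29⟩ => ⟨hin.run (by decide), h9.run (by decide),
      h11.run (by decide), h23.run (by decide), h27.run (by decide), h29.run (by decide), ?_⟩) ?_
  · refine holdsSet_fillCol hin.h9 (by decide) fun v => ?_
    simp [Formula.Holds, hin.h9, hin.Y.iff, h29.iff, T]
  refine Spec.seq (Q := fun s => s.HasInput G X Y ∧
      s.HoldsSet 11 (G.setE1 X Y) ∧ s.HoldsRel 23 (ReflTransGen G.dir) ∧
      s.HoldsRel 27 (fun v r => v ∈ G.Vm ∧ G.ind v = r) ∧ s.HoldsRel 29 (ReflTransGen H.dir) ∧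
      s.HoldsSet 41 S)
    (fun s ⟨hin, h9, h11, h23, h27, h29, h40⟩ => ⟨hin.run (by decide),
      h11.run (by decide), h23.run (by decide), h27.run (by decide), h29.run (by decide), ?_⟩) ?_
  · refine holdsSet_fillCol hin.h9 (by decide) fun v => ?_
    simp [Formula.Holds, hin.h9, h9.iff, h40.iff, S, H, deleteOutOf]
  refine Spec.seq (Q := fun s => s.HasInput G X Y ∧
      s.HoldsSet 11 (G.setE1 X Y) ∧ s.HoldsRel 23 (ReflTransGen G.dir) ∧
      s.HoldsRel 27 (fun v r => v ∈ G.Vm ∧ G.ind v = r) ∧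
      s.HoldsSet 42 {x | x ∈ X ∧ H.Trek ∅ Y x})
    (fun s ⟨hin, h11, h23, h27, h29, h41⟩ => ⟨hin.run (by decide),
      h11.run (by decide), h23.run (by decide), h27.run (by decide), ?_⟩) ?_
  · refine holdsSet_fillCol hin.h9 (by decide) fun v => ?_
    simp only [Formula.Holds, State.setReg_reg, State.setReg_arr]
    simp only [if_true, if_neg (show 9 ≠ 12 by decide), if_neg (show 9 ≠ 10 by decide),
      if_neg (show 10 ≠ 12 by decide), hin.h9, h29.iff, h41.iff, hin.X.iff]
    refine and_congr_right fun _ => ⟨?_, ?_⟩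
    · rintro ⟨c, hT | ⟨d, hcd, hT⟩, hcv⟩
      · exact ⟨c, c, id, id, hcv, hT, .inl rfl⟩
      · exact ⟨c, d, id, id, hcv, hT, .inr hcd⟩
    · rintro ⟨c, d, -, -, hcv, hT, rfl | hcd⟩
      · exact ⟨c, .inl hT, hcv⟩
      · exact ⟨c, .inr ⟨d, hcd, hT⟩, hcv⟩
  refine Spec.seq (Q := fun s => s.HasInput G X Y ∧ s.HoldsSet 11 (G.setE1 X Y) ∧
      s.HoldsRel 27 (fun v r => v ∈ G.Vm ∧ G.ind v = r) ∧
      s.HoldsSet 43 {r | ∃ x ∈ X, ReflTransGen G.dir x r ∧ H.Trek ∅ Y x})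
    (fun s ⟨hin, h11, h23, h27, h42⟩ => ⟨hin.run (by decide),
      h11.run (by decide), h27.run (by decide), ?_⟩) ?_
  · refine holdsSet_fillCol hin.h9 (by decide) fun v => ?_
    simp only [Formula.Holds, State.setReg_reg, State.setReg_arr]
    simp [hin.h9, h42.iff, h23.iff]
    exact exists_congr fun x => by tauto
  · refine fun s ⟨hin, h11, h27, h43⟩ => ?_
    refine holdsSet_fillCol hin.h9 (by decide) fun v => ?_
    rw [MGraph.mem_setE2_iff]
    simp only [Formula.Holds, State.setReg_reg, State.setReg_arr]
    simp only [if_true, if_neg (show 9 ≠ 12 by decide), if_neg (show 9 ≠ 10 by decide),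
      if_neg (show 10 ≠ 12 by decide), hin.h9, h11.iff, hin.Vo.iff, hin.Vm.iff, h43.iff, h27.iff]
    refine and_congr_right fun _ => or_congr_right (and_congr_right fun hv => not_congr ?_)
    constructor
    · rintro ⟨r, ⟨-, rfl⟩, h⟩
      exact h
    · exact fun h => ⟨_, ⟨hv, rfl⟩, h⟩

/-- The moral graph of the ancestors of `X ∪ Y` in the proper backdoor graph is put into array
`48`, the set of these ancestors into array `45`. -/
def moralize : Cmd :=
  .seq (reflClosure 44 (.cell 8 10 11)) <|
  .seq (fillCol 45 (.ex 12 (.conj (.disj (.cell 2 12 9) (.cell 3 12 9)) (.cell 44 10 12)))) <|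
  .seq (reflClosure 46 (.conj (.cell 9 10 11) (.conj (.cell 45 10 9) (.cell 45 11 9)))) <|
  .seq (fillMat 47 (.conj (.cell 45 10 9) (.ex 12 (.conj (.cell 45 12 9)
    (.conj (.disj (.eq 10 12) (.cell 8 10 12)) (.cell 46 12 11)))))) <|
  fillMat 48 (.conj (.cell 45 11 9) (.ex 12 (.conj (.cell 45 12 9)
    (.conj (.cell 47 10 12) (.disj (.eq 12 11) (.cell 8 11 12))))))

/-- The definition of `MoralAdj` quantifies over both `c` and `d`, which would be quartic over all
pairs. Array `47` eliminates `c` first, so that two matrices with one quantifier each suffice. -/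
theorem spec_moralize : Spec n (fun s => s.HasInput G X Y ∧ s.HoldsRel 8 (G.pbd X Y).dir ∧
      s.HoldsRel 9 (G.pbd X Y).bi ∧ s.HoldsSet 12 (G.setE2 X Y)) moralize fun s =>
    s.HasInput G X Y ∧ s.HoldsSet 12 (G.setE2 X Y) ∧ s.HoldsSet 45 ((G.pbd X Y).An (X ∪ Y)) ∧
      s.HoldsRel 48 ((G.pbd X Y).MoralAdj ((G.pbd X Y).An (X ∪ Y))) := by
  let H := G.pbd X Y
  let A := H.An (X ∪ Y)
  let D : Fin n → Fin n → Prop := fun p q => H.bi p q ∧ p ∈ A ∧ q ∈ A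
  refine Spec.seq (Q := fun s => s.HasInput G X Y ∧ s.HoldsSet 12 (G.setE2 X Y) ∧
      s.HoldsRel 8 H.dir ∧ s.HoldsRel 9 H.bi ∧ s.HoldsRel 44 (ReflTransGen H.dir))
    (fun s ⟨hin, h8, h9, h12⟩ => ⟨hin.run (by decide), h12.run (by decide), h8.run (by decide),
      h9.run (by decide), ?_⟩) ?_
  · exact holdsRel_reflClosure hin.h9 (by decide) (by decide) fun u v => by
      simp [Formula.Holds, h8.iff, H]
  refine Spec.seq (Q := fun s => s.HasInput G X Y ∧ s.HoldsSet 12 (G.setE2 X Y) ∧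
      s.HoldsRel 8 H.dir ∧ s.HoldsRel 9 H.bi ∧ s.HoldsSet 45 A)
    (fun s ⟨hin, h12, h8, h9, h44⟩ => ⟨hin.run (by decide), h12.run (by decide),
      h8.run (by decide), h9.run (by decide), ?_⟩) ?_
  · refine holdsSet_fillCol hin.h9 (by decide) fun v => ?_
    simp [Formula.Holds, hin.h9, hin.X.iff, hin.Y.iff, h44.iff, A, An]
  refine Spec.seq (Q := fun s => s.HasInput G X Y ∧ s.HoldsSet 12 (G.setE2 X Y) ∧
      s.HoldsRel 8 H.dir ∧ s.HoldsSet 45 A ∧ s.HoldsRel 46 (ReflTransGen D))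
    (fun s ⟨hin, h12, h8, h9, h45⟩ => ⟨hin.run (by decide), h12.run (by decide),
      h8.run (by decide), h45.run (by decide), ?_⟩) ?_
  · exact holdsRel_reflClosure hin.h9 (by decide) (by decide) fun u v => by
      simp [Formula.Holds, hin.h9, h9.iff, h45.iff, D]
  refine Spec.seq (Q := fun s => s.HasInput G X Y ∧ s.HoldsSet 12 (G.setE2 X Y) ∧
      s.HoldsRel 8 H.dir ∧ s.HoldsSet 45 A ∧ s.HoldsRel 47 (fun u d => u ∈ A ∧
        ∃ c ∈ A, (u = c ∨ H.dir u c) ∧ ReflTransGen D c d))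
    (fun s ⟨hin, h12, h8, h45, h46⟩ => ⟨hin.run (by decide), h12.run (by decide),
      h8.run (by decide), h45.run (by decide), ?_⟩) ?_
  · refine holdsRel_fillMat (by decide) fun u v => ?_
    simp [Formula.Holds, hin.h9, h8.iff, h45.iff, h46.iff, Fin.val_inj]
  · refine fun s ⟨hin, h12, h8, h45, h47⟩ => ⟨hin.run (by decide), h12.run (by decide),
      h45.run (by decide), ?_⟩
    refine holdsRel_fillMat (by decide) fun u w => ?_
    simp only [Formula.Holds, State.setReg_reg, State.setReg_arr]
    simp [hin.h9, h8.iff, h45.iff, h47.iff, Fin.val_inj]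
    constructor
    · rintro ⟨hw, d, hd, ⟨hu, c, hc, huc, hcd⟩, hdw⟩
      exact ⟨hu, hw, c, hc, d, hd, huc, hcd, hdw⟩
    · rintro ⟨hu, hw, c, hc, d, hd, huc, hcd, hdw⟩
      exact ⟨hw, d, hd, ⟨hu, c, hc, huc, hcd⟩, hdw⟩

/-- The bipartite graph for the separators in the moral graph is put into array `30`, and array
`48` is changed to the relation of being connected outside the candidates. -/
def buildCutGraph : Cmd :=
  .seq (fillCol 49 (.conj (.cell 12 10 9) (.cell 45 10 9))) <|
  .seq (fillCol 50 (.neg (.cell 49 10 9))) <|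
  .seq (closure 48 18 50) <|
  .seq (fillCol 51 (.conj (.cell 49 10 9) (.ex 12 (.conj (.cell 2 12 9) (.cell 48 12 10))))) <|
  .seq (fillCol 52 (.conj (.cell 49 10 9) (.ex 12 (.conj (.cell 3 12 9) (.cell 48 10 12))))) <|
  fillMat 30 (.conj (.conj (.cell 49 10 9) (.neg (.cell 52 10 9)))
    (.conj (.conj (.cell 49 11 9) (.neg (.cell 51 11 9))) (.disj (.eq 10 11) (.cell 48 10 11))))

theorem spec_buildCutGraph {N : Fin n → Fin n → Prop} {E A : Set (Fin n)} :
    Spec n (fun s => s.HasInput G X Y ∧ s.HoldsSet 12 E ∧ s.HoldsSet 45 A ∧ s.HoldsRel 48 N)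
      buildCutGraph fun s => s.HasInput G X Y ∧ s.HoldsSet 49 (E ∩ A) ∧
      s.HoldsRel 48 (PathIn N (E ∩ A)ᶜ) ∧ s.HoldsSet 51 (sources N X (E ∩ A)) ∧
      s.HoldsSet 52 (targets N Y (E ∩ A)) ∧ s.HoldsRel 30 (cutGraph N X Y (E ∩ A)) := by
  refine Spec.seq (Q := fun s => s.HasInput G X Y ∧ s.HoldsRel 48 N ∧ s.HoldsSet 49 (E ∩ A))
    (fun s ⟨hin, h12, h45, h48⟩ => ⟨hin.run (by decide), h48.run (by decide), ?_⟩) ?_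
  · refine holdsSet_fillCol hin.h9 (by decide) fun v => ?_
    simp [Formula.Holds, hin.h9, h12.iff, h45.iff]
  generalize E ∩ A = M
  refine Spec.seq (Q := fun s => s.HasInput G X Y ∧ s.HoldsRel 48 N ∧ s.HoldsSet 49 M ∧
      s.HoldsSet 50 Mᶜ)
    (fun s ⟨hin, h48, h49⟩ => ⟨hin.run (by decide), h48.run (by decide), h49.run (by decide),
      ?_⟩) ?_
  · refine holdsSet_fillCol hin.h9 (by decide) fun v => ?_
    simp [Formula.Holds, hin.h9, h49.iff]
  refine Spec.seq (Q := fun s => s.HasInput G X Y ∧ s.HoldsSet 49 M ∧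
      s.HoldsRel 48 (PathIn N Mᶜ))
    (fun s ⟨hin, h48, h49, h50⟩ => ⟨hin.run (by decide), h49.run (by decide),
      holdsRel_closure hin.h9 (by decide) (by decide) (by decide) h48 h50⟩) ?_
  refine Spec.seq (Q := fun s => s.HasInput G X Y ∧ s.HoldsSet 49 M ∧
      s.HoldsRel 48 (PathIn N Mᶜ) ∧ s.HoldsSet 51 (sources N X M))
    (fun s ⟨hin, h49, h48⟩ => ⟨hin.run (by decide), h49.run (by decide), h48.run (by decide),
      ?_⟩) ?_
  · refine holdsSet_fillCol hin.h9 (by decide) fun v => ?_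
    simp [Formula.Holds, hin.h9, h49.iff, hin.X.iff, h48.iff, sources]
  refine Spec.seq (Q := fun s => s.HasInput G X Y ∧ s.HoldsSet 49 M ∧
      s.HoldsRel 48 (PathIn N Mᶜ) ∧ s.HoldsSet 51 (sources N X M) ∧
      s.HoldsSet 52 (targets N Y M))
    (fun s ⟨hin, h49, h48, h51⟩ => ⟨hin.run (by decide), h49.run (by decide),
      h48.run (by decide), h51.run (by decide), ?_⟩) ?_
  · refine holdsSet_fillCol hin.h9 (by decide) fun v => ?_
    simp [Formula.Holds, hin.h9, h49.iff, hin.Y.iff, h48.iff, targets]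
  · refine fun s ⟨hin, h49, h48, h51, h52⟩ => ⟨hin.run (by decide), h49.run (by decide),
      h48.run (by decide), h51.run (by decide), h52.run (by decide), ?_⟩
    refine holdsRel_fillMat (by decide) fun u v => ?_
    simp only [Formula.Holds, State.setReg_reg, State.setReg_arr]
    simp [hin.h9, h49.iff, h48.iff, h51.iff, h52.iff, cutGraph, Fin.val_inj]

/-- A minimum separator. -/
def lineSep : Cmd :=
  .seq moralize <| .seq buildCutGraph <| .seq maxMatching <|
  .seq (fillCol 15 (.conj (.cell 49 10 9) (.conj (.disj (.cell 51 10 9) (.cell 32 10 9))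
    (.disj (.cell 52 10 9) (.ex 12 (.conj (.cell 31 10 12) (.neg (.cell 32 12 9)))))))) <|
  .test 1 (.neg (.ex 12 (.conj (.cell 2 12 9) (.ex 13 (.conj (.cell 3 13 9) (.cell 48 12 13))))))

/-- With unit weights a cut of minimum cardinality is wanted. It is computed in any case; the final
test only decides whether it counts as a separator or the answer is failure. -/
theorem spec_lineSep (hXY : Disjoint X Y) :
    Spec n (fun s => s.HasInput G X Y ∧ s.HoldsRel 8 (G.pbd X Y).dir ∧
      s.HoldsRel 9 (G.pbd X Y).bi ∧ s.HoldsSet 12 (G.setE2 X Y)) lineSep fun s =>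
    ∃ N, (G.pbd X Y).IsFindMinCostSepOutput X Y ∅ (G.setE2 X Y) (fun _ => 1) N ∧
      s.HoldsOption 1 15 (N.map fun Z => (Z : Set (Fin n))) := by
  refine Spec.seq spec_moralize (Spec.seq spec_buildCutGraph ?_)
  set N := (G.pbd X Y).MoralAdj ((G.pbd X Y).An (X ∪ Y)) with hN
  set M := G.setE2 X Y ∩ (G.pbd X Y).An (X ∪ Y) with hM
  refine Spec.seq (Q := fun s => s.HasInput G X Y ∧ s.HoldsSet 49 M ∧
      s.HoldsRel 48 (PathIn N Mᶜ) ∧ s.HoldsSet 51 (sources N X M) ∧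
      s.HoldsSet 52 (targets N Y M) ∧ ∃ m ρ, s.HoldsRel 31 m ∧ s.HoldsSet 32 ρ ∧
        IsMatching (cutGraph N X Y M) m ∧ Stuck (cutGraph N X Y M) m ρ)
    (fun s ⟨hin, h49, h48, h51, h52, h30⟩ => ⟨hin.run (by decide), h49.run (by decide),
      h48.run (by decide), h51.run (by decide), h52.run (by decide),
      run_maxMatching hin.h0 hin.h9 h30⟩) ?_
  refine Spec.seq (Q := fun s => s.HasInput G X Y ∧ s.HoldsRel 48 (PathIn N Mᶜ) ∧
      ∃ m ρ, IsMatching (cutGraph N X Y M) m ∧ Stuck (cutGraph N X Y M) m ρ ∧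
        s.HoldsSet 15 (coverCut N X Y M {u | ∃ w, m u w ∧ w ∉ ρ} ρ))
    (fun s ⟨hin, h49, h48, h51, h52, m, ρ, h31, h32, hm, hs⟩ => ⟨hin.run (by decide),
      h48.run (by decide), m, ρ, hm, hs, ?_⟩) ?_
  · refine holdsSet_fillCol hin.h9 (by decide) fun v => ?_
    simp only [Formula.Holds, State.setReg_reg, State.setReg_arr]
    simp [hin.h9, h49.iff, h51.iff, h52.iff, h31.iff, h32.iff, coverCut]
    tauto
  · classical
    rintro s ⟨hin, h48, m, ρ, hm, hs, h15⟩
    have htest : Formula.Holds n (.neg (.ex 12 (.conj (.cell 2 12 9)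
        (.ex 13 (.conj (.cell 3 13 9) (.cell 48 12 13)))))) s ↔
        ¬ ∃ x ∈ X, ∃ y ∈ Y, PathIn N Mᶜ x y := by
      simp [Formula.Holds, hin.h9, hin.X.iff, hin.Y.iff, h48.iff]
    rw [run, truthValue_congr htest]
    by_cases hp : ∃ x ∈ X, ∃ y ∈ Y, PathIn N Mᶜ x y
    · refine ⟨none, isFindMinCostSepOutput_none hp _, ?_⟩
      simp only [State.HoldsOption, State.setReg_reg, if_true]
      exact truthValue_of_false (not_not.2 hp)
    · refine ⟨_, isFindMinCostSepOutput_some hXY hp hm hs, ?_⟩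
      simp only [State.HoldsOption, State.setReg_reg, if_true]
      refine ⟨truthValue_of_true hp, ?_⟩
      rw [Set.coe_toFinset]
      exact h15

/-- The value that is returned. -/
def lineReturn : Cmd :=
  .seq (.copy 2 1) (fillCol 16 (.disj (.cell 15 10 9)
    (.ex 12 (.conj (.cell 15 12 9) (.cell 27 12 10)))))

theorem spec_lineReturn {N : Option (Finset (Fin n))} : Spec n (fun s => s.HasInput G X Y ∧
      s.HoldsRel 27 (fun v r => v ∈ G.Vm ∧ G.ind v = r) ∧
      s.HoldsOption 1 15 (N.map fun Z => (Z : Set (Fin n)))) lineReturn fun s =>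
    s.HoldsOption 2 16 (N.map fun Z => G.withIndicators (Z : Set (Fin n))) := by
  rintro s ⟨hin, h27, hN⟩
  have h2 : (lineReturn.run n s).reg 2 = s.reg 1 := by
    rw [lineReturn, run_seq, run_reg _ (by decide)]; simp [run]
  cases N with
  | none => simpa [State.HoldsOption, h2] using hN
  | some Z =>
    refine ⟨h2.trans hN.1, holdsSet_fillCol (by simp [run, hin.h9]) (by decide) fun v => ?_⟩
    have h15 := State.HoldsSet.iff hN.2
    simp only [run, Formula.Holds, State.setReg_reg, State.setReg_arr]
    simp [hin.h9, h15, h27.iff, MGraph.withIndicators, and_assoc]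

/-- The lines of the algorithm one after the other. -/
def allLines : Cmd :=
  .seq lineBackdoor <| .seq lineE <| .seq lineE1 <| .seq lineE2 <|
    .seq (fillCol 13 (.eq 0 0)) <| .seq (fillCol 14 .false) <| .seq lineSep lineReturn

theorem isBigO_cost {c : Cmd} {k : ℕ} (hc : c.depth ≤ k) :
    (fun n => (c.cost n : ℝ)) =O[Filter.atTop] (fun n => (n : ℝ) ^ k) := by
  obtain ⟨C, hC⟩ := c.exists_cost_le
  -- The factor `2 ^ k` comes from `n + 1 ≤ 2 * n` for `n ≥ 1`.
  refine Asymptotics.IsBigO.of_bound (C * 2 ^ k) ?_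
  filter_upwards [Filter.eventually_ge_atTop 1] with n hn
  rw [Real.norm_of_nonneg (by positivity), Real.norm_of_nonneg (by positivity)]
  have h : c.cost n ≤ C * 2 ^ k * n ^ k := calc
    c.cost n ≤ C * (n + 1) ^ c.depth := hC n
    _ ≤ C * (n + 1) ^ k := by gcongr; omega
    _ ≤ C * (2 * n) ^ k := by gcongr; omega
    _ = C * 2 ^ k * n ^ k := by rw [mul_pow, mul_assoc]
  exact_mod_cast h

end Cmd

end MissingData

/-! ### Assembly of the program -/

open MissingData in
theorem theorem5 :
    ∃ (c : MissingData.Code) (T : ℕ → ℕ),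
      (fun n => (T n : ℝ)) =O[Filter.atTop] (fun n => (n : ℝ) ^ 3) ∧
      ∀ (n : ℕ) (G : MissingData.MGraph n) (X Y : Set (Fin n)),
        X ⊆ G.Vo ∪ G.Vm → Y ⊆ G.Vo ∪ G.Vm → Disjoint X Y →
          ∃ t ≤ T n, c.RunsFindMinAdjSet G X Y t := by
  -- Scratch registers begin at `50`, above all registers that the commands name. The final `decide`
  -- checks that loops and quantifiers are nested at most three deep.
  refine ⟨⟨Cmd.lineBackdoor.prog 50, Cmd.lineE.prog 50, Cmd.lineE1.prog 50, Cmd.lineE2.prog 50,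
    (Cmd.fillCol 13 (.eq 0 0)).prog 50, (Cmd.fillCol 14 .false).prog 50, Cmd.lineSep.prog 50,
    Cmd.lineReturn.prog 50⟩, fun n => Cmd.allLines.cost n, Cmd.isBigO_cost (by decide), ?_⟩
  intro n G X Y hX _ hXY
  have hin₁ := Cmd.hasInput_inputState G X Y
  obtain ⟨t₂, ht₂, s₂, he₂, ha₂, h0₂⟩ := Cmd.lineBackdoor.exec_prog (d := 50) (by decide) hin₁.h0
    (by decide) (s := inputState G X Y) ⟨rfl, fun _ _ => rfl⟩
  obtain ⟨hin₂, h8, h9, h20⟩ := Cmd.spec_lineBackdoor _ hin₁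
  generalize Cmd.lineBackdoor.run n (inputState G X Y) = u₂ at *
  obtain ⟨t₃, ht₃, s₃, he₃, ha₃, h0₃⟩ := Cmd.lineE.exec_prog (by decide) h0₂ (by decide) ha₂
  obtain ⟨h10, h23⟩ := Cmd.spec_lineE _ ⟨hin₂, h20⟩
  have hin₃ := hin₂.run (c := Cmd.lineE) (by decide)
  have h8₃ := h8.run (c := Cmd.lineE) (by decide)
  have h9₃ := h9.run (c := Cmd.lineE) (by decide)
  generalize Cmd.lineE.run n u₂ = u₃ at *
  obtain ⟨t₄, ht₄, s₄, he₄, ha₄, h0₄⟩ := Cmd.lineE1.exec_prog (by decide) h0₃ (by decide) ha₃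
  obtain ⟨h11, h27⟩ := Cmd.spec_lineE1 hX hXY _ ⟨hin₃, h8₃, h9₃, h10⟩
  have hin₄ := hin₃.run (c := Cmd.lineE1) (by decide)
  have h8₄ := h8₃.run (c := Cmd.lineE1) (by decide)
  have h9₄ := h9₃.run (c := Cmd.lineE1) (by decide)
  have h23₄ := h23.run (c := Cmd.lineE1) (by decide)
  generalize Cmd.lineE1.run n u₃ = u₄ at *
  obtain ⟨t₅, ht₅, s₅, he₅, ha₅, h0₅⟩ := Cmd.lineE2.exec_prog (by decide) h0₄ (by decide) ha₄
  have h12 := Cmd.spec_lineE2 _ ⟨hin₄, h8₄, h9₄, h11, h23₄, h27⟩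
  have hin₅ := hin₄.run (c := Cmd.lineE2) (by decide)
  have h8₅ := h8₄.run (c := Cmd.lineE2) (by decide)
  have h9₅ := h9₄.run (c := Cmd.lineE2) (by decide)
  have h27₅ := h27.run (c := Cmd.lineE2) (by decide)
  generalize Cmd.lineE2.run n u₄ = u₅ at *
  obtain ⟨t₆, ht₆, s₆, he₆, ha₆, h0₆⟩ := (Cmd.fillCol 13 (.eq 0 0)).exec_prog (by decide) h0₅
    (by decide) ha₅
  -- The weight function `1` is the characteristic vector of the set of all vertices.
  have h13 : ((Cmd.fillCol 13 (.eq 0 0)).run n u₅).HoldsSet 13 (Set.univ : Set (Fin n)) :=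
    Cmd.holdsSet_fillCol hin₅.h9 (by decide) fun v => by simp [Formula.Holds]
  have hin₆ := hin₅.run (c := Cmd.fillCol 13 (.eq 0 0)) (by decide)
  have h8₆ := h8₅.run (c := Cmd.fillCol 13 (.eq 0 0)) (by decide)
  have h9₆ := h9₅.run (c := Cmd.fillCol 13 (.eq 0 0)) (by decide)
  have h12₆ := h12.run (c := Cmd.fillCol 13 (.eq 0 0)) (by decide)
  have h27₆ := h27₅.run (c := Cmd.fillCol 13 (.eq 0 0)) (by decide)
  generalize (Cmd.fillCol 13 (.eq 0 0)).run n u₅ = u₆ at *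
  obtain ⟨t₇, ht₇, s₇, he₇, ha₇, h0₇⟩ := (Cmd.fillCol 14 .false).exec_prog (by decide) h0₆
    (by decide) ha₆
  have h14 : ((Cmd.fillCol 14 .false).run n u₆).HoldsSet 14 (∅ : Set (Fin n)) :=
    Cmd.holdsSet_fillCol hin₆.h9 (by decide) fun v => by simp [Formula.holds_false]
  have hin₇ := hin₆.run (c := Cmd.fillCol 14 .false) (by decide)
  have h8₇ := h8₆.run (c := Cmd.fillCol 14 .false) (by decide)
  have h9₇ := h9₆.run (c := Cmd.fillCol 14 .false) (by decide)
  have h12₇ := h12₆.run (c := Cmd.fillCol 14 .false) (by decide)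
  have h27₇ := h27₆.run (c := Cmd.fillCol 14 .false) (by decide)
  generalize (Cmd.fillCol 14 .false).run n u₆ = u₇ at *
  obtain ⟨t₈, ht₈, s₈, he₈, ha₈, h0₈⟩ := Cmd.lineSep.exec_prog (by decide) h0₇ (by decide) ha₇
  obtain ⟨N, hN, h15⟩ := Cmd.spec_lineSep hXY _ ⟨hin₇, h8₇, h9₇, h12₇⟩
  have hin₈ := hin₇.run (c := Cmd.lineSep) (by decide)
  have h27₈ := h27₇.run (c := Cmd.lineSep) (by decide)
  generalize Cmd.lineSep.run n u₇ = u₈ at *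
  obtain ⟨t₉, ht₉, s₉, he₉, ha₉, -⟩ := Cmd.lineReturn.exec_prog (by decide) h0₈ (by decide) ha₈
  have h16 := Cmd.spec_lineReturn _ ⟨hin₈, h27₈, h15⟩
  -- Machine states equal the abstract ones up to scratch registers, so facts about arrays and low
  -- registers carry over.
  have harr : ∀ {s u : State}, s.Agree 50 u → ∀ a, s.arr a = u.arr a := fun h a => by rw [h.1]
  have hopt : ∀ {s u : State}, s.Agree 50 u → ∀ x < 50, ∀ {a : ℕ} {O : Option (Set (Fin n))},
      u.HoldsOption x a O → s.HoldsOption x a O := by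
    intro s u h x hx a O hO
    cases O with
    | none => exact (h.2 x hx).trans hO
    | some S => exact ⟨(h.2 x hx).trans hO.1, State.HoldsSet.congr hO.2 (harr h a)⟩
  refine ⟨_, ?_, s₂, s₃, s₄, s₅, s₆, s₇, s₈, s₉, t₂, t₃, t₄, t₅, t₆, t₇, t₈, t₉, N,
    ⟨he₂, h8.congr (harr ha₂ 8), h9.congr (harr ha₂ 9)⟩, ⟨he₃, h10.congr (harr ha₃ 10)⟩,
    ⟨he₄, h11.congr (harr ha₄ 11)⟩, ⟨he₅, h12.congr (harr ha₅ 12)⟩, ⟨he₆, fun v => ?_⟩,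
    ⟨he₇, h14.congr (harr ha₇ 14)⟩, ⟨he₈, hN, hopt ha₈ 1 (by decide) h15⟩,
    ⟨he₉, hopt ha₉ 2 (by decide) h16⟩,
    .seq he₂ <| .seq he₃ <| .seq he₄ <| .seq he₅ <| .seq he₆ <| .seq he₇ <| .seq he₈ he₉⟩
  · simp only [Cmd.allLines, Cmd.cost] at *
    omega
  · rw [harr ha₆ 13, h13 v]
    exact truthValue_of_true trivial
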